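/- **Setting.** Let $\mathbb S^1=\mathbb R/\mathbb Z$ with arc-length distance and Lebesgue probability measure $m$. Fix $\lambda>1$ and $A_*\in\mathbb R$, and let $\mathcal M$ be the set of $C^2$ maps $T:\mathbb S^1\to\mathbb S^1$ with $T'\ge\lambda$ and $\|T''\|_\infty\le A_*$. For a sequence $(T_i)_{i\ge1}\subset\mathcal M$ put $\mathcal T_i=T_i\circ\cdots\circ T_1$, $\mathcal T_0=\mathrm{id}$, and $\mathcal L_{c,a}=\mathcal L_{T_c}\cdots\mathcal L_{T_a}$ $(a\le c)$, where $\mathcal L_Tg(x)=\sum_{Ty=x}g(y)/T'(y)$. Let $\mu$ be the probability measure with density $\varrho>0$ with respect to $m$, where $\log\varrho$ is Lipschitz with constant $L_0\geq 0$, and let $f:\mathbb S^1\to\mathbb R$ be Lipschitz, $\|f\|_{\mathrm{Lip}}=\|f\|_\infty+\mathrm{Lip}(f)$. Put $$\bar f^i=f\circ\mathcal T_i-\mu(f\circ\mathcal T_i),\qquad W=W(N)=\frac1{\sqrt N}\sum_{i=0}^{N-1}\bar f^i,\qquad \sigma_N=\sqrt{\mu(W^2)}.$$ Let $Z$ be standard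 normal, and let $d_{\mathscr W}(X,Y)=\sup_h|\mathbb E h(X)-\mathbb E h(Y)|$, the supremum being over all $1$-Lipschitz $h:\mathbb R\to\mathbb R$. For $L\ge0$ let $\mathcal D_L$ be the class of probability densities $\psi>0$ on $\mathbb S^1$ for which there is a point $z$ such that $\log\psi$ is $L$-Lipschitz along the open arc $\mathbb S^1\setminus\{z\}$ (with respect to the distance along that arc). Put $L_*=A_*\lambda(1-\lambda^{-1})^{-2}$ and $L_1=\max\{L_*,L_0\}$. For $\vartheta\in[\lambda^{-1},1)$ and constants $B_0,C_2,C_4>0$ consider the conditions: * **(M)** $\|\mathcal L_{c,a}\psi_1-\mathcal L_{c,b}\psi_2\|_{L^1(m)}\le B_0\vartheta^{c-b+1}$ for all sequences in $\mathcal M$, all $\psi_1,\psi_2\in\mathcal D_{L_1}$ and all $1\le a\le b\le c$; * **(C)** for all $0\le i\le j\le k\le l$: $|\mu(\bar f^i\bar f^j)|\le C_2\vartheta^{j-i}$, $|\mu(\bar f^i\bar f^j\bar f^k\bar f^l)|\le C_4\vartheta^{\max\{j-i,\,l-k\}}$ and $|\mu(\bar f^i\bar f^j\bar f^k\bar f^l)-\mu(\bar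 f^i\bar f^j)\mu(\bar f^k\bar f^l)|\le C_4\vartheta^{k-j}$. **Theorem 3.2.** 1. There is $\vartheta=\vartheta(\lambda,A_*)\in[\lambda^{-1},1)$ such that, for every $L_0\ge0$, condition (M) holds with some $B_0=B_0(L_0,\lambda,A_*)>0$, and such that, for every $L_0\ge 0$ and $M$, there are $C_2,C_4>0$ depending only on $\lambda,A_*,M,L_0$ such that (C) holds for all $(T_i)\subset\mathcal M$, all $\varrho$ as above and all Lipschitz $f$ with $\|f\|_{\mathrm{Lip}}\le M$. 2. Let $\vartheta\in[\lambda^{-1},1)$ and $B_0,C_2,C_4>0$ be any constants satisfying (M), and (C) for the given $(T_i)\subset\mathcal M$, $\varrho$ and $f$. Let $N\ge 16/(1-\vartheta)^2$ and $\sigma_N\ge C_0N^{-p}$, where $C_0>0$, $p\ge0$. Then $$d_{\mathscr W}(W,\sigma_NZ)\le\tilde C\max\{1,C_0^{-2}\}\,N^{-\frac12+2p}\log N,$$ where $$\tilde C=\frac{60\max\{C_2,\sqrt{C_4}\}(1+\|f\|_\infty)}{(1-\vartheta)^2}+\frac{4\|f\|_{\mathrm{Lip}}^2}{\vartheta^{-1/2}-\vartheta^{1/2}}+8B_0\|f\|_{\mathrm{Lip}}+\frac{4\|f\|_{\mathrm{Lip}}}{\vartheta^{1/2}}$$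 is independent of $N$. -/

import Mathlib

open MeasureTheory ProbabilityTheory
open scoped NNReal ENNReal

noncomputable section

namespace CircleCLT

/-- The circle `ℝ / ℤ`, with its arc-length distance and its Lebesgue measure `volume`
(of total mass one). -/
abbrev S1 : Type := UnitAddCircle

/-- A `C²` expanding map `T` of the circle with `T' ≥ lam` and `|T''| ≤ A`. Smoothness and the
derivatives of `T` are those of a lift of `T` to the real line; two lifts of the same map differ
by an integer constant, so they have the same derivatives. -/
structure ExpandingMap (lam A : ℝ) where
  /-- the map of the circle -/
  toFun : S1 → S1
  /-- a lift to the line -/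
  lift : ℝ → ℝ
  coe_lift : ∀ x : ℝ, ((lift x : ℝ) : S1) = toFun (x : S1)
  contDiff_lift : ContDiff ℝ 2 lift
  le_deriv : ∀ x : ℝ, lam ≤ deriv lift x
  abs_deriv_deriv_le : ∀ x : ℝ, |deriv (deriv lift) x| ≤ A

/-- The derivative `T'` as a function on the circle (the derivative of the lift is `1`-periodic,
so the choice of the representative in `[0, 1)` does not matter). -/
def ExpandingMap.derivative {lam A : ℝ} (T : ExpandingMap lam A) (y : S1) : ℝ :=
  deriv T.lift (AddCircle.equivIco (1 : ℝ) 0 y : ℝ)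

/-- `𝒯_i = T_i ∘ ⋯ ∘ T_1`, with `𝒯_0 = id`. -/
def compose {lam A : ℝ} (T : ℕ → ExpandingMap lam A) : ℕ → S1 → S1
  | 0 => id
  | i + 1 => (T (i + 1)).toFun ∘ compose T i

/-- The transfer operator `(ℒ_T g)(x) = ∑_{T y = x} g(y) / T'(y)` (a finite sum). -/
def transfer {lam A : ℝ} (T : ExpandingMap lam A) (g : S1 → ℝ) (x : S1) : ℝ :=
  ∑ᶠ (y : S1) (_ : T.toFun y = x), g y / T.derivative y

/-- `transferFrom T a k = ℒ_{T_{a+k-1}} ⋯ ℒ_{T_a}`, that is, `k` steps starting with `T_a`. -/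
def transferFrom {lam A : ℝ} (T : ℕ → ExpandingMap lam A) (a : ℕ) : ℕ → (S1 → ℝ) → S1 → ℝ
  | 0, g => g
  | k + 1, g => transfer (T (a + k)) (transferFrom T a k g)

/-- `ℒ_{c,a} = ℒ_{T_c} ⋯ ℒ_{T_a}`, for `a ≤ c`. -/
def transferBetween {lam A : ℝ} (T : ℕ → ExpandingMap lam A) (c a : ℕ) : (S1 → ℝ) → S1 → ℝ :=
  transferFrom T a (c + 1 - a)

/-- The class `𝒟_L`: positive probability densities `ψ` on the circle such that, for some point
`z`, `log ψ` is `L`-Lipschitz on the open arc of length one obtained by removing `z`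
(with respect to the distance along that arc; `ψ` may jump at `z`). -/
def IsDensityClass (L : ℝ) (ψ : S1 → ℝ) : Prop :=
  (∀ x, 0 < ψ x) ∧ ∫ x, ψ x = 1 ∧
    ∃ z : ℝ, ∀ x ∈ Set.Ioo z (z + 1), ∀ y ∈ Set.Ioo z (z + 1),
      |Real.log (ψ (x : S1)) - Real.log (ψ (y : S1))| ≤ L * |x - y|

/-- `L_* = A λ (1 - λ⁻¹)⁻²`. -/
def regularityConst (lam A : ℝ) : ℝ := A * lam * ((1 - lam⁻¹) ^ 2)⁻¹

/-- Memory loss: with `L₁ = max {L_*, L₀}`, for all densities `ψ₁, ψ₂` of class `𝒟_{L₁}`, all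
sequences of maps and all `1 ≤ a ≤ b ≤ c`,
`‖ℒ_{c,a} ψ₁ - ℒ_{c,b} ψ₂‖_{L¹} ≤ B₀ ϑ ^ (c - b + 1)`. -/
def MemoryLoss (lam A L₀ ϑ B₀ : ℝ) : Prop :=
  ∀ (T : ℕ → ExpandingMap lam A) (ψ₁ ψ₂ : S1 → ℝ),
    IsDensityClass (max (regularityConst lam A) L₀) ψ₁ →
    IsDensityClass (max (regularityConst lam A) L₀) ψ₂ →
    ∀ a b c : ℕ, 1 ≤ a → a ≤ b → b ≤ c →
      ∫ x, |transferBetween T c a ψ₁ x - transferBetween T c b ψ₂ x| ≤ B₀ * ϑ ^ (c - b + 1)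

/-- Initial densities: positive probability densities `ϱ` on the circle such that `log ϱ` is
Lipschitz continuous with constant `L₀`. -/
structure IsInitialDensity (L₀ : ℝ≥0) (ϱ : S1 → ℝ) : Prop where
  pos : ∀ x, 0 < ϱ x
  integral_eq_one : ∫ x, ϱ x = 1
  lipschitz_log : LipschitzWith L₀ (fun x => Real.log (ϱ x))

/-- The measure with density `ϱ` with respect to Lebesgue measure. -/
def initialMeasure (ϱ : S1 → ℝ) : Measure S1 :=
  (volume : Measure S1).withDensity (fun x => ENNReal.ofReal (ϱ x))

/-- `‖f‖_∞`. -/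
def supNorm (f : S1 → ℝ) : ℝ := ⨆ x, |f x|

/-- `Lip(f)`, the least Lipschitz constant. -/
def lipConst (f : S1 → ℝ) : ℝ := ((sInf {K : ℝ≥0 | LipschitzWith K f} : ℝ≥0) : ℝ)

/-- `‖f‖_Lip = ‖f‖_∞ + Lip(f)`. -/
def lipNorm (f : S1 → ℝ) : ℝ := supNorm f + lipConst f

/-- `f̄^i = f ∘ 𝒯_i - μ(f ∘ 𝒯_i)`. -/
def centered {lam A : ℝ} (μ : Measure S1) (T : ℕ → ExpandingMap lam A) (f : S1 → ℝ) (i : ℕ)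
    (x : S1) : ℝ :=
  f (compose T i x) - ∫ y, f (compose T i y) ∂μ

/-- `W(N) = N^{-1/2} ∑_{i < N} f̄^i`. -/
def normalizedSum {lam A : ℝ} (μ : Measure S1) (T : ℕ → ExpandingMap lam A) (f : S1 → ℝ) (N : ℕ)
    (x : S1) : ℝ :=
  (Real.sqrt N)⁻¹ * ∑ i ∈ Finset.range N, centered μ T f i x

/-- `σ_N`, the nonnegative square root of `σ_N² = μ(W(N)²)`. -/
def sigma {lam A : ℝ} (μ : Measure S1) (T : ℕ → ExpandingMap lam A) (f : S1 → ℝ) (N : ℕ) : ℝ :=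
  Real.sqrt (∫ x, normalizedSum μ T f N x ^ 2 ∂μ)

/-- Decay of the second and fourth order correlations of `(f̄^i)` at rate `ϑ ^ n`, with
constants `C₂` and `C₄`. -/
structure CorrelationDecay {lam A : ℝ} (μ : Measure S1) (T : ℕ → ExpandingMap lam A) (f : S1 → ℝ)
    (ϑ C₂ C₄ : ℝ) : Prop where
  two : ∀ i j : ℕ, i ≤ j →
    |∫ x, centered μ T f i x * centered μ T f j x ∂μ| ≤ C₂ * ϑ ^ (j - i)
  four : ∀ i j k l : ℕ, i ≤ j → j ≤ k → k ≤ l →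
    |∫ x, centered μ T f i x * centered μ T f j x * centered μ T f k x * centered μ T f l x ∂μ|
      ≤ C₄ * ϑ ^ max (j - i) (l - k)
  split : ∀ i j k l : ℕ, i ≤ j → j ≤ k → k ≤ l →
    |(∫ x, centered μ T f i x * centered μ T f j x * centered μ T f k x * centered μ T f l x ∂μ)
        - (∫ x, centered μ T f i x * centered μ T f j x ∂μ)
          * ∫ x, centered μ T f k x * centered μ T f l x ∂μ|
      ≤ C₄ * ϑ ^ (k - j)

/-- The Wasserstein distance `sup_h |E h(X) - E h(Y)|`, over all `1`-Lipschitz `h : ℝ → ℝ`, of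
two real random variables (which may live on different probability spaces). -/
def wassersteinDist {Ω Ω' : Type*} [MeasurableSpace Ω] [MeasurableSpace Ω']
    (P : Measure Ω) (X : Ω → ℝ) (Q : Measure Ω') (Y : Ω' → ℝ) : ℝ≥0∞ :=
  ⨆ (h : ℝ → ℝ) (_ : LipschitzWith 1 h), ENNReal.ofReal |(∫ ω, h (X ω) ∂P) - ∫ ω, h (Y ω) ∂Q|

/-- The constant `C̃` in terms of `ϑ, C₂, C₄, B₀`, `‖f‖_∞` and `‖f‖_Lip`. -/
def tildeC (ϑ C₂ C₄ B₀ : ℝ) (f : S1 → ℝ) : ℝ :=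
  60 * max C₂ (Real.sqrt C₄) * (1 + supNorm f) / (1 - ϑ) ^ 2
    + 4 * lipNorm f ^ 2 / (ϑ ^ (-(1 / 2 : ℝ)) - ϑ ^ (1 / 2 : ℝ))
    + 8 * B₀ * lipNorm f
    + 4 * lipNorm f / ϑ ^ (1 / 2 : ℝ)

end CircleCLT

end

open MeasureTheory ProbabilityTheory CircleCLT
open scoped NNReal ENNReal

open MeasureTheory ProbabilityTheory
open scoped NNReal ENNReal

namespace CircleCLT

/-! ### The Stein equation of the standard normal distribution -/

/-! The rate comes from Stein's method with a block of indices removed around each time. For a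
differentiable `h` with `|h'| ≤ 1`, the equation `σ² g'(x) - x g(x) = h(x) - E h(σZ)` has a solution
with bounded `g`, `g'`, `g''` (`exists_stein_solution_scaled`), so it suffices to bound `E[σ² g'(W)
- W g(W)]`, where `σ² = E[W²]`. Write `W g(W) = N^{-1/2} ∑ X_n g(W)` with `X_n = f̄^n`, and let
`W_n` be `W` without the indices `|i - n| ≤ K`. Expanding `g(W_n)` around `W` leaves four errors
(`stein_block_bound`): the covariances off the band, the fluctuation of the band part of the
quadratic form, a quadratic Taylor remainder of order `K/√N`, and the terms `E[X_n g(W_n)]`. The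
fluctuation is small in `L²` because fourth order correlations decay.

The terms `E[X_n g(W_n)]` are exponentially small in the block length
(`abs_integral_centered_mul_block_le`). On a cylinder of `𝒯_m` functions of the past are almost
constant, by expansion. By bounded distortion, the normalized image of the initial density on a
cylinder lies in `𝒟_{L₁}`, so memory loss puts the law of a later state `𝒯_c`, conditioned on the
cylinder, within `ϑ^{c-m}` of its global law. Decoupling the future and then the past leaves `E[X_n]
= 0`. With `K = 2a - 1` and `a = ⌈log N/(1-ϑ)⌉` one has `ϑ^a ≤ 1/N`, and all errors are of order
`log N/√N` up to powers of `1/σ`.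

Memory loss itself is a coupling argument (`exists_memory_loss`). Transfer operators preserve
densities that are log-Lipschitz off one point. Each of them dominates a fixed fraction of its mass
in constant form; the same constant is subtracted from two densities, and one transfer step restores
the regularity of the remainders. Correlation decay (`correlationDecay_of_cone`) follows by
absorbing the observables into signed densities, which are differences of elements of the same cone.
-/

theorem stdGaussianPDF_eq (x : ℝ) :
    gaussianPDFReal 0 1 x = (Real.sqrt (2 * Real.pi))⁻¹ * Real.exp (-x ^ 2 / 2) := by
  simp [gaussianPDFReal]

theorem hasDerivAt_stdGaussianPDF (x : ℝ) :
    HasDerivAt (gaussianPDFReal 0 1) (-x * gaussianPDFReal 0 1 x) x := by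
  have h1 : HasDerivAt (fun x : ℝ => (Real.sqrt (2 * Real.pi))⁻¹ * Real.exp (-x ^ 2 / 2))
      ((Real.sqrt (2 * Real.pi))⁻¹ * (Real.exp (-x ^ 2 / 2) * (-(2 * x) / 2))) x := by
    have : HasDerivAt (fun x : ℝ => -x ^ 2 / 2) (-(2 * x) / 2) x := by
      simpa using ((hasDerivAt_pow 2 x).neg).div_const 2
    exact (this.exp).const_mul _
  have h2 : gaussianPDFReal 0 1
      = fun x : ℝ => (Real.sqrt (2 * Real.pi))⁻¹ * Real.exp (-x ^ 2 / 2) :=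
    funext stdGaussianPDF_eq
  rw [h2]
  refine HasDerivAt.congr_deriv h1 ?_
  ring

theorem stdGaussianPDF_pos (x : ℝ) : 0 < gaussianPDFReal 0 1 x :=
  gaussianPDFReal_pos 0 1 x one_ne_zero

theorem continuous_stdGaussianPDF : Continuous (gaussianPDFReal 0 1) :=
  continuous_iff_continuousAt.2 fun x => (hasDerivAt_stdGaussianPDF x).continuousAt

theorem tendsto_stdGaussianPDF_cocompact :
    Filter.Tendsto (gaussianPDFReal 0 1) (Filter.cocompact ℝ) (nhds 0) := by
  have h := (tendsto_rpow_abs_mul_exp_neg_mul_sq_cocompact (a := 1 / 2) (by norm_num) 0).const_mul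
    (Real.sqrt (2 * Real.pi))⁻¹
  simp only [mul_zero] at h
  refine h.congr fun x => ?_
  rw [stdGaussianPDF_eq]
  simp only [Real.rpow_zero, one_mul]
  ring_nf

theorem tendsto_abs_mul_stdGaussianPDF_cocompact :
    Filter.Tendsto (fun x => |x| * gaussianPDFReal 0 1 x) (Filter.cocompact ℝ) (nhds 0) := by
  have h := (tendsto_rpow_abs_mul_exp_neg_mul_sq_cocompact (a := 1 / 2) (by norm_num) 1).const_mul
    (Real.sqrt (2 * Real.pi))⁻¹
  simp only [mul_zero] at h
  refine h.congr fun x => ?_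
  rw [stdGaussianPDF_eq]
  simp only [Real.rpow_one]
  ring_nf

theorem integrable_gaussianReal_iff {g : ℝ → ℝ} :
    Integrable g (gaussianReal 0 1) ↔ Integrable (fun x => gaussianPDFReal 0 1 x * g x) := by
  rw [gaussianReal_of_var_ne_zero 0 one_ne_zero,
    integrable_withDensity_iff_integrable_smul' (measurable_gaussianPDF 0 1)
      (by filter_upwards with x using gaussianPDF_lt_top)]
  simp [toReal_gaussianPDF]

theorem integral_gaussianReal_eq (g : ℝ → ℝ) :
    ∫ x, g x ∂gaussianReal 0 1 = ∫ x, gaussianPDFReal 0 1 x * g x := by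
  simp [integral_gaussianReal_eq_integral_smul]

theorem integrable_id_gaussian : Integrable (fun x : ℝ => x) (gaussianReal 0 1) :=
  (memLp_id_gaussianReal (μ := 0) (v := 1) 1).integrable (by simp)

theorem integrable_sq_gaussian : Integrable (fun x : ℝ => x ^ 2) (gaussianReal 0 1) :=
  (memLp_id_gaussianReal (μ := 0) (v := 1) 2).integrable_sq

theorem integral_sq_gaussian : ∫ x, x ^ 2 ∂gaussianReal 0 1 = 1 := by
  have h := variance_id_gaussianReal (μ := 0) (v := 1)
  rw [variance_of_integral_eq_zero (by fun_prop) (by simp)] at h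
  simpa using h

theorem integrable_gaussian_of_lipschitz {h : ℝ → ℝ} {K : ℝ≥0} (hh : LipschitzWith K h) :
    Integrable h (gaussianReal 0 1) := by
  refine Integrable.mono' (g := fun x => |h 0| + K * |x|)
    ((integrable_const _).add (integrable_id_gaussian.abs.const_mul _))
    hh.continuous.aestronglyMeasurable (Filter.Eventually.of_forall fun x => ?_)
  have h1 := hh.dist_le_mul x 0
  rw [Real.dist_eq, Real.dist_eq, sub_zero] at h1
  have h2 := abs_sub_abs_le_abs_sub (h x) (h 0)
  rw [Real.norm_eq_abs]
  linarith

/-- The unnormalized solution of the Stein equation. -/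
noncomputable def steinPrimitive (h : ℝ → ℝ) (w : ℝ) : ℝ :=
  ∫ x in Set.Iic w, gaussianPDFReal 0 1 x * (h x - ∫ z, h z ∂gaussianReal 0 1)

theorem integrable_steinIntegrand {h : ℝ → ℝ} (hh : Integrable h (gaussianReal 0 1)) :
    Integrable (fun x => gaussianPDFReal 0 1 x * (h x - ∫ z, h z ∂gaussianReal 0 1)) :=
  integrable_gaussianReal_iff.1 (hh.sub (integrable_const _))

theorem integral_steinIntegrand {h : ℝ → ℝ} (hh : Integrable h (gaussianReal 0 1)) :
    ∫ x, gaussianPDFReal 0 1 x * (h x - ∫ z, h z ∂gaussianReal 0 1) = 0 := by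
  rw [← integral_gaussianReal_eq, integral_sub hh (integrable_const _)]
  simp

theorem hasDerivAt_steinPrimitive {h : ℝ → ℝ} (hh : Integrable h (gaussianReal 0 1))
    (hc : Continuous h) (w : ℝ) :
    HasDerivAt (steinPrimitive h)
      (gaussianPDFReal 0 1 w * (h w - ∫ z, h z ∂gaussianReal 0 1)) w := by
  set k := fun x => gaussianPDFReal 0 1 x * (h x - ∫ z, h z ∂gaussianReal 0 1) with hk
  have hkc : Continuous k := continuous_stdGaussianPDF.mul (hc.sub continuous_const)
  have hki : Integrable k := integrable_steinIntegrand hh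
  have h1 : steinPrimitive h = fun w => (∫ x in Set.Iic 0, k x) + ∫ x in (0 : ℝ)..w, k x := by
    funext w
    rw [← intervalIntegral.integral_Iic_sub_Iic hki.integrableOn hki.integrableOn]
    simp [steinPrimitive, hk]
  rw [h1]
  exact (intervalIntegral.integral_hasDerivAt_right (hkc.intervalIntegrable _ _)
    hkc.stronglyMeasurable.stronglyMeasurableAtFilter hkc.continuousAt).const_add _

/-- The integrand changes sign at most once, from negative to positive, and its total integral is
zero. -/
theorem steinPrimitive_nonpos_of_monotone {k : ℝ → ℝ} (hk : Monotone k)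
    (hi : Integrable k (gaussianReal 0 1)) (w : ℝ) : steinPrimitive k w ≤ 0 := by
  set c := ∫ z, k z ∂gaussianReal 0 1 with hc
  rcases le_total (k w) c with h | h
  · refine setIntegral_nonpos measurableSet_Iic fun x hx => ?_
    exact mul_nonpos_of_nonneg_of_nonpos (stdGaussianPDF_pos x).le
      (sub_nonpos.2 ((hk hx).trans h))
  · have h1 := integral_add_compl (measurableSet_Iic (a := w)) (integrable_steinIntegrand hi)
    rw [integral_steinIntegrand hi, Set.compl_Iic] at h1
    have h2 : 0 ≤ ∫ x in Set.Ioi w, gaussianPDFReal 0 1 x * (k x - c) := by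
      refine setIntegral_nonneg measurableSet_Ioi fun x hx => ?_
      exact mul_nonneg (stdGaussianPDF_pos x).le (sub_nonneg.2 (h.trans (hk (le_of_lt hx))))
    unfold steinPrimitive
    linarith

/-- The identity is the extremal Lipschitz function: its primitive is the envelope for all the
others. -/
theorem steinPrimitive_id (w : ℝ) : steinPrimitive (fun x => x) w = -gaussianPDFReal 0 1 w := by
  have h1 : ∀ x : ℝ, HasDerivAt (fun x => -gaussianPDFReal 0 1 x)
      (gaussianPDFReal 0 1 x * (x - ∫ z, z ∂gaussianReal 0 1)) x := by
    intro x
    refine HasDerivAt.congr_deriv (hasDerivAt_stdGaussianPDF x).neg ?_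
    simp; ring
  have h2 := integral_Iic_of_hasDerivAt_of_tendsto (a := w) (m := -0)
    (h1 w).continuousAt.continuousWithinAt (fun x _ => h1 x)
    (integrable_steinIntegrand integrable_id_gaussian).integrableOn
    ((tendsto_stdGaussianPDF_cocompact.mono_left atBot_le_cocompact).neg)
  rw [steinPrimitive, h2]; simp

theorem steinPrimitive_add {h k : ℝ → ℝ} (hh : Integrable h (gaussianReal 0 1))
    (hk : Integrable k (gaussianReal 0 1)) (w : ℝ) :
    steinPrimitive (fun x => h x + k x) w = steinPrimitive h w + steinPrimitive k w := by
  unfold steinPrimitive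
  rw [← integral_add (integrable_steinIntegrand hh).integrableOn
    (integrable_steinIntegrand hk).integrableOn, integral_add hh hk]
  congr 1; funext x; ring

theorem steinPrimitive_neg (h : ℝ → ℝ) (w : ℝ) :
    steinPrimitive (fun x => -h x) w = -steinPrimitive h w := by
  unfold steinPrimitive
  rw [← integral_neg, integral_neg]
  congr 1; funext x; ring

/-- Both `x + h x` and `x - h x` are increasing, so their primitives are nonpositive; subtracting
the primitive of the identity gives the two signs. -/
theorem abs_steinPrimitive_le {h : ℝ → ℝ} (hh : LipschitzWith 1 h) (w : ℝ) :
    |steinPrimitive h w| ≤ gaussianPDFReal 0 1 w := by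
  have hi := integrable_gaussian_of_lipschitz hh
  have hL : ∀ x y, x ≤ y → |h y - h x| ≤ y - x := fun x y hxy => by
    have := hh.dist_le_mul y x
    rw [Real.dist_eq, Real.dist_eq, abs_of_nonneg (sub_nonneg.2 hxy)] at this
    simpa using this
  have h1 := steinPrimitive_nonpos_of_monotone (k := fun x => x + h x)
    (fun x y hxy => by have := abs_le.1 (hL x y hxy); simp only; linarith)
    (integrable_id_gaussian.add hi) w
  have h2 := steinPrimitive_nonpos_of_monotone (k := fun x => x + -h x)
    (fun x y hxy => by have := abs_le.1 (hL x y hxy); simp only; linarith)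
    (integrable_id_gaussian.add hi.neg) w
  rw [steinPrimitive_add integrable_id_gaussian hi, steinPrimitive_id] at h1
  rw [steinPrimitive_add (k := fun x => -h x) integrable_id_gaussian hi.neg, steinPrimitive_neg,
    steinPrimitive_id] at h2
  rw [abs_le]; constructor <;> linarith

/-- The left side is at most `E|x - Z|`, and `2|u| ≤ u²/s + s`. The free parameter `s` replaces an
optimized Cauchy–Schwarz inequality. -/
theorem abs_sub_integral_gaussian_le {h : ℝ → ℝ} (hh : LipschitzWith 1 h) {x s : ℝ} (hs : 0 < s) :
    |h x - ∫ z, h z ∂gaussianReal 0 1| ≤ ((x ^ 2 + 1) / s + s) / 2 := by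
  have hi := integrable_gaussian_of_lipschitz hh
  have e : h x - ∫ z, h z ∂gaussianReal 0 1 = ∫ z, (h x - h z) ∂gaussianReal 0 1 := by
    rw [integral_sub (integrable_const _) hi]; simp
  have hsq : Integrable (fun z : ℝ => (x - z) ^ 2) (gaussianReal 0 1) := by
    have : (fun z : ℝ => (x - z) ^ 2) = fun z => (x ^ 2 - 2 * x * z) + z ^ 2 := by
      funext z; ring
    rw [this]
    exact ((integrable_const _).sub (integrable_id_gaussian.const_mul _)).add integrable_sq_gaussian
  have e2 : ∫ z, (x - z) ^ 2 ∂gaussianReal 0 1 = x ^ 2 + 1 := by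
    have : (fun z : ℝ => (x - z) ^ 2) = fun z => (x ^ 2 - 2 * x * z) + z ^ 2 := by
      funext z; ring
    have i1 : Integrable (fun z : ℝ => x ^ 2 - 2 * x * z) (gaussianReal 0 1) :=
      (integrable_const _).sub (integrable_id_gaussian.const_mul _)
    rw [this, integral_add i1 integrable_sq_gaussian, integral_sub (integrable_const _)
      (integrable_id_gaussian.const_mul _), integral_sq_gaussian, integral_const_mul]
    simp
  have h2 : ∫ z, ((x - z) ^ 2 / s + s) / 2 ∂gaussianReal 0 1 = ((x ^ 2 + 1) / s + s) / 2 := by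
    rw [integral_div, integral_add (hsq.div_const _) (integrable_const _), integral_div, e2]
    simp
  rw [e, ← h2, ← Real.norm_eq_abs]
  refine norm_integral_le_of_norm_le (((hsq.div_const _).add (integrable_const _)).div_const _)
    (Filter.Eventually.of_forall fun z => ?_)
  have h3 := hh.dist_le_mul x z
  rw [Real.dist_eq, Real.dist_eq] at h3
  simp only [NNReal.coe_one, one_mul] at h3
  rw [Real.norm_eq_abs]
  refine h3.trans ?_
  rw [← sq_abs (x - z)]
  have : 0 ≤ (|x - z| - s) ^ 2 / s := by positivity
  have h4 : (|x - z| - s) ^ 2 / s = |x - z| ^ 2 / s - 2 * |x - z| + s := by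
    field_simp; ring
  linarith

/-- A function with derivative bounded by `2 φ` that vanishes at infinity is at most
`2 φ(x) / x` at `x > 0`. -/
theorem mul_le_of_deriv_le_gaussian {v v' : ℝ → ℝ} (hv : ∀ x, HasDerivAt v (v' x) x)
    (hb : ∀ x, |v' x| ≤ 2 * gaussianPDFReal 0 1 x)
    (hlim : Filter.Tendsto v Filter.atTop (nhds 0)) {x : ℝ} (hx : 0 < x) :
    x * v x ≤ 2 * gaussianPDFReal 0 1 x := by
  have hd : ∀ y, HasDerivAt (fun y => v y - 2 / x * gaussianPDFReal 0 1 y)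
      (v' y - 2 / x * (-y * gaussianPDFReal 0 1 y)) y := fun y =>
    (hv y).sub ((hasDerivAt_stdGaussianPDF y).const_mul _)
  -- As `φ' = -yφ` and `y ≥ x`, the function `(2/x)φ` decreases at rate at least `2φ`, which `v`
  -- cannot exceed. The difference therefore increases to its limit `0` and is nonpositive at `x`.
  have hmono : MonotoneOn (fun y => v y - 2 / x * gaussianPDFReal 0 1 y) (Set.Ici x) := by
    refine monotoneOn_of_deriv_nonneg (convex_Ici x)
      (fun y _ => (hd y).continuousAt.continuousWithinAt)
      (fun y _ => (hd y).differentiableAt.differentiableWithinAt) fun y hy => ?_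
    rw [interior_Ici, Set.mem_Ioi] at hy
    rw [(hd y).deriv]
    have h1 := (abs_le.1 (hb y)).1
    have h2 : 1 ≤ y / x := (one_le_div hx).2 hy.le
    have h3 := stdGaussianPDF_pos y
    have h4 : 2 / x * (-y * gaussianPDFReal 0 1 y) = -(2 * (y / x) * gaussianPDFReal 0 1 y) := by
      ring
    rw [h4]
    nlinarith
  have hlim2 : Filter.Tendsto (fun y => v y - 2 / x * gaussianPDFReal 0 1 y) Filter.atTop
      (nhds 0) := by
    have := hlim.sub ((tendsto_stdGaussianPDF_cocompact.mono_left atTop_le_cocompact).const_mul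
      (2 / x))
    simpa using this
  have h5 : v x - 2 / x * gaussianPDFReal 0 1 x ≤ 0 := by
    refine ge_of_tendsto hlim2 ?_
    filter_upwards [Filter.eventually_ge_atTop x] with y hy
    exact hmono Set.self_mem_Ici hy hy
  have h6 : x * (v x - 2 / x * gaussianPDFReal 0 1 x) ≤ 0 :=
    mul_nonpos_of_nonneg_of_nonpos hx.le h5
  have h7 : x * (v x - 2 / x * gaussianPDFReal 0 1 x) = x * v x - 2 * gaussianPDFReal 0 1 x := by
    field_simp
  linarith

theorem abs_mul_le_of_deriv_le_gaussian {v v' : ℝ → ℝ} (hv : ∀ x, HasDerivAt v (v' x) x)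
    (hb : ∀ x, |v' x| ≤ 2 * gaussianPDFReal 0 1 x)
    (hlim : Filter.Tendsto v (Filter.cocompact ℝ) (nhds 0)) (x : ℝ) :
    |x * v x| ≤ 2 * gaussianPDFReal 0 1 x := by
  have pos : ∀ {v v' : ℝ → ℝ} (_ : ∀ x, HasDerivAt v (v' x) x)
      (_ : ∀ x, |v' x| ≤ 2 * gaussianPDFReal 0 1 x)
      (_ : Filter.Tendsto v (Filter.cocompact ℝ) (nhds 0)) {x : ℝ} (_ : 0 < x),
      |x * v x| ≤ 2 * gaussianPDFReal 0 1 x := by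
    intro v v' hv hb hlim x hx
    have h1 := mul_le_of_deriv_le_gaussian hv hb (hlim.mono_left atTop_le_cocompact) hx
    have h2 := mul_le_of_deriv_le_gaussian (v := fun x => -v x) (fun x => (hv x).neg)
      (fun x => by rw [abs_neg]; exact hb x)
      (by simpa using (hlim.mono_left atTop_le_cocompact).neg) hx
    rw [abs_le]; constructor <;> linarith
  rcases lt_trichotomy x 0 with hx | rfl | hx
  · have hev : ∀ y, gaussianPDFReal 0 1 (-y) = gaussianPDFReal 0 1 y := fun y => by
      simp [stdGaussianPDF_eq]
    have hneg : Filter.Tendsto (fun y : ℝ => -y) (Filter.cocompact ℝ) (Filter.cocompact ℝ) :=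
      (Homeomorph.neg ℝ).isClosedEmbedding.tendsto_cocompact
    have := pos (v := fun y => v (-y)) (v' := fun y => -v' (-y))
      (fun y => by simpa [Function.comp_def] using (hv (-y)).scomp y (hasDerivAt_neg y))
      (fun y => by rw [abs_neg, ← hev y]; exact hb (-y)) (hlim.comp hneg) (neg_pos.2 hx)
    rw [hev, neg_neg] at this
    simpa using this
  · simpa using (stdGaussianPDF_pos 0).le
  · exact pos hv hb hlim hx

/-- A solution of the Stein equation, with bounds on its derivatives. -/
theorem exists_stein_solution {h h' : ℝ → ℝ} (hd : ∀ x, HasDerivAt h (h' x) x)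
    (hb : ∀ x, |h' x| ≤ 1) :
    ∃ f f' f'' : ℝ → ℝ, (∀ x, HasDerivAt f (f' x) x) ∧ (∀ x, HasDerivAt f' (f'' x) x) ∧
      (∀ x, |f x| ≤ 1) ∧ (∀ x, |f' x| ≤ 5 / 2) ∧ (∀ x, |f'' x| ≤ 4) ∧
      ∀ x, f' x - x * f x = h x - ∫ z, h z ∂gaussianReal 0 1 := by
  have hL : LipschitzWith 1 h := lipschitzWith_of_nnnorm_deriv_le
    (fun x => (hd x).differentiableAt) fun x => by
      rw [(hd x).deriv, ← NNReal.coe_le_coe, coe_nnnorm]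
      exact hb x
  have hi := integrable_gaussian_of_lipschitz hL
  set c := ∫ z, h z ∂gaussianReal 0 1 with hc
  set f : ℝ → ℝ := fun x => steinPrimitive h x / gaussianPDFReal 0 1 x with hf
  set f' : ℝ → ℝ := fun x => x * f x + (h x - c) with hf'
  set f'' : ℝ → ℝ := fun x => (1 * f x + x * f' x) + h' x with hf''
  have d1 : ∀ x, HasDerivAt f (f' x) x := by
    intro x
    have h0 := (stdGaussianPDF_pos x).ne'
    have := (hasDerivAt_steinPrimitive hi hL.continuous x).div (hasDerivAt_stdGaussianPDF x) h0
    refine HasDerivAt.congr_deriv this ?_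
    simp only [hf', hf]
    field_simp
    ring
  have d2 : ∀ x, HasDerivAt f' (f'' x) x := fun x =>
    ((hasDerivAt_id x).mul (d1 x)).add ((hd x).sub_const c)
  have b0 : ∀ x, |f x| ≤ 1 := fun x => by
    have h0 := stdGaussianPDF_pos x
    simp only [hf]
    rw [abs_div, abs_of_pos h0, div_le_one h0]
    exact abs_steinPrimitive_le hL x
  -- In the derivative of `f' φ` the terms `x f' φ` cancel and `(f + h')φ` remains, of size at most
  -- `2φ`; the tail comparison then applies to `f' φ`. Together with `f'' = f + x f' + h'` this
  -- yields `|f''| ≤ 1 + 2 + 1`.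
  have hxu : ∀ x, |x * f' x| ≤ 2 := by
    intro x
    have hv : ∀ x, HasDerivAt (fun x => f' x * gaussianPDFReal 0 1 x)
        ((f x + h' x) * gaussianPDFReal 0 1 x) x := fun x => by
      refine HasDerivAt.congr_deriv ((d2 x).mul (hasDerivAt_stdGaussianPDF x)) ?_
      simp only [hf'']; ring
    have hbv : ∀ x, |(f x + h' x) * gaussianPDFReal 0 1 x| ≤ 2 * gaussianPDFReal 0 1 x := by
      intro x
      rw [abs_mul, abs_of_pos (stdGaussianPDF_pos x)]
      refine mul_le_mul_of_nonneg_right ?_ (stdGaussianPDF_pos x).le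
      exact (abs_add_le _ _).trans (by linarith [b0 x, hb x])
    have hlim : Filter.Tendsto (fun x => f' x * gaussianPDFReal 0 1 x) (Filter.cocompact ℝ)
        (nhds 0) := by
      have hl : Filter.Tendsto (fun x => 2 * (|x| * gaussianPDFReal 0 1 x)
          + |h 0 - c| * gaussianPDFReal 0 1 x) (Filter.cocompact ℝ) (nhds 0) := by
        simpa using (tendsto_abs_mul_stdGaussianPDF_cocompact.const_mul 2).add
          (tendsto_stdGaussianPDF_cocompact.const_mul |h 0 - c|)
      refine squeeze_zero_norm (fun x => ?_) hl
      rw [Real.norm_eq_abs, abs_mul, abs_of_pos (stdGaussianPDF_pos x)]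
      have h1 : |f' x| ≤ 2 * |x| + |h 0 - c| := by
        have h2 : |x * f x| ≤ |x| := by
          rw [abs_mul]; exact mul_le_of_le_one_right (abs_nonneg x) (b0 x)
        have h3 := hL.dist_le_mul x 0
        rw [Real.dist_eq, Real.dist_eq] at h3
        simp only [NNReal.coe_one, one_mul, sub_zero] at h3
        have h4 : f' x = x * f x + (h x - h 0) + (h 0 - c) := by simp only [hf']; ring
        rw [h4]
        have h5 := abs_add_le (x * f x + (h x - h 0)) (h 0 - c)
        have h6 := abs_add_le (x * f x) (h x - h 0)
        linarith
      calc |f' x| * gaussianPDFReal 0 1 x ≤ (2 * |x| + |h 0 - c|) * gaussianPDFReal 0 1 x :=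
            mul_le_mul_of_nonneg_right h1 (stdGaussianPDF_pos x).le
        _ = _ := by ring
    have h1 := abs_mul_le_of_deriv_le_gaussian hv hbv hlim x
    rw [← mul_assoc, abs_mul, abs_of_pos (stdGaussianPDF_pos x)] at h1
    exact le_of_mul_le_mul_right h1 (stdGaussianPDF_pos x)
  refine ⟨f, f', f'', d1, d2, b0, fun x => ?_, fun x => ?_, fun x => ?_⟩
  -- For `|x| ≥ 4/5` the bound `|x f'| ≤ 2` gives `5/2`; for smaller `|x|` the Stein equation gives
  -- `4/5 + 1.3`.
  · rcases le_total (4 / 5) |x| with hx | hx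
    · have h1 := hxu x
      rw [abs_mul] at h1
      have := abs_nonneg (f' x)
      nlinarith
    · have h1 := abs_sub_integral_gaussian_le hL (x := x) (s := 5 / 4) (by norm_num)
      have h2 : |x * f x| ≤ |x| := by
        rw [abs_mul]; exact mul_le_of_le_one_right (abs_nonneg x) (b0 x)
      have h3 : x ^ 2 ≤ 16 / 25 := by
        rw [← sq_abs]; nlinarith [abs_nonneg x]
      have h4 : ((x ^ 2 + 1) / (5 / 4) + 5 / 4) / 2 ≤ 1.3 := by linarith
      exact (abs_add_le _ _).trans (by linarith)
  · have h1 := abs_add_le (1 * f x + x * f' x) (h' x)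
    have h2 := abs_add_le (1 * f x) (x * f' x)
    rw [one_mul] at h2
    simp only [hf'']
    rw [one_mul] at h1 ⊢
    linarith [b0 x, hb x, hxu x]
  · simp only [hf']; ring

/-- A solution of the Stein equation for the centered normal distribution with standard
deviation `s`. -/
theorem exists_stein_solution_scaled {h h' : ℝ → ℝ} (hd : ∀ x, HasDerivAt h (h' x) x)
    (hb : ∀ x, |h' x| ≤ 1) {s : ℝ} (hs : 0 < s) :
    ∃ f f' f'' : ℝ → ℝ, (∀ x, HasDerivAt f (f' x) x) ∧ (∀ x, HasDerivAt f' (f'' x) x) ∧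
      (∀ x, |f x| ≤ 1) ∧ (∀ x, |f' x| ≤ 5 / (2 * s)) ∧ (∀ x, |f'' x| ≤ 4 / s ^ 2) ∧
      ∀ x, s ^ 2 * f' x - x * f x = h x - ∫ z, h (s * z) ∂gaussianReal 0 1 := by
  -- The test function `h(s x)/s` again has slope at most one, so the bounds for the standard
  -- equation apply before rescaling.
  obtain ⟨f, f', f'', d1, d2, b0, b1, b2, e⟩ := exists_stein_solution
    (h := fun x => h (s * x) / s) (h' := fun x => h' (s * x))
    (fun x => by
      have := ((hd (s * x)).scomp x ((hasDerivAt_id x).const_mul s)).div_const s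
      refine HasDerivAt.congr_deriv this ?_
      simp; field_simp) (fun x => hb _)
  have hdiv : ∀ x : ℝ, HasDerivAt (fun x => x / s) (1 / s) x := fun x =>
    (hasDerivAt_id x).div_const s
  refine ⟨fun x => f (x / s), fun x => f' (x / s) / s, fun x => f'' (x / s) / s ^ 2,
    fun x => ?_, fun x => ?_, fun x => b0 _, fun x => ?_, fun x => ?_, fun x => ?_⟩
  · have := (d1 (x / s)).scomp x (hdiv x)
    refine HasDerivAt.congr_deriv this ?_
    simp; ring
  · have := ((d2 (x / s)).scomp x (hdiv x)).div_const s
    refine HasDerivAt.congr_deriv this ?_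
    simp; ring
  · rw [abs_div, abs_of_pos hs, div_le_div_iff₀ hs (by positivity)]
    nlinarith [b1 (x / s)]
  · rw [abs_div, abs_of_pos (by positivity : 0 < s ^ 2)]
    exact div_le_div_of_nonneg_right (b2 _) (by positivity)
  · have := e (x / s)
    rw [integral_div] at this
    have h1 : s * (x / s) = x := by field_simp
    simp only [h1] at this
    have h2 : s * (f' (x / s) - x / s * f (x / s)) = h x - ∫ z, h (s * z) ∂gaussianReal 0 1 := by
      rw [this]; field_simp
    rw [← h2]; field_simp

/-- Smooth approximation of a Lipschitz function. -/
theorem exists_smooth_approx {h : ℝ → ℝ} (hh : LipschitzWith 1 h) {ε : ℝ} (hε : 0 < ε) :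
    ∃ g g' : ℝ → ℝ, (∀ x, HasDerivAt g (g' x) x) ∧ (∀ x, |g' x| ≤ 1) ∧ ∀ x, |g x - h x| ≤ ε := by
  have hL : ∀ x y, |h x - h y| ≤ |x - y| := fun x y => by
    have := hh.dist_le_mul x y
    rw [Real.dist_eq, Real.dist_eq] at this
    simpa using this
  have hp : ∀ x, HasDerivAt (fun u => ∫ t in (0 : ℝ)..u, h t) (h x) x := fun x =>
    intervalIntegral.integral_hasDerivAt_right (hh.continuous.intervalIntegrable _ _)
      hh.continuous.stronglyMeasurable.stronglyMeasurableAtFilter hh.continuous.continuousAt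
  -- The average of `h` over `[x, x + ε]`: its derivative is a difference quotient of `h`.
  refine ⟨fun x => ((∫ t in (0 : ℝ)..(x + ε), h t) - ∫ t in (0 : ℝ)..x, h t) / ε,
    fun x => (h (x + ε) - h x) / ε, fun x => ?_, fun x => ?_, fun x => ?_⟩
  · exact (((hp (x + ε)).comp_add_const x ε).sub (hp x)).div_const ε
  · rw [abs_div, abs_of_pos hε, div_le_one hε]
    simpa [abs_of_pos hε] using hL (x + ε) x
  · simp only
    rw [intervalIntegral.integral_interval_sub_left (hh.continuous.intervalIntegrable _ _)
      (hh.continuous.intervalIntegrable _ _)]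
    have h1 : (∫ t in x..(x + ε), h t) / ε - h x = (∫ t in x..(x + ε), (h t - h x)) / ε := by
      rw [intervalIntegral.integral_sub (hh.continuous.intervalIntegrable _ _)
        (continuous_const.intervalIntegrable _ _)]
      simp; field_simp
    rw [h1, abs_div, abs_of_pos hε, div_le_iff₀ hε]
    have h2 := intervalIntegral.norm_integral_le_of_norm_le_const (a := x) (b := x + ε) (C := ε)
      (f := fun t => h t - h x) (fun t ht => by
        rw [Set.uIoc_of_le (by linarith)] at ht
        refine (hL t x).trans ?_
        rw [abs_of_pos (by linarith [ht.1])]; linarith [ht.2])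
    simpa [abs_of_pos hε] using h2

/-! ### Sums with decaying correlations -/

theorem integrable_of_continuous {Ω : Type*} [TopologicalSpace Ω] [CompactSpace Ω]
    [MeasurableSpace Ω] [OpensMeasurableSpace Ω] (μ : Measure Ω) [IsFiniteMeasure μ] {g : Ω → ℝ}
    (hg : Continuous g) : Integrable g μ :=
  hg.integrable_of_hasCompactSupport (HasCompactSupport.of_compactSpace g)

theorem geom_sum_le {p : ℝ} (hp0 : 0 ≤ p) (hp1 : p < 1) (n : ℕ) :
    ∑ j ∈ Finset.range n, p ^ j ≤ 1 / (1 - p) := by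
  rw [one_div, ← tsum_geometric_of_lt_one hp0 hp1]
  exact (summable_geometric_of_lt_one hp0 hp1).sum_le_tsum _ fun i _ => pow_nonneg hp0 i

theorem sum_pow_dist_le {p : ℝ} (hp0 : 0 ≤ p) (hp1 : p < 1) (i N : ℕ) :
    ∑ j ∈ Finset.range N, p ^ Nat.dist i j ≤ 2 / (1 - p) := by
  have hsub : Finset.range N ⊆ Finset.range (i + 1) ∪ Finset.Ico i N := by
    intro j hj
    simp only [Finset.mem_union, Finset.mem_range, Finset.mem_Ico] at *
    omega
  have hnn : ∀ j, 0 ≤ p ^ Nat.dist i j := fun j => pow_nonneg hp0 _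
  have h1 : ∑ j ∈ Finset.range (i + 1), p ^ Nat.dist i j ≤ 1 / (1 - p) := by
    rw [← Finset.sum_range_reflect]
    refine le_trans (le_of_eq (Finset.sum_congr rfl fun j hj => ?_)) (geom_sum_le hp0 hp1 (i + 1))
    have := Finset.mem_range.1 hj
    congr 1
    unfold Nat.dist; omega
  have h2 : ∑ j ∈ Finset.Ico i N, p ^ Nat.dist i j ≤ 1 / (1 - p) := by
    rw [Finset.sum_Ico_eq_sum_range]
    refine le_trans (le_of_eq (Finset.sum_congr rfl fun j hj => ?_)) (geom_sum_le hp0 hp1 (N - i))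
    congr 1
    unfold Nat.dist; omega
  have h3 := Finset.sum_le_sum_of_subset_of_nonneg hsub fun j _ _ => hnn j
  have h4 := Finset.sum_union_inter (s₁ := Finset.range (i + 1)) (s₂ := Finset.Ico i N)
    (f := fun j => p ^ Nat.dist i j)
  have h5 : 0 ≤ ∑ j ∈ Finset.range (i + 1) ∩ Finset.Ico i N, p ^ Nat.dist i j :=
    Finset.sum_nonneg fun j _ => hnn j
  have h6 : 2 / (1 - p) = 1 / (1 - p) + 1 / (1 - p) := by ring
  rw [h6]
  linarith

/-- Decay of the second and fourth order correlations of a sequence of functions. -/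
structure DecayingCorrelations {Ω : Type*} [MeasurableSpace Ω] (μ : Measure Ω) (X : ℕ → Ω → ℝ)
    (q D : ℝ) : Prop where
  two : ∀ i j : ℕ, i ≤ j → |∫ x, X i x * X j x ∂μ| ≤ D * q ^ (j - i)
  four : ∀ i j k l : ℕ, i ≤ j → j ≤ k → k ≤ l →
    |∫ x, X i x * X j x * X k x * X l x ∂μ| ≤ D ^ 2 * q ^ max (j - i) (l - k)
  split : ∀ i j k l : ℕ, i ≤ j → j ≤ k → k ≤ l →
    |(∫ x, X i x * X j x * X k x * X l x ∂μ)
        - (∫ x, X i x * X j x ∂μ) * ∫ x, X k x * X l x ∂μ| ≤ D ^ 2 * q ^ (k - j)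

namespace DecayingCorrelations

variable {Ω : Type*} [MeasurableSpace Ω] {μ : Measure Ω} {X : ℕ → Ω → ℝ} {q D : ℝ}

theorem two_dist (h : DecayingCorrelations μ X q D) (i j : ℕ) :
    |∫ x, X i x * X j x ∂μ| ≤ D * q ^ Nat.dist i j := by
  rcases le_total i j with hij | hij
  · rw [Nat.dist_eq_sub_of_le hij]; exact h.two i j hij
  · rw [Nat.dist_eq_sub_of_le_right hij]
    simpa only [mul_comm] using h.two j i hij

/-- The bound for the covariance of two products, see `cov_le_of_le`. -/
noncomputable def pairBound (p : ℝ) (a b m j : ℕ) : ℝ :=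
  p ^ Nat.dist a m * p ^ Nat.dist b j + p ^ Nat.dist b m * p ^ Nat.dist m j
    + p ^ Nat.dist a j * p ^ Nat.dist j m

theorem pairBound_nonneg {p : ℝ} (hp : 0 ≤ p) (a b m j : ℕ) : 0 ≤ pairBound p a b m j := by
  unfold pairBound; positivity

/-- The hypotheses pay for one gap at a time, while summation over `m` and `j` needs decay in two
distances. Since `p² = q`, a factor `q^k` dominates `p^s p^t` whenever `s + t ≤ 2k`. The terms of
`pairBound` correspond to overlapping pairs, to `(m, j)` on the right, and to `(m, j)` on the left.
-/
theorem cov_le_of_le (h : DecayingCorrelations μ X q D) (hD : 0 < D) {p : ℝ} (hp0 : 0 ≤ p)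
    (hp1 : p < 1) (hpq : p ^ 2 = q) {a b m j : ℕ} (hab : a ≤ b) (hmj : m ≤ j) :
    |(∫ x, X a x * X b x * X m x * X j x ∂μ)
        - (∫ x, X a x * X b x ∂μ) * ∫ x, X m x * X j x ∂μ| ≤ 2 * D ^ 2 * pairBound p a b m j := by
  have hqp : ∀ k s t : ℕ, s + t ≤ 2 * k → q ^ k ≤ p ^ s * p ^ t := fun k s t hk => by
    rw [← hpq, ← pow_mul, ← pow_add]
    exact pow_le_pow_of_le_one hp0 hp1.le hk
  have hprod : ∀ k s t : ℕ, s + t ≤ 2 * k → k ≤ (b - a) + (j - m) →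
      |(∫ x, X a x * X b x ∂μ) * ∫ x, X m x * X j x ∂μ| ≤ D ^ 2 * (p ^ s * p ^ t) := by
    intro k s t hk hk2
    rw [abs_mul]
    have e1 := mul_le_mul (h.two a b hab) (h.two m j hmj) (abs_nonneg _)
      ((abs_nonneg _).trans (h.two a b hab))
    have e2 : q ^ ((b - a) + (j - m)) ≤ p ^ s * p ^ t := hqp _ _ _ (by omega)
    rw [pow_add] at e2
    refine e1.trans ?_
    calc _ = D ^ 2 * (q ^ (b - a) * q ^ (j - m)) := by ring
      _ ≤ _ := mul_le_mul_of_nonneg_left e2 (by positivity)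
  have hfin : ∀ (I : ℝ) (k s t : ℕ), s + t ≤ 2 * k → k ≤ (b - a) + (j - m) →
      |I| ≤ D ^ 2 * q ^ k → |I - (∫ x, X a x * X b x ∂μ) * ∫ x, X m x * X j x ∂μ|
        ≤ 2 * D ^ 2 * (p ^ s * p ^ t) := by
    intro I k s t hk hk2 hI
    have e1 := hprod k s t hk hk2
    have e2 : D ^ 2 * q ^ k ≤ D ^ 2 * (p ^ s * p ^ t) :=
      mul_le_mul_of_nonneg_left (hqp k s t hk) (by positivity)
    have e3 := abs_sub I ((∫ x, X a x * X b x ∂μ) * ∫ x, X m x * X j x ∂μ)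
    linarith
  have n1 : 0 ≤ p ^ Nat.dist a m * p ^ Nat.dist b j := by positivity
  have n2 : 0 ≤ p ^ Nat.dist b m * p ^ Nat.dist m j := by positivity
  have n3 : 0 ≤ p ^ Nat.dist a j * p ^ Nat.dist j m := by positivity
  have hDD : 0 < D ^ 2 := by positivity
  unfold pairBound
  rcases le_or_gt b m with hbm | hbm
  · -- disjoint pairs, the first one on the left
    refine le_trans ?_ (mul_le_mul_of_nonneg_left
      (show p ^ Nat.dist b m * p ^ Nat.dist m j ≤ _ by linarith) (by positivity))
    -- If the gap `m - b` is the longer one, the two pairs nearly factorize. If the pair `(m, j)` is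
    -- longer, both the fourth moment and the product of covariances are small separately.
    rcases le_total (j - m) (m - b) with hc | hc
    · have e1 := h.split a b m j hab hbm hmj
      have e2 := hqp (m - b) (Nat.dist b m) (Nat.dist m j) (by unfold Nat.dist; omega)
      have e3 := mul_le_mul_of_nonneg_left e2 hDD.le
      nlinarith
    · refine hfin _ (j - m) _ _ (by unfold Nat.dist; omega) (by omega) ?_
      refine (h.four a b m j hab hbm hmj).trans (mul_le_mul_of_nonneg_left ?_ hDD.le)
      exact pow_le_pow_of_le_one (by rw [← hpq]; positivity) (by rw [← hpq]; nlinarith)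
        (le_max_right _ _)
  rcases le_or_gt j a with hja | hja
  · refine le_trans ?_ (mul_le_mul_of_nonneg_left
      (show p ^ Nat.dist a j * p ^ Nat.dist j m ≤ _ by linarith) (by positivity))
    have e4 : ∫ x, X a x * X b x * X m x * X j x ∂μ = ∫ x, X m x * X j x * X a x * X b x ∂μ := by
      congr 1; funext x; ring
    rw [e4]
    rcases le_total (j - m) (a - j) with hc | hc
    · have e1 := h.split m j a b hmj hja hab
      rw [mul_comm (∫ x, X m x * X j x ∂μ)] at e1
      have e2 := hqp (a - j) (Nat.dist a j) (Nat.dist j m) (by unfold Nat.dist; omega)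
      have e3 := mul_le_mul_of_nonneg_left e2 hDD.le
      nlinarith
    · refine hfin _ (j - m) _ _ (by unfold Nat.dist; omega) (by omega) ?_
      refine (h.four m j a b hmj hja hab).trans (mul_le_mul_of_nonneg_left ?_ hDD.le)
      exact pow_le_pow_of_le_one (by rw [← hpq]; positivity) (by rw [← hpq]; nlinarith)
        (le_max_left _ _)
  -- The pairs overlap: `a, m` are the two smallest indices and `b, j` the two largest, so the outer
  -- gaps are `|a - m|` and `|b - j|`.
  refine le_trans ?_ (mul_le_mul_of_nonneg_left
      (show p ^ Nat.dist a m * p ^ Nat.dist b j ≤ _ by linarith) (by positivity))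
  refine hfin _ (max (Nat.dist a m) (Nat.dist b j)) _ _ (by omega)
    (by unfold Nat.dist; omega) ?_
  rcases le_total a m with ham | ham <;> rcases le_total b j with hbj | hbj
  · have := h.four a m b j ham hbm.le hbj
    rw [Nat.dist_eq_sub_of_le ham, Nat.dist_eq_sub_of_le hbj]
    convert this using 4; ring
  · have := h.four a m j b ham hmj hbj
    rw [Nat.dist_eq_sub_of_le ham, Nat.dist_eq_sub_of_le_right hbj]
    convert this using 4; ring
  · have := h.four m a b j ham hab hbj
    rw [Nat.dist_eq_sub_of_le_right ham, Nat.dist_eq_sub_of_le hbj]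
    convert this using 4; ring
  · have := h.four m a j b ham hja.le hbj
    rw [Nat.dist_eq_sub_of_le_right ham, Nat.dist_eq_sub_of_le_right hbj]
    convert this using 4; ring

theorem cov_le (h : DecayingCorrelations μ X q D) (hD : 0 < D) {p : ℝ} (hp0 : 0 ≤ p)
    (hp1 : p < 1) (hpq : p ^ 2 = q) (n i m j : ℕ) :
    |(∫ x, X n x * X i x * X m x * X j x ∂μ)
        - (∫ x, X n x * X i x ∂μ) * ∫ x, X m x * X j x ∂μ|
      ≤ 2 * D ^ 2 * (pairBound p (min n i) (max n i) m j
        + pairBound p (min n i) (max n i) j m) := by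
  have key : ∀ a b : ℕ, a ≤ b → |(∫ x, X a x * X b x * X m x * X j x ∂μ)
        - (∫ x, X a x * X b x ∂μ) * ∫ x, X m x * X j x ∂μ|
      ≤ 2 * D ^ 2 * (pairBound p a b m j + pairBound p a b j m) := by
    intro a b hab
    have n1 := mul_nonneg (by positivity : 0 ≤ 2 * D ^ 2) (pairBound_nonneg hp0 a b m j)
    have n2 := mul_nonneg (by positivity : 0 ≤ 2 * D ^ 2) (pairBound_nonneg hp0 a b j m)
    rw [mul_add]
    rcases le_total m j with hmj | hmj
    · linarith [h.cov_le_of_le hD hp0 hp1 hpq hab hmj]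
    · have e := h.cov_le_of_le hD hp0 hp1 hpq hab hmj
      have e1 : ∫ x, X a x * X b x * X j x * X m x ∂μ = ∫ x, X a x * X b x * X m x * X j x ∂μ := by
        congr 1; funext x; ring
      have e2 : ∫ x, X j x * X m x ∂μ = ∫ x, X m x * X j x ∂μ := by
        congr 1; funext x; ring
      rw [e1, e2] at e
      linarith
  rcases le_total n i with hni | hni
  · rw [min_eq_left hni, max_eq_right hni]; exact key n i hni
  · rw [min_eq_right hni, max_eq_left hni]
    have e := key i n hni
    have e1 : ∫ x, X i x * X n x * X m x * X j x ∂μ = ∫ x, X n x * X i x * X m x * X j x ∂μ := by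
      congr 1; funext x; ring
    have e2 : ∫ x, X i x * X n x ∂μ = ∫ x, X n x * X i x ∂μ := by
      congr 1; funext x; ring
    rwa [e1, e2] at e

/-- Each summand chains the free indices `m, j` to the fixed ones, so it costs two geometric series,
whatever `a`, `b` and `N` are. -/
theorem sum_pairBound_le {p : ℝ} (hp0 : 0 ≤ p) (hp1 : p < 1) (a b N : ℕ) :
    ∑ m ∈ Finset.range N, ∑ j ∈ Finset.range N, pairBound p a b m j ≤ 3 * (2 / (1 - p)) ^ 2 := by
  have hs := fun i => sum_pow_dist_le hp0 hp1 i N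
  have hpos : 0 ≤ 2 / (1 - p) := div_nonneg (by norm_num) (by linarith)
  have hdep : ∀ c, ∑ m ∈ Finset.range N, ∑ j ∈ Finset.range N,
      p ^ Nat.dist c m * p ^ Nat.dist m j ≤ (2 / (1 - p)) ^ 2 := by
    intro c
    calc _ ≤ ∑ m ∈ Finset.range N, p ^ Nat.dist c m * (2 / (1 - p)) := by
          refine Finset.sum_le_sum fun m _ => ?_
          rw [← Finset.mul_sum]
          exact mul_le_mul_of_nonneg_left (hs m) (pow_nonneg hp0 _)
      _ = (∑ m ∈ Finset.range N, p ^ Nat.dist c m) * (2 / (1 - p)) := by rw [Finset.sum_mul]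
      _ ≤ (2 / (1 - p)) * (2 / (1 - p)) := mul_le_mul_of_nonneg_right (hs c) hpos
      _ = _ := by ring
  have h1 : ∑ m ∈ Finset.range N, ∑ j ∈ Finset.range N,
      p ^ Nat.dist a m * p ^ Nat.dist b j ≤ (2 / (1 - p)) ^ 2 := by
    rw [← Finset.sum_mul_sum, sq]
    exact mul_le_mul (hs a) (hs b) (Finset.sum_nonneg fun _ _ => pow_nonneg hp0 _) hpos
  have h3 : ∑ m ∈ Finset.range N, ∑ j ∈ Finset.range N,
      p ^ Nat.dist a j * p ^ Nat.dist j m ≤ (2 / (1 - p)) ^ 2 := by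
    rw [Finset.sum_comm]; exact hdep a
  simp only [pairBound, Finset.sum_add_distrib]
  linarith [hdep b]

end DecayingCorrelations

/-! ### Stein's method with blocks of dependent variables. -/

/-- The indicator of `|n - i| ≤ K`. -/
noncomputable def bandWeight (K n i : ℕ) : ℝ := if Nat.dist n i ≤ K then 1 else 0

theorem bandWeight_nonneg (K n i : ℕ) : 0 ≤ bandWeight K n i := by
  unfold bandWeight; split_ifs <;> norm_num

theorem bandWeight_le_one (K n i : ℕ) : bandWeight K n i ≤ 1 := by
  unfold bandWeight; split_ifs <;> norm_num

theorem sum_bandWeight_le (K n N : ℕ) :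
    ∑ i ∈ Finset.range N, bandWeight K n i ≤ 2 * K + 1 := by
  unfold bandWeight
  rw [Finset.sum_boole]
  have hsub : (Finset.range N).filter (fun i => Nat.dist n i ≤ K) ⊆ Finset.Icc (n - K) (n + K) := by
    intro i hi
    simp only [Finset.mem_filter, Finset.mem_Icc] at *
    have := hi.2
    unfold Nat.dist at this
    omega
  have h1 := Finset.card_le_card hsub
  rw [Nat.card_Icc] at h1
  have h2 : ((Finset.range N).filter (fun i => Nat.dist n i ≤ K)).card ≤ 2 * K + 1 := by omega
  exact_mod_cast h2

/-- The second order Taylor bound. -/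
theorem abs_sub_sub_mul_le {f f' f'' : ℝ → ℝ} {c : ℝ} (h1 : ∀ x, HasDerivAt f (f' x) x)
    (h2 : ∀ x, HasDerivAt f' (f'' x) x) (hc : ∀ x, |f'' x| ≤ c) (x s : ℝ) :
    |f x - f (x - s) - s * f' x| ≤ c / 2 * s ^ 2 := by
  have key : ∀ {g g' g'' : ℝ → ℝ} (_ : ∀ x, HasDerivAt g (g' x) x)
      (_ : ∀ x, HasDerivAt g' (g'' x) x) (_ : ∀ x, |g'' x| ≤ c),
      g x - g (x - s) - s * g' x ≤ c / 2 * s ^ 2 := by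
    intro g g' g'' h1 h2 hc
    have d1 : ∀ y, HasDerivAt (fun y => c / 2 * y ^ 2 + g y) (c * y + g' y) y := fun y => by
      refine HasDerivAt.congr_deriv (((hasDerivAt_pow 2 y).const_mul (c / 2)).add (h1 y)) ?_
      simp; ring
    have d2 : ∀ y, HasDerivAt (fun y => c * y + g' y) (c * 1 + g'' y) y := fun y =>
      ((hasDerivAt_id y).const_mul c).add (h2 y)
    have hmono : Monotone (fun y => c * y + g' y) := by
      refine monotone_of_deriv_nonneg (fun y => (d2 y).differentiableAt) fun y => ?_
      rw [(d2 y).deriv]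
      have := (abs_le.1 (hc y)).1
      linarith
    -- No continuity of the second derivative is available, so the remainder comes from convexity:
    -- the graph of `c y²/2 + g` lies above its tangent at `x`.
    have hconv : ConvexOn ℝ Set.univ (fun y => c / 2 * y ^ 2 + g y) := by
      refine MonotoneOn.convexOn_of_deriv convex_univ
        (fun y _ => (d1 y).continuousAt.continuousWithinAt)
        (fun y _ => (d1 y).differentiableAt.differentiableWithinAt) ?_
      rw [show deriv (fun y => c / 2 * y ^ 2 + g y) = fun y => c * y + g' y from
        funext fun y => (d1 y).deriv]
      exact hmono.monotoneOn _
    have h3 : c / 2 * x ^ 2 + g x - s * (c * x + g' x) ≤ c / 2 * (x - s) ^ 2 + g (x - s) := by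
      rcases lt_trichotomy s 0 with hs | rfl | hs
      · have := hconv.le_slope_of_hasDerivAt (Set.mem_univ x) (Set.mem_univ (x - s))
          (by linarith) (d1 x)
        rw [slope_def_field, le_div_iff₀ (by linarith)] at this
        linarith
      · simp
      · have := hconv.slope_le_of_hasDerivAt (Set.mem_univ (x - s)) (Set.mem_univ x)
          (by linarith) (d1 x)
        rw [slope_def_field, div_le_iff₀ (by linarith)] at this
        linarith
    nlinarith
  have e1 := key h1 h2 hc
  have e2 := key (g := fun y => -f y) (fun y => (h1 y).neg) (fun y => (h2 y).neg)
    (fun y => by rw [abs_neg]; exact hc y)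
  rw [abs_le]; constructor <;> linarith

section
variable {Ω : Type*} [TopologicalSpace Ω] [CompactSpace Ω] [MeasurableSpace Ω]
  [OpensMeasurableSpace Ω] {μ : Measure Ω} [IsProbabilityMeasure μ] {X : ℕ → Ω → ℝ} {q D : ℝ}

theorem integral_sq_weighted_sum_le (hX : ∀ n, Continuous (X n))
    (h : DecayingCorrelations μ X q D) (hD : 0 < D) (hq0 : 0 ≤ q) (hq1 : q < 1) {w : ℕ → ℝ}
    (hw0 : ∀ i, 0 ≤ w i) (hw1 : ∀ i, w i ≤ 1) (N : ℕ) :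
    ∫ x, (∑ i ∈ Finset.range N, w i * X i x) ^ 2 ∂μ
      ≤ (∑ i ∈ Finset.range N, w i) * (D * (2 / (1 - q))) := by
  have e : ∀ x, (∑ i ∈ Finset.range N, w i * X i x) ^ 2
      = ∑ i ∈ Finset.range N, ∑ j ∈ Finset.range N, w i * w j * (X i x * X j x) := fun x => by
    rw [sq, Finset.sum_mul_sum]
    exact Finset.sum_congr rfl fun i _ => Finset.sum_congr rfl fun j _ => by ring
  simp_rw [e]
  rw [integral_finsetSum _ fun i _ => integrable_of_continuous μ (by fun_prop), Finset.sum_mul]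
  refine Finset.sum_le_sum fun i _ => ?_
  rw [integral_finsetSum _ fun j _ => integrable_of_continuous μ (by fun_prop)]
  simp_rw [integral_const_mul]
  calc ∑ j ∈ Finset.range N, w i * w j * ∫ x, X i x * X j x ∂μ
      ≤ ∑ j ∈ Finset.range N, w i * (D * q ^ Nat.dist i j) := by
        refine Finset.sum_le_sum fun j _ => ?_
        rw [mul_assoc]
        refine mul_le_mul_of_nonneg_left ?_ (hw0 i)
        have h1 := h.two_dist i j
        have h2 : 0 ≤ D * q ^ Nat.dist i j := by positivity
        calc w j * ∫ x, X i x * X j x ∂μ ≤ w j * (D * q ^ Nat.dist i j) :=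
              mul_le_mul_of_nonneg_left ((le_abs_self _).trans h1) (hw0 j)
          _ ≤ 1 * (D * q ^ Nat.dist i j) := mul_le_mul_of_nonneg_right (hw1 j) h2
          _ = _ := one_mul _
    _ = w i * (D * ∑ j ∈ Finset.range N, q ^ Nat.dist i j) := by
        rw [Finset.mul_sum, Finset.mul_sum]
    _ ≤ w i * (D * (2 / (1 - q))) := by
        have := sum_pow_dist_le hq0 hq1 i N
        have := hw0 i
        gcongr

/-- The second moment is a double sum of covariances of products. For a fixed pair `P` the sum over
all `Q` is bounded independently of `N`, so only one factor `∑ w` survives. The constant is `12 = 2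
· (3 + 3)`, with both orders of the second pair. -/
theorem integral_sq_centered_products_le (hX : ∀ n, Continuous (X n))
    (h : DecayingCorrelations μ X q D) (hD : 0 < D) {p : ℝ} (hp0 : 0 ≤ p)
    (hp1 : p < 1) (hpq : p ^ 2 = q) {w : ℕ → ℕ → ℝ}
    (hw0 : ∀ n i, 0 ≤ w n i) (hw1 : ∀ n i, w n i ≤ 1) (N : ℕ) :
    ∫ x, (∑ n ∈ Finset.range N, ∑ i ∈ Finset.range N,
        w n i * (X n x * X i x - ∫ y, X n y * X i y ∂μ)) ^ 2 ∂μ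
      ≤ (∑ n ∈ Finset.range N, ∑ i ∈ Finset.range N, w n i)
        * (12 * D ^ 2 * (2 / (1 - p)) ^ 2) := by
  set c : ℕ → ℕ → ℝ := fun n i => ∫ y, X n y * X i y ∂μ with hc
  set R := Finset.range N ×ˢ Finset.range N with hR
  have e : ∀ x, (∑ n ∈ Finset.range N, ∑ i ∈ Finset.range N,
        w n i * (X n x * X i x - c n i)) ^ 2
      = ∑ P ∈ R, ∑ Q ∈ R, w P.1 P.2 * w Q.1 Q.2 *
        ((X P.1 x * X P.2 x - c P.1 P.2) * (X Q.1 x * X Q.2 x - c Q.1 Q.2)) := fun x => by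
    rw [← Finset.sum_product', sq, Finset.sum_mul_sum]
    exact Finset.sum_congr rfl fun i _ => Finset.sum_congr rfl fun j _ => by ring
  have hcov : ∀ n i m j, ∫ x, (X n x * X i x - c n i) * (X m x * X j x - c m j) ∂μ
      = (∫ x, X n x * X i x * X m x * X j x ∂μ) - c n i * c m j := by
    intro n i m j
    have e1 : ∀ x, (X n x * X i x - c n i) * (X m x * X j x - c m j)
        = (X n x * X i x * X m x * X j x - c m j * (X n x * X i x))
          - (c n i * (X m x * X j x) - c n i * c m j) := fun x => by ring
    simp_rw [e1]
    rw [integral_sub (integrable_of_continuous μ (by fun_prop))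
        (integrable_of_continuous μ (by fun_prop)),
      integral_sub (integrable_of_continuous μ (by fun_prop))
        (integrable_of_continuous μ (by fun_prop)),
      integral_sub (integrable_of_continuous μ (by fun_prop))
        (integrable_of_continuous μ (by fun_prop)), integral_const_mul, integral_const_mul]
    simp only [integral_const, probReal_univ, smul_eq_mul, one_mul]
    change _ - c m j * c n i - (c n i * c m j - _) = _
    ring
  change ∫ x, (∑ n ∈ Finset.range N, ∑ i ∈ Finset.range N,
    w n i * (X n x * X i x - c n i)) ^ 2 ∂μ ≤ _
  simp_rw [e]
  rw [integral_finsetSum _ fun i _ => integrable_of_continuous μ (by fun_prop),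
    ← Finset.sum_product', Finset.sum_mul]
  refine Finset.sum_le_sum fun P _ => ?_
  rw [integral_finsetSum _ fun j _ => integrable_of_continuous μ (by fun_prop)]
  simp_rw [integral_const_mul, hcov]
  set B : ℕ → ℕ → ℝ := DecayingCorrelations.pairBound p (min P.1 P.2) (max P.1 P.2) with hB
  have hBn : ∀ m j, 0 ≤ B m j := fun m j => DecayingCorrelations.pairBound_nonneg hp0 _ _ m j
  calc ∑ Q ∈ R, w P.1 P.2 * w Q.1 Q.2 *
        ((∫ x, X P.1 x * X P.2 x * X Q.1 x * X Q.2 x ∂μ) - c P.1 P.2 * c Q.1 Q.2)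
      ≤ ∑ Q ∈ R, w P.1 P.2 * (2 * D ^ 2 * (B Q.1 Q.2 + B Q.2 Q.1)) := by
        refine Finset.sum_le_sum fun Q _ => ?_
        rw [mul_assoc]
        refine mul_le_mul_of_nonneg_left ?_ (hw0 _ _)
        have h1 := h.cov_le hD hp0 hp1 hpq P.1 P.2 Q.1 Q.2
        have h2 := (le_abs_self _).trans h1
        calc _ ≤ w Q.1 Q.2 * (2 * D ^ 2 * (B Q.1 Q.2 + B Q.2 Q.1)) :=
              mul_le_mul_of_nonneg_left h2 (hw0 _ _)
          _ ≤ 1 * (2 * D ^ 2 * (B Q.1 Q.2 + B Q.2 Q.1)) := by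
              have := hBn Q.1 Q.2
              have := hBn Q.2 Q.1
              exact mul_le_mul_of_nonneg_right (hw1 _ _) (by positivity)
          _ = _ := one_mul _
    _ = w P.1 P.2 * (2 * D ^ 2 * (∑ m ∈ Finset.range N, ∑ j ∈ Finset.range N, B m j
          + ∑ j ∈ Finset.range N, ∑ m ∈ Finset.range N, B m j)) := by
        rw [← Finset.mul_sum, ← Finset.mul_sum, Finset.sum_add_distrib, hR,
          Finset.sum_product' (f := fun m j => B m j), Finset.sum_product' (f := fun m j => B j m)]
    _ ≤ w P.1 P.2 * (12 * D ^ 2 * (2 / (1 - p)) ^ 2) := by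
        refine mul_le_mul_of_nonneg_left ?_ (hw0 _ _)
        have h1 := DecayingCorrelations.sum_pairBound_le hp0 hp1 (min P.1 P.2) (max P.1 P.2) N
        rw [Finset.sum_comm (f := fun j m => B m j)]
        have : 0 < D ^ 2 := by positivity
        nlinarith

/-- Stein's method with blocks of size `K`. -/
theorem stein_block_bound (hX : ∀ n, Continuous (X n)) {b : ℝ} (hb : ∀ n x, |X n x| ≤ b)
    (h : DecayingCorrelations μ X q D) (hD : 0 < D) {p : ℝ} (hp0 : 0 ≤ p)
    (hp1 : p < 1) (hpq : p ^ 2 = q) {f f' f'' : ℝ → ℝ} {c1 c2 : ℝ}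
    (d1 : ∀ x, HasDerivAt f (f' x) x) (d2 : ∀ x, HasDerivAt f' (f'' x) x)
    (hc1 : ∀ x, |f' x| ≤ c1) (hc2 : ∀ x, |f'' x| ≤ c2) {N : ℕ} (hN : 0 < N) (K : ℕ)
    {V : ℝ} (hV : 0 < V) (hVle : 48 * (2 * K + 1) * D ^ 2 / (1 - p) ^ 2 ≤ V ^ 2 * N)
    {W : Ω → ℝ} (hW : ∀ x, W x = (Real.sqrt N)⁻¹ * ∑ i ∈ Finset.range N, X i x) :
    |∫ x, ((∫ y, W y ^ 2 ∂μ) * f' (W x) - W x * f (W x)) ∂μ|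
      ≤ c1 * (N * D * q ^ (K + 1) + V)
        + c2 / 2 * b * (Real.sqrt N)⁻¹ * ((2 * K + 1) * (D * (2 / (1 - q))))
        + (Real.sqrt N)⁻¹ * ∑ n ∈ Finset.range N, |∫ x, X n x *
            f (W x - (Real.sqrt N)⁻¹ * ∑ i ∈ Finset.range N, bandWeight K n i * X i x) ∂μ| := by
  have hq0 : 0 ≤ q := by rw [← hpq]; positivity
  have hq1 : q < 1 := by rw [← hpq]; nlinarith
  set r : ℝ := (Real.sqrt N)⁻¹ with hr
  have hNr : (0 : ℝ) < N := by exact_mod_cast hN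
  have hr0 : 0 < r := by positivity
  have hrr : r * r * N = 1 := by
    rw [hr, ← mul_inv, Real.mul_self_sqrt hNr.le]; field_simp
  set w : ℕ → ℕ → ℝ := bandWeight K with hw
  set B : ℕ → Ω → ℝ := fun n x => ∑ i ∈ Finset.range N, w n i * X i x with hB
  have hfc : Continuous f := continuous_iff_continuousAt.2 fun x => (d1 x).continuousAt
  have hf'c : Continuous f' := continuous_iff_continuousAt.2 fun x => (d2 x).continuousAt
  have hWc : Continuous W := by
    rw [show W = fun x => r * ∑ i ∈ Finset.range N, X i x from funext hW]; fun_prop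
  have hBc : ∀ n, Continuous (B n) := fun n => by simp only [hB]; fun_prop
  have hint : ∀ {g : Ω → ℝ}, Continuous g → Integrable g μ := fun hg =>
    integrable_of_continuous μ hg
  set c : ℕ → ℕ → ℝ := fun n i => ∫ y, X n y * X i y ∂μ with hc
  set S2 : ℝ := ∫ y, W y ^ 2 ∂μ with hS2
  have hc1' : 0 ≤ c1 := (abs_nonneg _).trans (hc1 0)
  have hc2' : 0 ≤ c2 := (abs_nonneg _).trans (hc2 0)
  have hb' : 0 ≤ b := by
    by_contra hneg
    obtain ⟨x⟩ : Nonempty Ω := by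
      by_contra hne
      rw [not_nonempty_iff] at hne
      have := measure_univ (μ := μ)
      rw [Set.univ_eq_empty_iff.2 hne, measure_empty] at this
      exact zero_ne_one this
    exact hneg ((abs_nonneg _).trans (hb 0 x))
  -- the variance
  have hS2e : S2 = r * r * ∑ n ∈ Finset.range N, ∑ i ∈ Finset.range N, c n i := by
    have e : ∀ y, W y ^ 2
        = r * r * ∑ n ∈ Finset.range N, ∑ i ∈ Finset.range N, X n y * X i y := fun y => by
      rw [hW, mul_pow, sq, sq, Finset.sum_mul_sum]
    rw [hS2]
    simp_rw [e]
    rw [integral_const_mul, integral_finsetSum _ fun i _ => hint (by fun_prop)]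
    congr 1
    refine Finset.sum_congr rfl fun n _ => ?_
    rw [integral_finsetSum _ fun i _ => hint (by fun_prop)]
  -- the band part of the quadratic form
  set Y : Ω → ℝ := fun x => ∑ n ∈ Finset.range N, ∑ i ∈ Finset.range N,
    w n i * (X n x * X i x - c n i) with hY
  have hYc : Continuous Y := by simp only [hY]; fun_prop
  -- The band contains at most `N(2K + 1)` pairs and the prefactor is `r⁴ = N⁻²`; the `48` of the
  -- hypothesis on `V` is `12 · 2²`.
  have hYsq : ∫ x, (r * r * Y x) ^ 2 ∂μ ≤ V ^ 2 := by
    have e1 := integral_sq_centered_products_le hX h hD hp0 hp1 hpq (bandWeight_nonneg K)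
      (bandWeight_le_one K) N
    have e2 : ∑ n ∈ Finset.range N, ∑ i ∈ Finset.range N, w n i ≤ N * (2 * K + 1) := by
      refine (Finset.sum_le_sum fun n _ => sum_bandWeight_le K n N).trans (le_of_eq ?_)
      rw [Finset.sum_const, Finset.card_range, nsmul_eq_mul]
    have e3 : (∑ n ∈ Finset.range N, ∑ i ∈ Finset.range N, w n i)
        * (12 * D ^ 2 * (2 / (1 - p)) ^ 2)
        ≤ N * (2 * K + 1) * (12 * D ^ 2 * (2 / (1 - p)) ^ 2) :=
      mul_le_mul_of_nonneg_right e2 (by positivity)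
    have e4 : N * (2 * K + 1) * (12 * D ^ 2 * (2 / (1 - p)) ^ 2)
        = N * (48 * (2 * K + 1) * D ^ 2 / (1 - p) ^ 2) := by
      rw [div_pow]; ring
    have e5 : N * (48 * (2 * K + 1) * D ^ 2 / (1 - p) ^ 2) ≤ N * (V ^ 2 * N) :=
      mul_le_mul_of_nonneg_left hVle hNr.le
    have e6 : ∀ x, (r * r * Y x) ^ 2 = (r * r) ^ 2 * Y x ^ 2 := fun x => by ring
    simp_rw [e6]
    rw [integral_const_mul]
    have e7 : (r * r) ^ 2 * (N * (V ^ 2 * N)) = V ^ 2 := by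
      calc _ = (r * r * N) ^ 2 * V ^ 2 := by ring
        _ = _ := by rw [hrr]; ring
    rw [← e7]
    refine mul_le_mul_of_nonneg_left ?_ (by positivity)
    exact e1.trans (e3.trans (e4.le.trans e5))
  -- From `L²` to `L¹` by `2|y| ≤ y²/V + V`.
  have hYabs : ∫ x, |r * r * Y x| ∂μ ≤ V := by
    have e1 : ∀ x, |r * r * Y x| ≤ ((r * r * Y x) ^ 2 / V + V) / 2 := fun x => by
      have e2 : 0 ≤ (|r * r * Y x| - V) ^ 2 / V := by positivity
      have e3 : (|r * r * Y x| - V) ^ 2 / V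
          = |r * r * Y x| ^ 2 / V - 2 * |r * r * Y x| + V := by field_simp; ring
      rw [sq_abs] at e3
      linarith
    have e4 : ∫ x, ((r * r * Y x) ^ 2 / V + V) / 2 ∂μ
        = ((∫ x, (r * r * Y x) ^ 2 ∂μ) / V + V) / 2 := by
      rw [integral_div, integral_add (hint (by fun_prop)) (hint (by fun_prop)), integral_div]
      simp
    refine (integral_mono (hint (by fun_prop)) (hint (by fun_prop)) e1).trans ?_
    rw [e4]
    have e5 : (∫ x, (r * r * Y x) ^ 2 ∂μ) / V ≤ V := by
      rw [div_le_iff₀ hV, ← sq V]; exact hYsq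
    linarith
  -- the part of the variance off the band
  set E0 : ℝ := r * r * ∑ n ∈ Finset.range N, ∑ i ∈ Finset.range N, w n i * c n i with hE0
  -- There are at most `N²` pairs off the band, each at distance at least `K + 1`, against the
  -- factor `r² = 1/N`.
  have htail : |S2 - E0| ≤ N * D * q ^ (K + 1) := by
    have e1 : S2 - E0
        = r * r * ∑ n ∈ Finset.range N, ∑ i ∈ Finset.range N, (1 - w n i) * c n i := by
      rw [hS2e, hE0, ← mul_sub, ← Finset.sum_sub_distrib]
      congr 1
      refine Finset.sum_congr rfl fun n _ => ?_
      rw [← Finset.sum_sub_distrib]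
      exact Finset.sum_congr rfl fun i _ => by ring
    have e2 : ∀ n i, |(1 - w n i) * c n i| ≤ D * q ^ (K + 1) := by
      intro n i
      simp only [hw, bandWeight]
      split_ifs with hd
      · simp; positivity
      · rw [sub_zero, one_mul]
        refine (h.two_dist n i).trans (mul_le_mul_of_nonneg_left ?_ hD.le)
        exact pow_le_pow_of_le_one hq0 hq1.le (by omega)
    have e3 : |∑ n ∈ Finset.range N, ∑ i ∈ Finset.range N, (1 - w n i) * c n i|
        ≤ ∑ n ∈ Finset.range N, ∑ i ∈ Finset.range N, D * q ^ (K + 1) :=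
      (Finset.abs_sum_le_sum_abs _ _).trans (Finset.sum_le_sum fun n _ =>
        (Finset.abs_sum_le_sum_abs _ _).trans (Finset.sum_le_sum fun i _ => e2 n i))
    rw [e1, abs_mul, abs_of_pos (by positivity : 0 < r * r)]
    calc _ ≤ r * r * ∑ n ∈ Finset.range N, ∑ i ∈ Finset.range N, D * q ^ (K + 1) :=
          mul_le_mul_of_nonneg_left e3 (by positivity)
      _ = (r * r * N) * (N * D * q ^ (K + 1)) := by simp; ring
      _ = _ := by rw [hrr, one_mul]
  -- Taylor expansion
  set T : ℕ → Ω → ℝ := fun n x => f (W x) - f (W x - r * B n x) - r * B n x * f' (W x) with hT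
  have hTc : ∀ n, Continuous (T n) := fun n => by simp only [hT]; fun_prop
  have hTle : ∀ n x, |T n x| ≤ c2 / 2 * (r * B n x) ^ 2 := fun n x =>
    abs_sub_sub_mul_le d1 d2 hc2 _ _
  have hTint : ∀ n, |∫ x, X n x * T n x ∂μ|
      ≤ c2 / 2 * b * (r * r) * ((2 * K + 1) * (D * (2 / (1 - q)))) := by
    intro n
    have e1 : ∀ x, ‖X n x * T n x‖ ≤ c2 / 2 * b * (r * r) * B n x ^ 2 := fun x => by
      rw [Real.norm_eq_abs, abs_mul]
      calc |X n x| * |T n x| ≤ b * (c2 / 2 * (r * B n x) ^ 2) :=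
            mul_le_mul (hb n x) (hTle n x) (abs_nonneg _) hb'
        _ = _ := by ring
    have e2 := norm_integral_le_of_norm_le (μ := μ)
      (hint (by fun_prop : Continuous fun x => c2 / 2 * b * (r * r) * B n x ^ 2))
      (Filter.Eventually.of_forall e1)
    rw [integral_const_mul, Real.norm_eq_abs] at e2
    refine e2.trans (mul_le_mul_of_nonneg_left ?_ (by positivity))
    refine (integral_sq_weighted_sum_le hX h hD hq0 hq1 (bandWeight_nonneg K n)
      (bandWeight_le_one K n) N).trans ?_
    have : 0 ≤ 2 / (1 - q) := div_nonneg (by norm_num) (by linarith)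
    exact mul_le_mul_of_nonneg_right (sum_bandWeight_le K n N) (by positivity)
  -- the decomposition
  have hdec : ∀ x, S2 * f' (W x) - W x * f (W x)
      = ((S2 - E0) * f' (W x) - r * r * Y x * f' (W x))
        - (r * ∑ n ∈ Finset.range N, X n x * T n x
          + r * ∑ n ∈ Finset.range N, X n x * f (W x - r * B n x)) := by
    intro x
    have e1 : W x * f (W x) = r * ∑ n ∈ Finset.range N, X n x * f (W x) := by
      rw [← Finset.sum_mul, ← mul_assoc, ← hW]
    have e2 : ∀ n, X n x * f (W x) = X n x * T n x + X n x * f (W x - r * B n x)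
        + r * (X n x * B n x) * f' (W x) := fun n => by simp only [hT]; ring
    have e3 : ∑ n ∈ Finset.range N, X n x * B n x = Y x +
        ∑ n ∈ Finset.range N, ∑ i ∈ Finset.range N, w n i * c n i := by
      simp only [hY, hB]
      rw [← Finset.sum_add_distrib]
      refine Finset.sum_congr rfl fun n _ => ?_
      rw [← Finset.sum_add_distrib, Finset.mul_sum]
      exact Finset.sum_congr rfl fun i _ => by ring
    rw [e1]
    simp_rw [e2]
    rw [Finset.sum_add_distrib, Finset.sum_add_distrib, ← Finset.sum_mul, ← Finset.mul_sum, e3, hE0]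
    ring
  simp_rw [hdec]
  have i1 : Continuous fun x => (S2 - E0) * f' (W x) := by fun_prop
  have i2 : Continuous fun x => r * r * Y x * f' (W x) := by fun_prop
  have i3 : Continuous fun x => r * ∑ n ∈ Finset.range N, X n x * T n x := by fun_prop
  have i4 : Continuous fun x => r * ∑ n ∈ Finset.range N, X n x * f (W x - r * B n x) := by fun_prop
  have i5 : Continuous fun x => (S2 - E0) * f' (W x) - r * r * Y x * f' (W x) := i1.sub i2
  have i6 : Continuous fun x => r * ∑ n ∈ Finset.range N, X n x * T n x
      + r * ∑ n ∈ Finset.range N, X n x * f (W x - r * B n x) := i3.add i4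
  rw [integral_sub (hint i5) (hint i6), integral_sub (hint i1) (hint i2),
    integral_add (hint i3) (hint i4)]
  have b1 : |∫ x, (S2 - E0) * f' (W x) ∂μ| ≤ c1 * (N * D * q ^ (K + 1)) := by
    rw [integral_const_mul, abs_mul, mul_comm c1]
    refine mul_le_mul htail ?_ (abs_nonneg _) ((abs_nonneg _).trans htail)
    have := norm_integral_le_of_norm_le_const (μ := μ) (f := fun x => f' (W x)) (C := c1)
      (Filter.Eventually.of_forall fun x => hc1 _)
    simpa using this
  have b2 : |∫ x, r * r * Y x * f' (W x) ∂μ| ≤ c1 * V := by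
    have e1 := norm_integral_le_of_norm_le (μ := μ) (f := fun x => r * r * Y x * f' (W x))
      (hint (by fun_prop : Continuous fun x => c1 * |r * r * Y x|))
      (Filter.Eventually.of_forall fun x => by
        rw [Real.norm_eq_abs, abs_mul, mul_comm]
        exact mul_le_mul_of_nonneg_right (hc1 _) (abs_nonneg _))
    rw [integral_const_mul, Real.norm_eq_abs] at e1
    exact e1.trans (mul_le_mul_of_nonneg_left hYabs hc1')
  have b3 : |∫ x, r * ∑ n ∈ Finset.range N, X n x * T n x ∂μ|
      ≤ c2 / 2 * b * r * ((2 * K + 1) * (D * (2 / (1 - q)))) := by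
    rw [integral_const_mul, integral_finsetSum _ fun i _ => hint (by fun_prop), abs_mul,
      abs_of_pos hr0]
    calc _ ≤ r * ∑ n ∈ Finset.range N,
          c2 / 2 * b * (r * r) * ((2 * K + 1) * (D * (2 / (1 - q)))) :=
          mul_le_mul_of_nonneg_left ((Finset.abs_sum_le_sum_abs _ _).trans
            (Finset.sum_le_sum fun n _ => hTint n)) hr0.le
      _ = (r * r * N) * (c2 / 2 * b * r * ((2 * K + 1) * (D * (2 / (1 - q))))) := by
          simp; ring
      _ = _ := by rw [hrr, one_mul]
  have b4 : |∫ x, r * ∑ n ∈ Finset.range N, X n x * f (W x - r * B n x) ∂μ|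
      ≤ r * ∑ n ∈ Finset.range N, |∫ x, X n x * f (W x - r * B n x) ∂μ| := by
    rw [integral_const_mul, integral_finsetSum _ fun i _ => hint (by fun_prop), abs_mul,
      abs_of_pos hr0]
    exact mul_le_mul_of_nonneg_left (Finset.abs_sum_le_sum_abs _ _) hr0.le
  refine (abs_sub _ _).trans ?_
  have t1 := abs_sub (∫ x, (S2 - E0) * f' (W x) ∂μ) (∫ x, r * r * Y x * f' (W x) ∂μ)
  have t2 := abs_add_le (∫ x, r * ∑ n ∈ Finset.range N, X n x * T n x ∂μ)
    (∫ x, r * ∑ n ∈ Finset.range N, X n x * f (W x - r * B n x) ∂μ)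
  rw [mul_add]
  simp only [hB] at b4 ⊢
  linarith
end

/-! ### Integration on the circle -/

theorem integrable_circle_iff (s : ℝ) {f : S1 → ℝ} :
    Integrable f ↔ IntegrableOn (fun t : ℝ => f (t : S1)) (Set.Ioc s (s + 1)) := by
  have m : MeasurableSet (Set.Ioc s (s + 1)) := measurableSet_Ioc
  have h1 := (AddCircle.measurePreserving_equivIoc (1 : ℝ) (a := s)).integrable_comp_emb
    (AddCircle.measurableEquivIoc 1 s).measurableEmbedding
    (g := fun t : Set.Ioc s (s + 1) => f ((t : ℝ) : S1))
  have h2 : (fun t : Set.Ioc s (s + 1) => f ((t : ℝ) : S1)) ∘ AddCircle.equivIoc (1 : ℝ) s = f := by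
    funext x
    exact congrArg f ((AddCircle.equivIoc (1 : ℝ) s).symm_apply_apply x)
  rw [h2] at h1
  rw [h1, IntegrableOn, ← map_comap_subtype_coe m,
    (MeasurableEmbedding.subtype_coe m).integrable_map_iff]
  rfl

theorem integral_circle_eq (s : ℝ) (f : S1 → ℝ) :
    ∫ x, f x = ∫ t in Set.Ioc s (s + 1), f (t : S1) :=
  (AddCircle.integral_preimage 1 s f).symm

/-! ### Lifts of covering maps of the circle -/

theorem coe_eq_coe_iff_exists_int {x y : ℝ} : (x : S1) = y ↔ ∃ n : ℤ, y = x + n := by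
  refine QuotientAddGroup.eq.trans ?_
  rw [AddSubgroup.mem_zmultiples_iff]
  refine exists_congr fun n => ?_
  rw [zsmul_eq_mul, mul_one]
  constructor <;> intro h <;> linarith

theorem coe_add_natCast (x : ℝ) (k : ℕ) : ((x + k : ℝ) : S1) = (x : S1) :=
  (coe_eq_coe_iff_exists_int.2 ⟨k, by simp⟩).symm

/-- Orientation preserving `C¹` lifts of degree `d`. -/
structure Lift (F : ℝ → ℝ) (d : ℕ) : Prop where
  differentiable : Differentiable ℝ F
  continuous_deriv : Continuous (deriv F)
  deriv_pos : ∀ x, 0 < deriv F x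
  add_one : ∀ x, F (x + 1) = F x + d

namespace Lift

variable {F : ℝ → ℝ} {d : ℕ}

theorem strictMono (h : Lift F d) : StrictMono F := strictMono_of_deriv_pos h.deriv_pos

theorem add_nat (h : Lift F d) (x : ℝ) (n : ℕ) : F (x + n) = F x + n * d := by
  induction n with
  | zero => simp
  | succ n ih =>
    push_cast
    rw [← add_assoc, h.add_one, ih]; ring

theorem degree_pos (h : Lift F d) : 0 < d := by
  have h1 := h.strictMono (show (0 : ℝ) < 0 + 1 by norm_num)
  rw [h.add_one] at h1
  have : (0 : ℝ) < d := by linarith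
  exact_mod_cast this

theorem sub_nat (h : Lift F d) (x : ℝ) (n : ℕ) : F (x - n) = F x - n * d := by
  have := h.add_nat (x - n) n
  rw [sub_add_cancel] at this
  linarith

theorem surjective (h : Lift F d) : Function.Surjective F := by
  have hd : (1 : ℝ) ≤ d := by exact_mod_cast h.degree_pos
  intro y
  obtain ⟨n, hn⟩ := exists_nat_ge (|y - F 0|)
  have hab := abs_le.1 hn
  have hn0 : (0 : ℝ) ≤ n := Nat.cast_nonneg n
  have h1 : F (0 - n) ≤ y := by rw [h.sub_nat]; nlinarith
  have h2 : y ≤ F (0 + n) := by rw [h.add_nat]; nlinarith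
  obtain ⟨x, -, hx⟩ := intermediate_value_Icc (by linarith : (0 : ℝ) - n ≤ 0 + n)
    h.differentiable.continuous.continuousOn ⟨h1, h2⟩
  exact ⟨x, hx⟩

/-- The inverse of a lift. -/
noncomputable def inv (h : Lift F d) : ℝ ≃o ℝ :=
  (h.strictMono.orderIsoOfSurjective F h.surjective).symm

theorem apply_inv (h : Lift F d) (x : ℝ) : F (h.inv x) = x :=
  StrictMono.orderIsoOfSurjective_self_symm_apply F h.strictMono h.surjective x

theorem inv_apply (h : Lift F d) (x : ℝ) : h.inv (F x) = x :=
  StrictMono.orderIsoOfSurjective_symm_apply_self F h.strictMono h.surjective x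

theorem inv_add_degree (h : Lift F d) (x : ℝ) : h.inv (x + d) = h.inv x + 1 := by
  apply h.strictMono.injective
  rw [h.apply_inv, h.add_one, h.apply_inv]

theorem hasDerivAt_inv (h : Lift F d) (x : ℝ) : HasDerivAt h.inv (deriv F (h.inv x))⁻¹ x :=
  HasDerivAt.of_local_left_inverse h.inv.continuous.continuousAt
    (h.differentiable _).hasDerivAt (h.deriv_pos _).ne'
    (Filter.Eventually.of_forall h.apply_inv)

theorem deriv_add_one (h : Lift F d) (x : ℝ) : deriv F (x + 1) = deriv F x := by
  have e : (fun x => F (x + 1)) = fun x => F x + d := funext h.add_one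
  rw [← deriv_comp_add_const F 1 x, e, deriv_add_const]

theorem deriv_eq_of_coe_eq (h : Lift F d) {x y : ℝ} (hxy : (x : S1) = y) :
    deriv F x = deriv F y := by
  have hp : Function.Periodic (deriv F) 1 := h.deriv_add_one
  obtain ⟨n, rfl⟩ := coe_eq_coe_iff_exists_int.1 hxy
  rw [← mul_one (n : ℝ)]
  exact (hp.int_mul n x).symm

/-- The derivative of the branch `k` of the inverse. -/
theorem hasDerivAt_branch (h : Lift F d) (k : ℕ) (x : ℝ) :
    HasDerivAt (fun x => h.inv (x + k)) (deriv F (h.inv (x + k)))⁻¹ x :=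
  (h.hasDerivAt_inv (x + k)).comp_add_const x (k : ℝ)

theorem branch_image (h : Lift F d) (k : ℕ) (z : ℝ) :
    (fun x => h.inv (x + k)) '' Set.Ioc z (z + 1)
      = Set.Ioc (h.inv (z + k)) (h.inv (z + (k + 1 : ℕ))) := by
  have e : (fun x => h.inv (x + k)) = h.inv ∘ fun x => x + (k : ℝ) := rfl
  rw [e, Set.image_comp, Set.image_add_const_Ioc, OrderIso.image_Ioc]
  push_cast
  congr 2; ring

theorem integral_branch (h : Lift F d) (k : ℕ) (z : ℝ) (u : ℝ → ℝ) :
    ∫ t in Set.Ioc (h.inv (z + k)) (h.inv (z + (k + 1 : ℕ))), u t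
      = ∫ x in Set.Ioc z (z + 1), (deriv F (h.inv (x + k)))⁻¹ * u (h.inv (x + k)) := by
  rw [← h.branch_image, integral_image_eq_integral_abs_deriv_smul measurableSet_Ioc
    (fun x _ => (h.hasDerivAt_branch k x).hasDerivWithinAt)
    (fun x _ y _ hxy => by simpa using hxy)]
  congr 1
  funext x
  rw [abs_of_pos (inv_pos.2 (h.deriv_pos _)), smul_eq_mul]

theorem integrableOn_branch (h : Lift F d) (k : ℕ) (z : ℝ) (u : ℝ → ℝ) :
    IntegrableOn u (Set.Ioc (h.inv (z + k)) (h.inv (z + (k + 1 : ℕ)))) ↔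
      IntegrableOn (fun x => (deriv F (h.inv (x + k)))⁻¹ * u (h.inv (x + k)))
        (Set.Ioc z (z + 1)) := by
  rw [← h.branch_image, integrableOn_image_iff_integrableOn_abs_deriv_smul measurableSet_Ioc
    (fun x _ => (h.hasDerivAt_branch k x).hasDerivWithinAt)
    (fun x _ y _ hxy => by simpa using hxy)]
  refine integrableOn_congr_fun (fun x _ => ?_) measurableSet_Ioc
  simp only [abs_of_pos (inv_pos.2 (h.deriv_pos _)), smul_eq_mul]

theorem branch_subset (h : Lift F d) {k : ℕ} (hk : k < d) (z : ℝ) :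
    Set.Ioc (h.inv (z + k)) (h.inv (z + (k + 1 : ℕ))) ⊆ Set.Ioc (h.inv z) (h.inv z + 1) := by
  rw [← h.inv_add_degree]
  refine Set.Ioc_subset_Ioc (h.inv.monotone ?_) (h.inv.monotone ?_)
  · have : (0 : ℝ) ≤ k := Nat.cast_nonneg k
    linarith
  · have : ((k + 1 : ℕ) : ℝ) ≤ d := by exact_mod_cast hk
    linarith

theorem branch_mem_Ioo (h : Lift F d) {k : ℕ} (hk : k < d) {z x : ℝ}
    (hx : x ∈ Set.Ioo z (z + 1)) : h.inv (x + k) ∈ Set.Ioo (h.inv z) (h.inv z + 1) := by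
  rw [← h.inv_add_degree]
  have h1 : (0 : ℝ) ≤ k := Nat.cast_nonneg k
  have h2 : (k : ℝ) + 1 ≤ d := by exact_mod_cast hk
  exact ⟨h.inv.strictMono (by linarith [hx.1]), h.inv.strictMono (by linarith [hx.2])⟩

/-- The `d` inverse images of `(z + k, z + k + 1]` are adjacent and tile one period. -/
theorem integral_Ioc_eq_sum (h : Lift F d) (z : ℝ) {u : ℝ → ℝ}
    (hu : IntegrableOn u (Set.Ioc (h.inv z) (h.inv z + 1))) :
    ∫ t in Set.Ioc (h.inv z) (h.inv z + 1), u t = ∑ k ∈ Finset.range d,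
      ∫ t in Set.Ioc (h.inv (z + k)) (h.inv (z + (k + 1 : ℕ))), u t := by
  have hle : ∀ k : ℕ, h.inv (z + k) ≤ h.inv (z + (k + 1 : ℕ)) := fun k =>
    h.inv.monotone (by push_cast; linarith)
  have h1 := intervalIntegral.sum_integral_adjacent_intervals (μ := volume) (f := u)
    (a := fun k : ℕ => h.inv (z + k)) (n := d) fun k hk => by
      rw [intervalIntegrable_iff, Set.uIoc_of_le (hle k)]
      exact hu.mono_set (h.branch_subset hk z)
  simp only [Nat.cast_zero, add_zero] at h1
  rw [h.inv_add_degree, intervalIntegral.integral_of_le (by linarith)] at h1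
  rw [← h1]
  exact Finset.sum_congr rfl fun k _ => intervalIntegral.integral_of_le (hle k)

theorem comp {F' : ℝ → ℝ} {d' : ℕ} (h' : Lift F' d') (h : Lift F d) : Lift (F' ∘ F) (d * d') where
  differentiable := h'.differentiable.comp h.differentiable
  continuous_deriv := by
    have e : deriv (F' ∘ F) = fun x => deriv F' (F x) * deriv F x :=
      funext fun x => deriv_comp x (h'.differentiable _) (h.differentiable _)
    rw [e]
    exact (h'.continuous_deriv.comp h.differentiable.continuous).mul h.continuous_deriv
  deriv_pos x := by
    rw [deriv_comp x (h'.differentiable _) (h.differentiable _)]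
    exact mul_pos (h'.deriv_pos _) (h.deriv_pos _)
  add_one x := by
    simp only [Function.comp_apply]
    rw [h.add_one, h'.add_nat]; push_cast; ring

theorem id : Lift (fun x => x) 1 where
  differentiable := differentiable_id
  continuous_deriv := by simp only [deriv_id'']; exact continuous_const
  deriv_pos x := by simp
  add_one x := by simp

/-- The fibers of the circle map with lift `F`. -/
theorem finsum_fiber (h : Lift F d) {T : S1 → S1} (hT : ∀ x : ℝ, ((F x : ℝ) : S1) = T x)
    (g : S1 → ℝ) (x : ℝ) :
    ∑ᶠ (y : S1) (_ : T y = x), g y = ∑ k ∈ Finset.range d, g (h.inv (x + k) : ℝ) := by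
  classical
  have hmem : ∀ k ∈ Finset.range d, h.inv (x + k) ∈ Set.Ico (h.inv x) (h.inv x + 1) := by
    intro k hk
    have h1 : (k : ℝ) < d := by exact_mod_cast Finset.mem_range.1 hk
    have h0 : (0 : ℝ) ≤ k := Nat.cast_nonneg k
    rw [← h.inv_add_degree]
    exact ⟨h.inv.monotone (by linarith), h.inv.strictMono (by linarith)⟩
  have hinj : ∀ k ∈ Finset.range d, ∀ l ∈ Finset.range d,
      ((h.inv (x + k) : ℝ) : S1) = (h.inv (x + l) : ℝ) → k = l := by
    intro k hk l hl hkl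
    rw [AddCircle.coe_eq_coe_iff_of_mem_Ico (hmem k hk) (hmem l hl)] at hkl
    simpa using hkl
  rw [← Finset.sum_image (f := g) (g := fun k : ℕ => ((h.inv (x + k) : ℝ) : S1)) hinj,
    ← finsum_mem_coe_finset]
  refine finsum_congr fun y => ?_
  have : (T y = x) ↔ y ∈ ((Finset.range d).image
      (fun k : ℕ => ((h.inv (x + k) : ℝ) : S1)) : Set S1) := by
    rw [Finset.mem_coe, Finset.mem_image]
    constructor
    · intro hy
      -- On the period starting at `h.inv x` the lift takes its values in `[x, x + d)`, so a
      -- preimage of the class of `x` must hit one of `x, …, x + d - 1`.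
      set t : ℝ := (AddCircle.equivIco (1 : ℝ) (h.inv x) y : ℝ) with ht
      have hty : (t : S1) = y := (AddCircle.equivIco (1 : ℝ) (h.inv x)).symm_apply_apply y
      have htm : t ∈ Set.Ico (h.inv x) (h.inv x + 1) :=
        (AddCircle.equivIco (1 : ℝ) (h.inv x) y).2
      rw [← hty, ← hT] at hy
      obtain ⟨n, e⟩ := coe_eq_coe_iff_exists_int.1 hy.symm
      have h1 : x ≤ F t := by
        have := h.strictMono.monotone htm.1
        rwa [h.apply_inv] at this
      have h2 : F t < x + d := by
        have := h.strictMono htm.2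
        rwa [h.add_one, h.apply_inv] at this
      have hn0 : 0 ≤ n := by
        have : (0 : ℝ) ≤ n := by linarith
        exact_mod_cast this
      obtain ⟨k, rfl⟩ := Int.eq_ofNat_of_zero_le hn0
      refine ⟨k, ?_, ?_⟩
      · rw [Finset.mem_range]
        have : (k : ℝ) < d := by
          simp only [Int.cast_natCast] at e
          linarith
        exact_mod_cast this
      · rw [← hty]
        simp only [Int.cast_natCast] at e
        rw [← e, h.inv_apply]
    · rintro ⟨k, -, rfl⟩
      rw [← hT, h.apply_inv, coe_add_natCast]
  simp only [this]

end Lift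

theorem integral_circle_eq_Ioo (s : ℝ) (f : S1 → ℝ) :
    ∫ x, f x = ∫ t in Set.Ioo s (s + 1), f (t : S1) := by
  rw [integral_circle_eq s, integral_Ioc_eq_integral_Ioo]

theorem Integrable.mul_continuous {Ω : Type*} [TopologicalSpace Ω] [CompactSpace Ω]
    [MeasurableSpace Ω] [OpensMeasurableSpace Ω] {μ : Measure Ω} {g H : Ω → ℝ}
    (hg : Integrable g μ) (hH : Continuous H) : Integrable (fun x => g x * H x) μ := by
  obtain ⟨c, hc⟩ := isCompact_univ.exists_bound_of_continuousOn hH.continuousOn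
  exact hg.mul_bdd hH.aestronglyMeasurable (Filter.Eventually.of_forall fun x => hc x trivial)

/-! ### Densities that are log-Lipschitz off a point -/

/-- Functions that are positive and satisfy `ψ x ≤ exp (L |x - y|) ψ y` on the circle with the
point `z` removed. -/
structure LogLipCone (L z : ℝ) (ψ : S1 → ℝ) : Prop where
  pos : ∀ x ∈ Set.Ioo z (z + 1), 0 < ψ (x : S1)
  le_exp_mul : ∀ x ∈ Set.Ioo z (z + 1), ∀ y ∈ Set.Ioo z (z + 1),
    ψ (x : S1) ≤ Real.exp (L * |x - y|) * ψ (y : S1)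

namespace LogLipCone

variable {L z : ℝ} {ψ φ : S1 → ℝ}

theorem mono (h : LogLipCone L z ψ) {L' : ℝ} (hL : L ≤ L') : LogLipCone L' z ψ where
  pos := h.pos
  le_exp_mul x hx y hy := (h.le_exp_mul x hx y hy).trans
    (mul_le_mul_of_nonneg_right (Real.exp_le_exp.2 (mul_le_mul_of_nonneg_right hL (abs_nonneg _)))
      (h.pos y hy).le)

theorem add (h : LogLipCone L z ψ) (h' : LogLipCone L z φ) :
    LogLipCone L z (fun x => ψ x + φ x) where
  pos x hx := add_pos (h.pos x hx) (h'.pos x hx)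
  le_exp_mul x hx y hy := by
    have := h.le_exp_mul x hx y hy
    have := h'.le_exp_mul x hx y hy
    rw [mul_add]; linarith

theorem const_mul (h : LogLipCone L z ψ) {c : ℝ} (hc : 0 < c) :
    LogLipCone L z (fun x => c * ψ x) where
  pos x hx := mul_pos hc (h.pos x hx)
  le_exp_mul x hx y hy := by
    have := mul_le_mul_of_nonneg_left (h.le_exp_mul x hx y hy) hc.le
    linarith

theorem mid_mem : z + 1 / 2 ∈ Set.Ioo z (z + 1) := ⟨by linarith, by linarith⟩

theorem le_exp_mul_of_nonneg (h : LogLipCone L z ψ) (hL : 0 ≤ L) {x y : ℝ}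
    (hx : x ∈ Set.Ioo z (z + 1)) (hy : y ∈ Set.Ioo z (z + 1)) :
    ψ (x : S1) ≤ Real.exp L * ψ (y : S1) := by
  refine (h.le_exp_mul x hx y hy).trans (mul_le_mul_of_nonneg_right (Real.exp_le_exp.2 ?_)
    (h.pos y hy).le)
  refine mul_le_of_le_one_right hL ?_
  rw [abs_le]; constructor <;> linarith [hx.1, hx.2, hy.1, hy.2]

theorem continuousOn (h : LogLipCone L z ψ) :
    ContinuousOn (fun t : ℝ => ψ (t : S1)) (Set.Ioo z (z + 1)) := by
  have key : ∀ x ∈ Set.Ioo z (z + 1), ∀ y ∈ Set.Ioo z (z + 1),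
      Real.log (ψ (x : S1)) - Real.log (ψ (y : S1)) ≤ |L| * |x - y| := by
    intro x hx y hy
    have h1 := Real.log_le_log (h.pos x hx) (h.le_exp_mul x hx y hy)
    rw [Real.log_mul (Real.exp_pos _).ne' (h.pos y hy).ne', Real.log_exp] at h1
    have := mul_le_mul_of_nonneg_right (le_abs_self L) (abs_nonneg (x - y))
    linarith
  have hlip : LipschitzOnWith (Real.nnabs L) (fun t : ℝ => Real.log (ψ (t : S1)))
      (Set.Ioo z (z + 1)) := by
    refine LipschitzOnWith.of_dist_le_mul fun x hx y hy => ?_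
    rw [Real.dist_eq, Real.dist_eq, Real.coe_nnabs, abs_le]
    have h2 := key y hy x hx
    rw [abs_sub_comm] at h2
    constructor <;> linarith [key x hx y hy]
  exact (Real.continuous_exp.comp_continuousOn hlip.continuousOn).congr fun x hx =>
    (Real.exp_log (h.pos x hx)).symm

theorem integrable (h : LogLipCone L z ψ) : Integrable ψ := by
  rw [integrable_circle_iff z, integrableOn_Ioc_iff_integrableOn_Ioo]
  refine Integrable.mono' (g := fun _ => Real.exp |L| * ψ ((z + 1 / 2 : ℝ) : S1))
    (integrableOn_const (by simp)) (h.continuousOn.aestronglyMeasurable measurableSet_Ioo) ?_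
  rw [ae_restrict_iff' measurableSet_Ioo]
  refine Filter.Eventually.of_forall fun x hx => ?_
  rw [Real.norm_eq_abs, abs_of_pos (h.pos x hx)]
  exact (h.mono (le_abs_self L)).le_exp_mul_of_nonneg (abs_nonneg L) hx mid_mem

theorem integral_abs (h : LogLipCone L z ψ) : ∫ x, |ψ x| = ∫ x, ψ x := by
  rw [integral_circle_eq_Ioo z, integral_circle_eq_Ioo z]
  exact setIntegral_congr_fun measurableSet_Ioo fun x hx => abs_of_pos (h.pos x hx)

theorem integral_le (h : LogLipCone L z ψ) (hL : 0 ≤ L) {x : ℝ} (hx : x ∈ Set.Ioo z (z + 1)) :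
    ∫ y, ψ y ≤ Real.exp L * ψ (x : S1) := by
  have hi := h.integrable
  rw [integrable_circle_iff z, integrableOn_Ioc_iff_integrableOn_Ioo] at hi
  rw [integral_circle_eq_Ioo z]
  have hk : IntegrableOn (fun _ : ℝ => Real.exp L * ψ (x : S1)) (Set.Ioo z (z + 1)) :=
    integrableOn_const (by simp)
  refine (setIntegral_mono_on hi hk measurableSet_Ioo fun y hy =>
    h.le_exp_mul_of_nonneg hL hy hx).trans ?_
  simp

theorem integral_nonneg (h : LogLipCone L z ψ) : 0 ≤ ∫ x, ψ x := by
  rw [← h.integral_abs]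
  exact MeasureTheory.integral_nonneg fun x => abs_nonneg _

/-- Subtracting a constant that is at most a proportion `c` of the function. -/
theorem sub_const (h : LogLipCone L z ψ) (hL : 0 ≤ L) {c m : ℝ} (hc0 : 0 ≤ c)
    (hc1 : c < 1) (hm : ∀ x ∈ Set.Ioo z (z + 1), m ≤ c * ψ (x : S1)) :
    LogLipCone (L / (1 - c)) z (fun x => ψ x - m) where
  pos x hx := by
    have := hm x hx
    have := h.pos x hx
    nlinarith
  le_exp_mul x hx y hy := by
    set t := |x - y| with ht
    set E := Real.exp (L / (1 - c) * t) with hE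
    -- Convexity of `exp` between `L t/(1 - c)` and `0`, with weights `1 - c` and `c`. The bound `m
    -- ≤ c ψ(y)` then turns `((1 - c)E + c)ψ(y) - m` into at most `E(ψ(y) - m)`.
    have hconv : Real.exp (L * t) ≤ (1 - c) * E + c := by
      have := convexOn_exp.2 (Set.mem_univ (L / (1 - c) * t)) (Set.mem_univ 0)
        (by linarith : 0 ≤ 1 - c) hc0 (by ring)
      simp only [smul_eq_mul, mul_zero, add_zero, Real.exp_zero, mul_one] at this
      have e : (1 - c) * (L / (1 - c) * t) = L * t := by
        have : 1 - c ≠ 0 := by linarith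
        field_simp
      rwa [e] at this
    have h1 := h.le_exp_mul x hx y hy
    have h2 := hm y hy
    have hp := h.pos y hy
    have h3 := mul_le_mul_of_nonneg_right hconv hp.le
    have hE1 : 1 ≤ E := Real.one_le_exp
      (mul_nonneg (div_nonneg hL (by linarith)) (abs_nonneg _))
    nlinarith

end LogLipCone

/-! ### The transfer operator -/

namespace ExpandingMap

variable {lam A : ℝ}

theorem differentiable_lift (T : ExpandingMap lam A) : Differentiable ℝ T.lift :=
  T.contDiff_lift.differentiable (by norm_num)

theorem differentiable_deriv_lift (T : ExpandingMap lam A) : Differentiable ℝ (deriv T.lift) := by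
  have h := T.contDiff_lift
  rw [show (2 : WithTop ℕ∞) = 1 + 1 by norm_num, contDiff_succ_iff_deriv] at h
  exact h.2.2.differentiable (by norm_num)

theorem bound_nonneg (T : ExpandingMap lam A) : 0 ≤ A :=
  (abs_nonneg _).trans (T.abs_deriv_deriv_le 0)

/-- The increment `T.lift (x + 1) - T.lift x` is continuous and integer valued, hence constant;
monotonicity makes it nonnegative. -/
theorem exists_isLift (T : ExpandingMap lam A) (hlam : 1 < lam) : ∃ d : ℕ, Lift T.lift d := by
  have hint : ∀ x : ℝ, ∃ n : ℤ, T.lift (x + 1) = T.lift x + n := by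
    intro x
    refine coe_eq_coe_iff_exists_int.1 ?_
    rw [T.coe_lift, T.coe_lift]
    congr 1
    simp
  choose n hn using hint
  have hcont : Continuous n := by
    rw [Int.isClosedEmbedding_coe_real.isEmbedding.continuous_iff]
    have e : (fun x => ((n x : ℤ) : ℝ)) = fun x => T.lift (x + 1) - T.lift x := by
      funext x; rw [hn]; ring
    change Continuous (fun x => ((n x : ℤ) : ℝ))
    rw [e]
    have := T.differentiable_lift.continuous
    fun_prop
  have hconst : ∀ x, n x = n 0 := fun x =>
    PreconnectedSpace.constant (inferInstance : PreconnectedSpace ℝ) hcont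
  have hmono : StrictMono T.lift := strictMono_of_deriv_pos fun x =>
    lt_of_lt_of_le (by linarith) (T.le_deriv x)
  have hpos : 0 ≤ n 0 := by
    have h1 := hmono (show (0 : ℝ) < 0 + 1 by norm_num)
    rw [hn] at h1
    have : (0 : ℝ) < n 0 := by linarith
    exact_mod_cast this.le
  obtain ⟨d, hd⟩ := Int.eq_ofNat_of_zero_le hpos
  exact ⟨d, ⟨T.differentiable_lift, T.differentiable_deriv_lift.continuous,
    fun x => lt_of_lt_of_le (by linarith) (T.le_deriv x), fun x => by
      rw [hn, hconst, hd]; simp⟩⟩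

theorem continuous_toFun (T : ExpandingMap lam A) : Continuous T.toFun := by
  have hq : Topology.IsQuotientMap ((↑) : ℝ → S1) := QuotientAddGroup.isQuotientMap_mk _
  rw [hq.continuous_iff]
  have e : T.toFun ∘ ((↑) : ℝ → S1) = fun x => ((T.lift x : ℝ) : S1) :=
    funext fun x => (T.coe_lift x).symm
  rw [e]
  exact (AddCircle.continuous_mk' 1).comp T.differentiable_lift.continuous

theorem derivative_coe (T : ExpandingMap lam A) {d : ℕ} (h : Lift T.lift d) (t : ℝ) :
    T.derivative (t : S1) = deriv T.lift t :=
  h.deriv_eq_of_coe_eq ((AddCircle.equivIco (1 : ℝ) 0).symm_apply_apply (t : S1))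

end ExpandingMap

variable {lam A : ℝ}

theorem transfer_coe (T : ExpandingMap lam A) {d : ℕ} (h : Lift T.lift d) (g : S1 → ℝ) (x : ℝ) :
    transfer T g (x : S1) = ∑ k ∈ Finset.range d,
      (deriv T.lift (h.inv (x + k)))⁻¹ * g (h.inv (x + k) : ℝ) := by
  rw [transfer, h.finsum_fiber T.coe_lift (fun y => g y / T.derivative y)]
  refine Finset.sum_congr rfl fun k _ => ?_
  rw [T.derivative_coe h, div_eq_inv_mul]

theorem integrable_transfer (hlam : 1 < lam) (T : ExpandingMap lam A) {g : S1 → ℝ}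
    (hg : Integrable g) : Integrable (transfer T g) := by
  obtain ⟨d, h⟩ := T.exists_isLift hlam
  rw [integrable_circle_iff 0]
  simp_rw [transfer_coe T h]
  refine integrable_finsetSum _ fun k hk => ?_
  rw [integrable_circle_iff (h.inv 0)] at hg
  exact (h.integrableOn_branch k 0 (fun t => g (t : S1))).1
    (hg.mono_set (h.branch_subset (Finset.mem_range.1 hk) 0))

/-- Duality of the transfer operator with composition: a change of variables on each inverse branch.
-/
theorem integral_transfer_mul (hlam : 1 < lam) (T : ExpandingMap lam A) {g H : S1 → ℝ}
    (hg : Integrable g) (hH : Continuous H) :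
    ∫ x, transfer T g x * H x = ∫ x, g x * H (T.toFun x) := by
  obtain ⟨d, h⟩ := T.exists_isLift hlam
  have hi : Integrable (fun x => g x * H (T.toFun x)) :=
    Integrable.mul_continuous hg (hH.comp T.continuous_toFun)
  have hi' := (integrable_circle_iff (h.inv 0)).1 hi
  rw [integral_circle_eq (h.inv 0) (fun x => g x * H (T.toFun x)), h.integral_Ioc_eq_sum 0 hi',
    integral_circle_eq 0]
  simp_rw [transfer_coe T h, Finset.sum_mul]
  have e : ∀ (k : ℕ) (x : ℝ), (deriv T.lift (h.inv (x + k)))⁻¹ * g (h.inv (x + k) : ℝ) * H (x : S1)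
      = (deriv T.lift (h.inv (x + k)))⁻¹
        * (g (h.inv (x + k) : ℝ) * H (T.toFun (h.inv (x + k) : ℝ))) := by
    intro k x
    rw [← T.coe_lift, h.apply_inv, coe_add_natCast, mul_assoc]
  simp_rw [e]
  rw [integral_finsetSum]
  · refine Finset.sum_congr rfl fun k _ => ?_
    rw [h.integral_branch k 0 (fun t => g (t : S1) * H (T.toFun (t : S1)))]
  · intro k hk
    exact (h.integrableOn_branch k 0 (fun t => g (t : S1) * H (T.toFun (t : S1)))).1
      (hi'.mono_set (h.branch_subset (Finset.mem_range.1 hk) 0))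

theorem integral_transfer (hlam : 1 < lam) (T : ExpandingMap lam A) {g : S1 → ℝ}
    (hg : Integrable g) : ∫ x, transfer T g x = ∫ x, g x := by
  simpa using integral_transfer_mul hlam T hg (H := fun _ => 1) continuous_const

theorem transfer_sub (hlam : 1 < lam) (T : ExpandingMap lam A) (g h : S1 → ℝ) :
    transfer T (fun x => g x - h x) = fun x => transfer T g x - transfer T h x := by
  obtain ⟨d, hd⟩ := T.exists_isLift hlam
  funext x
  induction x using QuotientAddGroup.induction_on with | H x => ?_
  rw [transfer_coe T hd, transfer_coe T hd, transfer_coe T hd, ← Finset.sum_sub_distrib]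
  exact Finset.sum_congr rfl fun k _ => by ring

theorem abs_transfer_le (hlam : 1 < lam) (T : ExpandingMap lam A) (g : S1 → ℝ) (x : S1) :
    |transfer T g x| ≤ transfer T (fun x => |g x|) x := by
  obtain ⟨d, hd⟩ := T.exists_isLift hlam
  induction x using QuotientAddGroup.induction_on with | H x => ?_
  rw [transfer_coe T hd, transfer_coe T hd]
  refine (Finset.abs_sum_le_sum_abs _ _).trans (le_of_eq (Finset.sum_congr rfl fun k _ => ?_))
  rw [abs_mul, abs_of_pos (inv_pos.2 (hd.deriv_pos _))]

theorem integral_abs_transfer_le (hlam : 1 < lam) (T : ExpandingMap lam A) {g : S1 → ℝ}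
    (hg : Integrable g) : ∫ x, |transfer T g x| ≤ ∫ x, |g x| := by
  rw [← integral_transfer hlam T hg.abs]
  exact integral_mono (integrable_transfer hlam T hg).abs (integrable_transfer hlam T hg.abs)
    (abs_transfer_le hlam T g)

/-! ### Iterates -/

theorem transferFrom_add (T : ℕ → ExpandingMap lam A) (a j k : ℕ) (g : S1 → ℝ) :
    transferFrom T a (j + k) g = transferFrom T (a + j) k (transferFrom T a j g) := by
  induction k with
  | zero => rfl
  | succ k ih =>
    change transfer (T (a + (j + k))) (transferFrom T a (j + k) g)
      = transfer (T (a + j + k)) (transferFrom T (a + j) k (transferFrom T a j g))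
    rw [ih, add_assoc]

theorem transferFrom_succ' (T : ℕ → ExpandingMap lam A) (a k : ℕ) (g : S1 → ℝ) :
    transferFrom T a (k + 1) g = transferFrom T (a + 1) k (transfer (T a) g) := by
  rw [add_comm, transferFrom_add]; rfl

theorem transferFrom_sub (hlam : 1 < lam) (T : ℕ → ExpandingMap lam A) (a k : ℕ)
    (g h : S1 → ℝ) : transferFrom T a k (fun x => g x - h x)
      = fun x => transferFrom T a k g x - transferFrom T a k h x := by
  induction k with
  | zero => rfl
  | succ k ih =>
    change transfer _ (transferFrom T a k _) = _
    rw [ih, transfer_sub hlam]; rfl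

theorem integrable_transferFrom (hlam : 1 < lam) (T : ℕ → ExpandingMap lam A) (a k : ℕ)
    {g : S1 → ℝ} (hg : Integrable g) : Integrable (transferFrom T a k g) := by
  induction k with
  | zero => exact hg
  | succ k ih => exact integrable_transfer hlam _ ih

theorem integral_transferFrom (hlam : 1 < lam) (T : ℕ → ExpandingMap lam A) (a k : ℕ)
    {g : S1 → ℝ} (hg : Integrable g) : ∫ x, transferFrom T a k g x = ∫ x, g x := by
  induction k with
  | zero => rfl
  | succ k ih =>
    exact (integral_transfer hlam _ (integrable_transferFrom hlam T a k hg)).trans ih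

theorem integral_abs_transferFrom_le (hlam : 1 < lam) (T : ℕ → ExpandingMap lam A) (a k : ℕ)
    {g : S1 → ℝ} (hg : Integrable g) : ∫ x, |transferFrom T a k g x| ≤ ∫ x, |g x| := by
  induction k with
  | zero => exact le_rfl
  | succ k ih =>
    exact (integral_abs_transfer_le hlam _ (integrable_transferFrom hlam T a k hg)).trans ih

/-- `composeFrom T a k = T_{a+k-1} ∘ ⋯ ∘ T_a`. -/
def composeFrom (T : ℕ → ExpandingMap lam A) (a : ℕ) : ℕ → S1 → S1
  | 0 => id
  | k + 1 => (T (a + k)).toFun ∘ composeFrom T a k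

theorem continuous_composeFrom (T : ℕ → ExpandingMap lam A) (a k : ℕ) :
    Continuous (composeFrom T a k) := by
  induction k with
  | zero => exact continuous_id
  | succ k ih => exact (T (a + k)).continuous_toFun.comp ih

theorem compose_add (T : ℕ → ExpandingMap lam A) (i k : ℕ) :
    compose T (i + k) = composeFrom T (i + 1) k ∘ compose T i := by
  induction k with
  | zero => rfl
  | succ k ih =>
    change (T (i + k + 1)).toFun ∘ compose T (i + k) = _
    rw [ih, add_right_comm i k 1]; rfl

theorem compose_eq_composeFrom (T : ℕ → ExpandingMap lam A) (k : ℕ) :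
    compose T k = composeFrom T 1 k := by
  have := compose_add T 0 k
  rwa [zero_add] at this

theorem continuous_compose (T : ℕ → ExpandingMap lam A) (k : ℕ) : Continuous (compose T k) := by
  rw [compose_eq_composeFrom]; exact continuous_composeFrom T 1 k

theorem integral_transferFrom_mul (hlam : 1 < lam) (T : ℕ → ExpandingMap lam A) (a k : ℕ)
    {g H : S1 → ℝ} (hg : Integrable g) (hH : Continuous H) :
    ∫ x, transferFrom T a k g x * H x = ∫ x, g x * H (composeFrom T a k x) := by
  induction k generalizing H with
  | zero => rfl
  | succ k ih =>
    exact (integral_transfer_mul hlam _ (integrable_transferFrom hlam T a k hg) hH).trans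
      (ih (hH.comp (T (a + k)).continuous_toFun))

/-! ### Action of the transfer operator on log-Lipschitz densities -/

/-- Here `B` measures distortion and `E` expansion. A general lift is allowed because the estimate
serves both a single map and a composition `𝒯_m`. -/
theorem Lift.branch_le_exp_mul {F : ℝ → ℝ} {d : ℕ} (h : Lift F d) {B E L z : ℝ} (hE : 0 < E)
    (hL : 0 ≤ L) (hB : ∀ a b, deriv F a ≤ Real.exp (B * |F a - F b|) * deriv F b)
    (hexp : ∀ a b, E * |a - b| ≤ |F a - F b|) {ψ : S1 → ℝ} (hψ : LogLipCone L (h.inv z) ψ)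
    {k : ℕ} (hk : k < d) {x y : ℝ} (hx : x ∈ Set.Ioo z (z + 1)) (hy : y ∈ Set.Ioo z (z + 1)) :
    (deriv F (h.inv (x + k)))⁻¹ * ψ (h.inv (x + k) : ℝ)
      ≤ Real.exp ((B + L / E) * |x - y|)
        * ((deriv F (h.inv (y + k)))⁻¹ * ψ (h.inv (y + k) : ℝ)) := by
  set a := h.inv (x + k) with ha
  set b := h.inv (y + k) with hb
  have hd : |F a - F b| = |x - y| := by
    rw [ha, hb, h.apply_inv, h.apply_inv]; congr 1; ring
  have hmx := h.branch_mem_Ioo hk hx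
  have hmy := h.branch_mem_Ioo hk hy
  have h1 := hψ.le_exp_mul a hmx b hmy
  have h2 : (deriv F a)⁻¹ ≤ Real.exp (B * |x - y|) * (deriv F b)⁻¹ := by
    have h3 := hB b a
    rw [abs_sub_comm, hd] at h3
    have pa := h.deriv_pos a
    have pb := h.deriv_pos b
    rw [← div_eq_mul_inv, le_div_iff₀ pb, inv_mul_le_iff₀ pa, mul_comm]
    exact h3
  have h4 : ψ (a : S1) ≤ Real.exp (L / E * |x - y|) * ψ (b : S1) := by
    refine h1.trans (mul_le_mul_of_nonneg_right (Real.exp_le_exp.2 ?_) (hψ.pos b hmy).le)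
    have h5 := hexp a b
    rw [hd] at h5
    rw [div_mul_eq_mul_div, le_div_iff₀ hE, mul_assoc]
    exact mul_le_mul_of_nonneg_left (by linarith) hL
  have pa := inv_pos.2 (h.deriv_pos a)
  calc (deriv F a)⁻¹ * ψ (a : S1)
      ≤ (Real.exp (B * |x - y|) * (deriv F b)⁻¹) * (Real.exp (L / E * |x - y|) * ψ (b : S1)) :=
        mul_le_mul h2 h4 (hψ.pos a hmx).le (pa.le.trans h2)
    _ = Real.exp ((B + L / E) * |x - y|) * ((deriv F b)⁻¹ * ψ (b : S1)) := by
        rw [add_mul, Real.exp_add]; ring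

namespace ExpandingMap

theorem mul_abs_sub_le (T : ExpandingMap lam A) (a b : ℝ) :
    lam * |a - b| ≤ |T.lift a - T.lift b| := by
  have key : ∀ a b : ℝ, a ≤ b → lam * |b - a| ≤ |T.lift b - T.lift a| := fun a b hab => by
    rw [abs_of_nonneg (sub_nonneg.2 hab)]
    exact (mul_sub_le_image_sub_of_le_deriv T.differentiable_lift T.le_deriv hab).trans
      (le_abs_self _)
  rcases le_total a b with hab | hab
  · rw [abs_sub_comm a, abs_sub_comm (T.lift a)]; exact key a b hab
  · exact key b a hab

theorem deriv_le_exp_mul (hlam : 1 < lam) (T : ExpandingMap lam A) (a b : ℝ) :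
    deriv T.lift a ≤ Real.exp (A / lam * |a - b|) * deriv T.lift b := by
  have hpos : ∀ x, 0 < deriv T.lift x := fun x => lt_of_lt_of_le (by linarith) (T.le_deriv x)
  have hd : ∀ x, HasDerivAt (fun x => Real.log (deriv T.lift x))
      (deriv (deriv T.lift) x / deriv T.lift x) x := fun x =>
    (T.differentiable_deriv_lift x).hasDerivAt.log (hpos x).ne'
  have hb : ∀ x ∈ Set.univ, ‖deriv (fun x => Real.log (deriv T.lift x)) x‖ ≤ A / lam := by
    intro x _
    rw [(hd x).deriv, Real.norm_eq_abs, abs_div, abs_of_pos (hpos x)]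
    exact div_le_div₀ T.bound_nonneg (T.abs_deriv_deriv_le x) (by linarith) (T.le_deriv x)
  have h1 := convex_univ.norm_image_sub_le_of_norm_deriv_le
    (fun x _ => (hd x).differentiableAt) hb (Set.mem_univ b) (Set.mem_univ a)
  rw [Real.norm_eq_abs, Real.norm_eq_abs] at h1
  have h2 := (le_abs_self _).trans h1
  rw [← Real.exp_log (hpos a), ← Real.exp_log (hpos b), ← Real.exp_add]
  exact Real.exp_le_exp.2 (by linarith)

/-- The distortion of `T` in terms of the distance of the images. -/
theorem deriv_le_exp_mul_image (hlam : 1 < lam) (T : ExpandingMap lam A) (a b : ℝ) :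
    deriv T.lift a ≤ Real.exp (A / lam / lam * |T.lift a - T.lift b|) * deriv T.lift b := by
  refine (T.deriv_le_exp_mul hlam a b).trans (mul_le_mul_of_nonneg_right (Real.exp_le_exp.2 ?_)
    (le_trans (by linarith) (T.le_deriv b)))
  have h0 : 0 < lam := by linarith
  have h1 := T.mul_abs_sub_le a b
  rw [div_mul_eq_mul_div (A / lam), le_div_iff₀ h0, mul_assoc]
  exact mul_le_mul_of_nonneg_left (by linarith) (div_nonneg T.bound_nonneg h0.le)

end ExpandingMap

/-- Every inverse branch of the arc cut at `T z` avoids the jump point `z`, so the image again has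
at most one jump, at `T z`. Expansion divides `L` by `λ`, and the factor `1/T'` adds the distortion
`A/λ²`. -/
theorem LogLipCone.transfer (hlam : 1 < lam) (T : ExpandingMap lam A) {L z : ℝ} (hL : 0 ≤ L)
    {ψ : S1 → ℝ} (hψ : LogLipCone L z ψ) :
    LogLipCone (A / lam / lam + L / lam) (T.lift z) (transfer T ψ) := by
  obtain ⟨d, h⟩ := T.exists_isLift hlam
  rw [← h.inv_apply z] at hψ
  have hpos : ∀ x ∈ Set.Ioo (T.lift z) (T.lift z + 1), ∀ k ∈ Finset.range d,
      0 < (deriv T.lift (h.inv (x + k)))⁻¹ * ψ (h.inv (x + k) : ℝ) := fun x hx k hk =>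
    mul_pos (inv_pos.2 (h.deriv_pos _)) (hψ.pos _ (h.branch_mem_Ioo (Finset.mem_range.1 hk) hx))
  refine ⟨fun x hx => ?_, fun x hx y hy => ?_⟩
  · rw [transfer_coe T h]
    exact Finset.sum_pos (hpos x hx) (Finset.nonempty_range_iff.2 h.degree_pos.ne')
  · rw [transfer_coe T h, transfer_coe T h, Finset.mul_sum]
    exact Finset.sum_le_sum fun k hk => h.branch_le_exp_mul (by linarith) hL
      (T.deriv_le_exp_mul_image hlam) T.mul_abs_sub_le hψ (Finset.mem_range.1 hk) hx hy

/-- The bound for the distortion of compositions. -/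
noncomputable def distortion (lam A : ℝ) : ℝ := A / (lam * (lam - 1))

theorem distortion_nonneg (hlam : 1 < lam) (T : ExpandingMap lam A) : 0 ≤ distortion lam A :=
  div_nonneg T.bound_nonneg (mul_nonneg (by linarith) (by linarith))

/-- `distortion` is the fixed point of `L ↦ A/λ² + L/λ`, so each step moves the constant toward it
by the factor `1/λ`. -/
theorem distortion_step (hlam : 1 < lam) (L t : ℝ) :
    A / lam / lam + (L * t + distortion lam A * (1 - t)) / lam
      = L * (t * lam⁻¹) + distortion lam A * (1 - t * lam⁻¹) := by
  have h0 : lam ≠ 0 := by linarith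
  have h1 : lam - 1 ≠ 0 := by linarith
  unfold distortion
  field_simp
  ring

theorem inv_pow_mem (hlam : 1 < lam) (n : ℕ) : 0 ≤ lam⁻¹ ^ n ∧ lam⁻¹ ^ n ≤ 1 := by
  have h0 : 0 ≤ lam⁻¹ := by rw [inv_nonneg]; linarith
  exact ⟨pow_nonneg h0 n, pow_le_one₀ h0 (inv_le_one_of_one_le₀ hlam.le)⟩

/-- The point `z'` is chosen before `ψ`: the two parts of a signed density must keep a common jump
point. -/
theorem exists_forall_transferFrom (hlam : 1 < lam) (T : ℕ → ExpandingMap lam A) {L : ℝ}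
    (hL : 0 ≤ L) (z : ℝ) (a n : ℕ) : ∃ z', ∀ ψ : S1 → ℝ, LogLipCone L z ψ →
      LogLipCone (L * lam⁻¹ ^ n + distortion lam A * (1 - lam⁻¹ ^ n)) z'
        (transferFrom T a n ψ) := by
  have hD := distortion_nonneg hlam (T 0)
  induction n with
  | zero => exact ⟨z, fun ψ hψ => by simpa [transferFrom] using hψ⟩
  | succ n ih =>
    obtain ⟨z', hz'⟩ := ih
    have hp := inv_pow_mem hlam n
    refine ⟨(T (a + n)).lift z', fun ψ hψ => ?_⟩
    have := (hz' ψ hψ).transfer hlam (T (a + n)) (add_nonneg (mul_nonneg hL hp.1)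
      (mul_nonneg hD (by linarith [hp.2])))
    rw [distortion_step hlam, ← pow_succ] at this
    exact this

theorem LogLipCone.transferFrom (hlam : 1 < lam) (T : ℕ → ExpandingMap lam A) {L z : ℝ}
    (hL : 0 ≤ L) {ψ : S1 → ℝ} (hψ : LogLipCone L z ψ) (a n : ℕ) :
    ∃ z', LogLipCone (L * lam⁻¹ ^ n + distortion lam A * (1 - lam⁻¹ ^ n)) z'
      (transferFrom T a n ψ) :=
  (exists_forall_transferFrom hlam T hL z a n).imp fun _ h => h ψ hψ

theorem convex_comb_le (hlam : 1 < lam) {L D M : ℝ} (h1 : L ≤ M) (h2 : D ≤ M) (n : ℕ) :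
    L * lam⁻¹ ^ n + D * (1 - lam⁻¹ ^ n) ≤ M := by
  obtain ⟨h3, h4⟩ := inv_pow_mem hlam n
  nlinarith

theorem LogLipCone.transferFrom_of_le (hlam : 1 < lam) (T : ℕ → ExpandingMap lam A) {L z : ℝ}
    (hL : 0 ≤ L) (hDL : distortion lam A ≤ L) {ψ : S1 → ℝ} (hψ : LogLipCone L z ψ) (a n : ℕ) :
    ∃ z', LogLipCone L z' (CircleCLT.transferFrom T a n ψ) := by
  obtain ⟨z', h⟩ := hψ.transferFrom hlam T hL a n
  exact ⟨z', h.mono (convex_comb_le hlam le_rfl hDL n)⟩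

/-! ### Memory loss -/

theorem volume_real_univ : (volume : Measure S1).real Set.univ = 1 := by
  simp [Measure.real, AddCircle.measure_univ]

/-- The log-Lipschitz constant for which the coupling contracts at every step. -/
noncomputable def couplingConst (lam A : ℝ) : ℝ := 2 * (|A| / (lam * (lam - 1))) + 1

/-- The proportion of the densities that is coupled at every step. -/
noncomputable def couplingRate (lam A : ℝ) : ℝ :=
  (lam - 1) / (lam + 1) * Real.exp (-couplingConst lam A)

theorem couplingConst_pos (hlam : 1 < lam) (A : ℝ) : 0 < couplingConst lam A := by
  have : 0 ≤ |A| / (lam * (lam - 1)) :=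
    div_nonneg (abs_nonneg A) (mul_nonneg (by linarith) (by linarith))
  unfold couplingConst
  linarith

theorem couplingRate_pos (hlam : 1 < lam) (A : ℝ) : 0 < couplingRate lam A :=
  mul_pos (div_pos (by linarith) (by linarith)) (Real.exp_pos _)

theorem couplingRate_lt_one (hlam : 1 < lam) (A : ℝ) : couplingRate lam A < 1 := by
  have h1 : Real.exp (-couplingConst lam A) ≤ 1 := by
    rw [Real.exp_le_one_iff]; linarith [couplingConst_pos hlam A]
  have h2 : (lam - 1) / (lam + 1) < 1 := by rw [div_lt_one (by linarith)]; linarith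
  have h3 : 0 < (lam - 1) / (lam + 1) := div_pos (by linarith) (by linarith)
  unfold couplingRate
  nlinarith [Real.exp_pos (-couplingConst lam A)]

/-- Subtracting the proportion `c = (λ - 1)/(λ + 1)` multiplies the log-Lipschitz constant by `1/(1
- c) = (λ + 1)/2 < λ`, which one expanding step more than undoes. Any constant at least `2A/(λ(λ -
1))` is then preserved. -/
theorem couplingConst_step (hlam : 1 < lam) (hA : 0 ≤ A) :
    A / lam / lam + couplingConst lam A / (1 - (lam - 1) / (lam + 1)) / lam
      ≤ couplingConst lam A := by
  have h0 : 0 < lam := by linarith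
  have h1 : 0 < lam - 1 := by linarith
  have e1 : 1 - (lam - 1) / (lam + 1) = 2 / (lam + 1) := by field_simp; ring
  rw [e1, couplingConst, abs_of_nonneg hA]
  have e2 : 2 * (A / (lam * (lam - 1))) + 1 - (A / lam / lam
      + (2 * (A / (lam * (lam - 1))) + 1) / (2 / (lam + 1)) / lam) = (lam - 1) / (2 * lam) := by
    field_simp
    ring
  have e3 : 0 < (lam - 1) / (2 * lam) := by positivity
  linarith

theorem integral_abs_sub_le {L L' z z' : ℝ} {ψ φ : S1 → ℝ} (hψ : LogLipCone L z ψ)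
    (hφ : LogLipCone L' z' φ) : ∫ x, |ψ x - φ x| ≤ (∫ x, ψ x) + ∫ x, φ x := by
  rw [← hψ.integral_abs, ← hφ.integral_abs, ← integral_add hψ.integrable.abs hφ.integrable.abs]
  exact integral_mono (hψ.integrable.sub hφ.integrable).abs
    (hψ.integrable.abs.add hφ.integrable.abs) fun x => abs_sub _ _

/-- Both densities are at least `e^{-a} m` off their jumps, with `a = couplingConst`. The constant
`κ m` is removed from both and cancels in the difference, the remainders return to the cone after
one step, and their common mass has shrunk by `1 - κ`. The jump points need not agree. -/
theorem integral_abs_transferFrom_sub_le (hlam : 1 < lam) (T : ℕ → ExpandingMap lam A)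
    (a n : ℕ) {z₁ z₂ m : ℝ} {ψ₁ ψ₂ : S1 → ℝ} (h₁ : LogLipCone (couplingConst lam A) z₁ ψ₁)
    (h₂ : LogLipCone (couplingConst lam A) z₂ ψ₂) (i₁ : ∫ x, ψ₁ x = m) (i₂ : ∫ x, ψ₂ x = m) :
    ∫ x, |transferFrom T a n (fun x => ψ₁ x - ψ₂ x) x|
      ≤ 2 * m * (1 - couplingRate lam A) ^ n := by
  have hpos := couplingConst_pos hlam A
  induction n generalizing a z₁ z₂ m ψ₁ ψ₂ with
  | zero =>
    have := integral_abs_sub_le h₁ h₂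
    rw [i₁, i₂] at this
    simp only [transferFrom, pow_zero]
    linarith
  | succ n ih =>
    set κ := couplingRate lam A with hκ
    have hc0 : 0 ≤ (lam - 1) / (lam + 1) := div_nonneg (by linarith) (by linarith)
    have hc1 : (lam - 1) / (lam + 1) < 1 := by rw [div_lt_one (by linarith)]; linarith
    have hlow : ∀ {ψ : S1 → ℝ} {z : ℝ}, LogLipCone (couplingConst lam A) z ψ → ∫ x, ψ x = m →
        ∀ x ∈ Set.Ioo z (z + 1), κ * m ≤ (lam - 1) / (lam + 1) * ψ (x : S1) := by
      intro ψ z h i x hx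
      have h3 := h.integral_le hpos.le hx
      rw [i] at h3
      have h4 : Real.exp (-couplingConst lam A) * m ≤ ψ (x : S1) := by
        rw [Real.exp_neg, inv_mul_le_iff₀ (Real.exp_pos _)]; exact h3
      rw [hκ, couplingRate, mul_assoc]
      exact mul_le_mul_of_nonneg_left h4 hc0
    have hstep : ∀ {ψ : S1 → ℝ} {z : ℝ}, LogLipCone (couplingConst lam A) z ψ → ∫ x, ψ x = m →
        LogLipCone (couplingConst lam A) ((T a).lift z) (transfer (T a) fun x => ψ x - κ * m) ∧
        ∫ x, transfer (T a) (fun x => ψ x - κ * m) x = (1 - κ) * m := by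
      intro ψ z h i
      have h5 := h.sub_const hpos.le hc0 hc1 (hlow h i)
      refine ⟨(h5.transfer hlam (T a) (div_nonneg hpos.le (by linarith))).mono
        (couplingConst_step hlam (T 0).bound_nonneg), ?_⟩
      rw [integral_transfer hlam _ h5.integrable, integral_sub h.integrable (integrable_const _), i]
      simp [volume_real_univ]; ring
    obtain ⟨c₁, j₁⟩ := hstep h₁ i₁
    obtain ⟨c₂, j₂⟩ := hstep h₂ i₂
    have e : transferFrom T a (n + 1) (fun x => ψ₁ x - ψ₂ x)
        = transferFrom T (a + 1) n (fun x => transfer (T a) (fun x => ψ₁ x - κ * m) x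
          - transfer (T a) (fun x => ψ₂ x - κ * m) x) := by
      rw [transferFrom_succ', ← transfer_sub hlam]
      congr 2
      funext x; ring
    rw [e]
    refine (ih (a + 1) c₁ c₂ j₁ j₂).trans (le_of_eq ?_)
    rw [pow_succ]; ring

/-- Exponential memory loss for log-Lipschitz densities. -/
theorem exists_memory_loss (hlam : 1 < lam) (A : ℝ) :
    ∃ ϑ : ℝ, lam⁻¹ ≤ ϑ ∧ ϑ < 1 ∧ ∀ L : ℝ, 0 ≤ L → ∃ B : ℝ, 0 < B ∧
      ∀ (T : ℕ → ExpandingMap lam A) (a n : ℕ) (z₁ z₂ m : ℝ) (ψ₁ ψ₂ : S1 → ℝ),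
        LogLipCone L z₁ ψ₁ → LogLipCone L z₂ ψ₂ → ∫ x, ψ₁ x = m → ∫ x, ψ₂ x = m →
        ∫ x, |transferFrom T a n (fun x => ψ₁ x - ψ₂ x) x| ≤ B * m * ϑ ^ n := by
  have hinv : lam⁻¹ < 1 := inv_lt_one_of_one_lt₀ hlam
  have hinv0 : 0 < lam⁻¹ := inv_pos.2 (by linarith)
  set ϑ := max lam⁻¹ (1 - couplingRate lam A) with hϑ
  have hϑ0 : 0 < ϑ := lt_of_lt_of_le hinv0 (le_max_left _ _)
  have hϑ1 : ϑ < 1 := max_lt hinv (by linarith [couplingRate_pos hlam A])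
  refine ⟨ϑ, le_max_left _ _, hϑ1, fun L hL => ?_⟩
  -- After `k` steps the initial regularity contributes at most one, and the densities are in the
  -- cone where coupling works. The factor `ϑ^{-k}` in `B` covers the time before, when only the
  -- trivial bound `2m` is used.
  obtain ⟨k, hk⟩ := exists_pow_lt_of_lt_one (show 0 < 1 / (L + 1) by positivity) hinv
  have hLk : L * lam⁻¹ ^ k ≤ 1 := by
    rw [lt_div_iff₀ (by positivity)] at hk
    have : 0 < lam⁻¹ ^ k := pow_pos hinv0 k
    nlinarith
  refine ⟨2 / ϑ ^ k, by positivity, fun T a n z₁ z₂ m ψ₁ ψ₂ h₁ h₂ i₁ i₂ => ?_⟩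
  have hm : 0 ≤ m := i₁ ▸ h₁.integral_nonneg
  have hA := (T 0).bound_nonneg
  rcases le_total n k with hn | hn
  · have e1 := integral_abs_transferFrom_le hlam T a n (h₁.integrable.sub h₂.integrable)
    have e2 := integral_abs_sub_le h₁ h₂
    rw [i₁, i₂] at e2
    refine (e1.trans e2).trans ?_
    have e3 : ϑ ^ k ≤ ϑ ^ n := pow_le_pow_of_le_one hϑ0.le hϑ1.le hn
    have e4 : 1 ≤ ϑ ^ n / ϑ ^ k := (one_le_div (by positivity)).2 e3
    calc m + m = 2 * m * 1 := by ring
      _ ≤ 2 * m * (ϑ ^ n / ϑ ^ k) := mul_le_mul_of_nonneg_left e4 (by positivity)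
      _ = _ := by ring
  · obtain ⟨j, rfl⟩ := Nat.exists_eq_add_of_le hn
    have hle : L * lam⁻¹ ^ k + distortion lam A * (1 - lam⁻¹ ^ k) ≤ couplingConst lam A := by
      have e1 := inv_pow_mem hlam k
      have e2 := distortion_nonneg hlam (T 0)
      have e3 : couplingConst lam A = 2 * distortion lam A + 1 := by
        rw [couplingConst, abs_of_nonneg hA]; rfl
      nlinarith
    obtain ⟨w₁, c₁⟩ := h₁.transferFrom hlam T hL a k
    obtain ⟨w₂, c₂⟩ := h₂.transferFrom hlam T hL a k
    have e1 := integral_abs_transferFrom_sub_le hlam T (a + k) j (c₁.mono hle) (c₂.mono hle)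
      ((integral_transferFrom hlam T a k h₁.integrable).trans i₁)
      ((integral_transferFrom hlam T a k h₂.integrable).trans i₂)
    rw [transferFrom_add, transferFrom_sub hlam]
    refine e1.trans ?_
    have e2 : (1 - couplingRate lam A) ^ j ≤ ϑ ^ j :=
      pow_le_pow_left₀ (by linarith [couplingRate_lt_one hlam A]) (le_max_right _ _) j
    calc 2 * m * (1 - couplingRate lam A) ^ j ≤ 2 * m * ϑ ^ j :=
          mul_le_mul_of_nonneg_left e2 (by positivity)
      _ = _ := by rw [pow_add]; field_simp

theorem IsDensityClass.exists_cone {L : ℝ} {ψ : S1 → ℝ} (h : IsDensityClass L ψ) :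
    ∃ z, LogLipCone L z ψ := by
  obtain ⟨hpos, -, z, hz⟩ := h
  refine ⟨z, fun x _ => hpos _, fun x hx y hy => ?_⟩
  have h1 := (le_abs_self _).trans (hz x hx y hy)
  rw [← Real.exp_log (hpos x), ← Real.exp_log (hpos y), ← Real.exp_add]
  exact Real.exp_le_exp.2 (by linarith)

/-- The steps from `a` to `b - 1` merely replace `ψ₁` by another density of the cone, since its
constant dominates `distortion`; from `b` on, two densities of mass one are compared. -/
theorem memoryLoss_of_cone (hlam : 1 < lam) {L₀ : ℝ≥0} {ϑ B : ℝ}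
    (h : ∀ (T : ℕ → ExpandingMap lam A) (a n : ℕ) (z₁ z₂ m : ℝ) (ψ₁ ψ₂ : S1 → ℝ),
      LogLipCone (max (max (regularityConst lam A) L₀) (distortion lam A)) z₁ ψ₁ →
      LogLipCone (max (max (regularityConst lam A) L₀) (distortion lam A)) z₂ ψ₂ →
      ∫ x, ψ₁ x = m → ∫ x, ψ₂ x = m →
      ∫ x, |transferFrom T a n (fun x => ψ₁ x - ψ₂ x) x| ≤ B * m * ϑ ^ n) :
    MemoryLoss lam A L₀ ϑ B := by
  intro T ψ₁ ψ₂ h₁ h₂ a b c ha hab hbc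
  obtain ⟨z₁, c₁⟩ := h₁.exists_cone
  obtain ⟨z₂, c₂⟩ := h₂.exists_cone
  have hL : 0 ≤ max (max (regularityConst lam A) L₀) (distortion lam A) :=
    le_max_of_le_left (le_max_of_le_right L₀.2)
  obtain ⟨w, d₁⟩ := (c₁.mono (le_max_left _ (distortion lam A))).transferFrom_of_le hlam T hL
    (le_max_right _ _) a (b - a)
  have e1 : transferBetween T c a ψ₁
      = transferFrom T b (c + 1 - b) (transferFrom T a (b - a) ψ₁) := by
    have h1 : c + 1 - a = (b - a) + (c + 1 - b) := by omega
    have h2 : a + (b - a) = b := by omega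
    rw [transferBetween, h1, transferFrom_add, h2]
  have e2 : ∀ x, transferBetween T c a ψ₁ x - transferBetween T c b ψ₂ x
      = transferFrom T b (c + 1 - b) (fun x => transferFrom T a (b - a) ψ₁ x - ψ₂ x) x := by
    intro x
    rw [transferFrom_sub hlam, e1]; rfl
  simp_rw [e2]
  have := h T b (c + 1 - b) w z₂ 1 _ _ d₁ (c₂.mono (le_max_left _ _))
    ((integral_transferFrom hlam T a (b - a) c₁.integrable).trans h₁.2.1) h₂.2.1
  rw [mul_one] at this
  rwa [show c - b + 1 = c + 1 - b by omega]

/-! ### Lipschitz functions and initial densities -/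

theorem dist_coe_le (x y : ℝ) : dist (x : S1) (y : S1) ≤ |x - y| := by
  rw [dist_eq_norm, ← AddCircle.coe_sub, UnitAddCircle.norm_eq]
  simpa using round_le (x - y) 0

theorem abs_le_supNorm {f : S1 → ℝ} (hf : Continuous f) (x : S1) : |f x| ≤ supNorm f := by
  obtain ⟨c, hc⟩ := isCompact_univ.exists_bound_of_continuousOn hf.continuousOn
  exact le_ciSup (f := fun x => |f x|) ⟨c, by rintro _ ⟨y, rfl⟩; exact hc y trivial⟩ x

theorem supNorm_nonneg (f : S1 → ℝ) : 0 ≤ supNorm f := Real.iSup_nonneg fun _ => abs_nonneg _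

theorem lipConst_nonneg (f : S1 → ℝ) : 0 ≤ lipConst f := NNReal.coe_nonneg _

theorem abs_sub_le_lipConst_mul {f : S1 → ℝ} (hf : ∃ K : ℝ≥0, LipschitzWith K f) (x y : S1) :
    |f x - f y| ≤ lipConst f * dist x y := by
  rcases eq_or_ne x y with rfl | hxy
  · simp
  have hd : 0 < dist x y := dist_pos.2 hxy
  rw [← div_le_iff₀ hd]
  obtain ⟨r, hr⟩ : ∃ r : ℝ≥0, (r : ℝ) = |f x - f y| / dist x y :=
    ⟨⟨|f x - f y| / dist x y, by positivity⟩, rfl⟩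
  have hle : r ≤ sInf {K : ℝ≥0 | LipschitzWith K f} := by
    refine le_csInf hf fun K hK => ?_
    rw [← NNReal.coe_le_coe, hr, div_le_iff₀ hd]
    exact hK.dist_le_mul x y
  rw [← hr]
  exact_mod_cast hle

theorem abs_sub_coe_le {f : S1 → ℝ} (hf : ∃ K : ℝ≥0, LipschitzWith K f) (x y : ℝ) :
    |f (x : S1) - f (y : S1)| ≤ lipConst f * |x - y| :=
  (abs_sub_le_lipConst_mul hf _ _).trans
    (mul_le_mul_of_nonneg_left (dist_coe_le x y) (lipConst_nonneg f))

namespace IsInitialDensity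

variable {L₀ : ℝ≥0} {ϱ : S1 → ℝ}

theorem continuous (h : IsInitialDensity L₀ ϱ) : Continuous ϱ := by
  have e : ϱ = fun x => Real.exp (Real.log (ϱ x)) := funext fun x => (Real.exp_log (h.pos x)).symm
  rw [e]
  exact Real.continuous_exp.comp h.lipschitz_log.continuous

theorem abs_log_sub_le (h : IsInitialDensity L₀ ϱ) (x y : ℝ) :
    |Real.log (ϱ (x : S1)) - Real.log (ϱ (y : S1))| ≤ L₀ * |x - y| := by
  have := h.lipschitz_log.dist_le_mul (x : S1) (y : S1)
  rw [Real.dist_eq] at this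
  exact this.trans (mul_le_mul_of_nonneg_left (dist_coe_le x y) L₀.2)

theorem isDensityClass (h : IsInitialDensity L₀ ϱ) : IsDensityClass L₀ ϱ :=
  ⟨h.pos, h.integral_eq_one, 0, fun x _ y _ => h.abs_log_sub_le x y⟩

theorem measurable_ofReal (h : IsInitialDensity L₀ ϱ) :
    Measurable (fun x => ENNReal.ofReal (ϱ x)) :=
  ENNReal.measurable_ofReal.comp h.continuous.measurable

theorem integral_eq (h : IsInitialDensity L₀ ϱ) (g : S1 → ℝ) :
    ∫ x, g x ∂initialMeasure ϱ = ∫ x, ϱ x * g x := by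
  rw [initialMeasure, integral_withDensity_eq_integral_toReal_smul h.measurable_ofReal
    (Filter.Eventually.of_forall fun x => ENNReal.ofReal_lt_top)]
  congr 1
  funext x
  rw [ENNReal.toReal_ofReal (h.pos x).le, smul_eq_mul]

theorem isProbabilityMeasure (h : IsInitialDensity L₀ ϱ) :
    IsProbabilityMeasure (initialMeasure ϱ) := by
  constructor
  rw [initialMeasure, withDensity_apply _ MeasurableSet.univ, Measure.restrict_univ,
    ← ofReal_integral_eq_lintegral_ofReal (integrable_of_continuous _ h.continuous)
      (Filter.Eventually.of_forall fun x => (h.pos x).le), h.integral_eq_one, ENNReal.ofReal_one]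

end IsInitialDensity

/-! ### Signed densities -/

theorem LogLipCone.integral_pos {L z : ℝ} {ψ : S1 → ℝ} (h : LogLipCone L z ψ) :
    0 < ∫ x, ψ x := by
  have hi := h.integrable
  rw [integrable_circle_iff z, integrableOn_Ioc_iff_integrableOn_Ioo] at hi
  rw [integral_circle_eq_Ioo z]
  set c := ψ ((z + 1 / 2 : ℝ) : S1) with hc
  have hcp : 0 < c := h.pos _ LogLipCone.mid_mem
  have hle : ∀ y ∈ Set.Ioo z (z + 1), Real.exp (-|L|) * c ≤ ψ (y : S1) := fun y hy => by
    rw [Real.exp_neg, inv_mul_le_iff₀ (Real.exp_pos _)]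
    exact (h.mono (le_abs_self L)).le_exp_mul_of_nonneg (abs_nonneg L) LogLipCone.mid_mem hy
  have hk : IntegrableOn (fun _ : ℝ => Real.exp (-|L|) * c) (Set.Ioo z (z + 1)) :=
    integrableOn_const (by simp)
  have h1 := setIntegral_mono_on hk hi measurableSet_Ioo hle
  simp only [integral_const, smul_eq_mul, measureReal_restrict_apply_univ, Real.volume_real_Ioo,
    add_sub_cancel_left] at h1
  have h2 : 0 < Real.exp (-|L|) * c := mul_pos (Real.exp_pos _) hcp
  refine lt_of_lt_of_le h2 ?_
  simpa using h1

theorem LogLipCone.integral_mul_le {L z c : ℝ} {ψ u : S1 → ℝ} (h : LogLipCone L z ψ)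
    (hu : Continuous u) (hc : ∀ x, u x ≤ c) : ∫ x, u x * ψ x ≤ c * ∫ x, ψ x := by
  have h1 : Integrable (fun x => u x * ψ x) := by
    simpa only [mul_comm] using Integrable.mul_continuous h.integrable hu
  have h2 : Integrable (fun x => c * ψ x) := h.integrable.const_mul c
  rw [← integral_const_mul]
  rw [integrable_circle_iff z, integrableOn_Ioc_iff_integrableOn_Ioo] at h1 h2
  rw [integral_circle_eq_Ioo z, integral_circle_eq_Ioo z]
  exact setIntegral_mono_on h1 h2 measurableSet_Ioo fun x hx =>
    mul_le_mul_of_nonneg_right (hc _) (h.pos x hx).le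

/-- A positive function that is at least its own Lipschitz constant has a `1`-Lipschitz logarithm.
-/
theorem LogLipCone.mul {L z ℓ : ℝ} {ψ v : S1 → ℝ} (h : LogLipCone L z ψ)
    (hv : ∀ x y : ℝ, |v (x : S1) - v (y : S1)| ≤ ℓ * |x - y|) (hlow : ∀ x, ℓ ≤ v x)
    (hpos : ∀ x, 0 < v x) : LogLipCone (L + 1) z (fun x => v x * ψ x) where
  pos x hx := mul_pos (hpos _) (h.pos x hx)
  le_exp_mul x hx y hy := by
    have h1 := h.le_exp_mul x hx y hy
    have h2 : v (x : S1) ≤ Real.exp |x - y| * v (y : S1) := by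
      have h3 := (abs_le.1 (hv x y)).2
      have h4 : ℓ * |x - y| ≤ v (y : S1) * |x - y| :=
        mul_le_mul_of_nonneg_right (hlow _) (abs_nonneg _)
      have h5 := mul_le_mul_of_nonneg_right (Real.add_one_le_exp |x - y|) (hpos (y : S1)).le
      linarith
    calc v (x : S1) * ψ (x : S1)
        ≤ (Real.exp |x - y| * v (y : S1)) * (Real.exp (L * |x - y|) * ψ (y : S1)) :=
          mul_le_mul h2 h1 (h.pos x hx).le ((hpos _).le.trans h2)
      _ = _ := by rw [add_mul, Real.exp_add, one_mul]; ring

/-- Differences of two log-Lipschitz densities of mass at most `Q`. -/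
def IsSignedDensity (L Q : ℝ) (g : S1 → ℝ) : Prop :=
  ∃ (z : ℝ) (g₁ g₂ : S1 → ℝ), LogLipCone L z g₁ ∧ LogLipCone L z g₂ ∧
    (g = fun x => g₁ x - g₂ x) ∧ ∫ x, g₁ x ≤ Q ∧ ∫ x, g₂ x ≤ Q

theorem LogLipCone.isSignedDensity {L z : ℝ} {ψ : S1 → ℝ} (h : LogLipCone L z ψ)
    (hi : ∫ x, ψ x = 1) : IsSignedDensity L 2 ψ := by
  -- The difference `2ψ - ψ` is used because zero is not in the cone.
  refine ⟨z, fun x => 2 * ψ x, ψ, h.const_mul two_pos, h, by funext x; ring, ?_, by linarith⟩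
  rw [integral_const_mul, hi]; norm_num

namespace IsSignedDensity

variable {L Q : ℝ} {g : S1 → ℝ}

theorem mono (h : IsSignedDensity L Q g) {L' : ℝ} (hL : L ≤ L') : IsSignedDensity L' Q g := by
  obtain ⟨z, g₁, g₂, h₁, h₂, e, i₁, i₂⟩ := h
  exact ⟨z, g₁, g₂, h₁.mono hL, h₂.mono hL, e, i₁, i₂⟩

theorem integrable (h : IsSignedDensity L Q g) : Integrable g := by
  obtain ⟨z, g₁, g₂, h₁, h₂, rfl, i₁, i₂⟩ := h
  exact h₁.integrable.sub h₂.integrable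

theorem transferFrom (hlam : 1 < lam) (T : ℕ → ExpandingMap lam A) (hL : 0 ≤ L)
    (hDL : distortion lam A ≤ L) (h : IsSignedDensity L Q g) (a n : ℕ) :
    IsSignedDensity L Q (transferFrom T a n g) := by
  obtain ⟨z, g₁, g₂, h₁, h₂, rfl, i₁, i₂⟩ := h
  obtain ⟨z', hz'⟩ := exists_forall_transferFrom hlam T hL z a n
  have hle := convex_comb_le hlam (le_refl L) hDL n
  refine ⟨z', _, _, (hz' g₁ h₁).mono hle, (hz' g₂ h₂).mono hle, transferFrom_sub hlam T a n g₁ g₂,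
    ?_, ?_⟩
  · rwa [integral_transferFrom hlam T a n h₁.integrable]
  · rwa [integral_transferFrom hlam T a n h₂.integrable]

theorem mul (h : IsSignedDensity L Q g) {u : S1 → ℝ} {b ℓ : ℝ} (hb : 0 ≤ b) (hℓ : 0 ≤ ℓ)
    (hc : Continuous u) (hu : ∀ x, |u x| ≤ b)
    (hl : ∀ x y : ℝ, |u (x : S1) - u (y : S1)| ≤ ℓ * |x - y|) :
    IsSignedDensity (L + 1) ((3 * b + 2 * ℓ + 2) * Q) (fun x => u x * g x) := by
  obtain ⟨z, g₁, g₂, h₁, h₂, rfl, i₁, i₂⟩ := h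
  -- This shift puts `u + c` above `ℓ`, so multiplication by it costs one unit of log-Lipschitz
  -- constant. The masses grow by at most `(b + c) + c = 3b + 2ℓ + 2`.
  set c := b + ℓ + 1 with hcdef
  have hcpos : 0 < c := by positivity
  have hlow : ∀ x, ℓ + 1 ≤ u x + c := fun x => by
    have := (abs_le.1 (hu x)).1
    linarith
  have hmul : ∀ {φ : S1 → ℝ}, LogLipCone L z φ → LogLipCone (L + 1) z (fun x => (u x + c) * φ x) :=
    fun hφ => hφ.mul (fun x y => by simpa using hl x y) (fun x => by linarith [hlow x])
      (fun x => by linarith [hlow x])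
  have hconst : ∀ {φ : S1 → ℝ}, LogLipCone L z φ → LogLipCone (L + 1) z (fun x => c * φ x) :=
    fun hφ => (hφ.const_mul hcpos).mono (by linarith)
  have hbound : ∀ {φ χ : S1 → ℝ}, LogLipCone L z φ → LogLipCone L z χ → ∫ x, φ x ≤ Q →
      ∫ x, χ x ≤ Q → ∫ x, ((u x + c) * φ x + c * χ x) ≤ (3 * b + 2 * ℓ + 2) * Q := by
    intro φ χ hφ hχ iφ iχ
    rw [integral_add (hmul hφ).integrable (hconst hχ).integrable, integral_const_mul]
    have e1 := hφ.integral_mul_le (u := fun x => u x + c) (c := b + c) (by fun_prop)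
      (fun x => by linarith [(abs_le.1 (hu x)).2])
    have e2 : (b + c) * ∫ x, φ x ≤ (b + c) * Q := mul_le_mul_of_nonneg_left iφ (by positivity)
    have e3 : c * ∫ x, χ x ≤ c * Q := mul_le_mul_of_nonneg_left iχ hcpos.le
    have e4 : (b + c) * Q + c * Q = (3 * b + 2 * ℓ + 2) * Q := by rw [hcdef]; ring
    linarith
  refine ⟨z, fun x => (u x + c) * g₁ x + c * g₂ x, fun x => (u x + c) * g₂ x + c * g₁ x,
    (hmul h₁).add (hconst h₂), (hmul h₂).add (hconst h₁), ?_, hbound h₁ h₂ i₁ i₂,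
    hbound h₂ h₁ i₂ i₁⟩
  funext x; ring

/-- Decorrelation of a signed density from functions of the later states. -/
theorem abs_integral_sub_le (hlam : 1 < lam) {ϑ B : ℝ} (hB : 0 ≤ B) (hϑ : 0 ≤ ϑ)
    (hmem : ∀ (T : ℕ → ExpandingMap lam A) (a n : ℕ) (z₁ z₂ m : ℝ) (ψ₁ ψ₂ : S1 → ℝ),
        LogLipCone L z₁ ψ₁ → LogLipCone L z₂ ψ₂ → ∫ x, ψ₁ x = m → ∫ x, ψ₂ x = m →
        ∫ x, |CircleCLT.transferFrom T a n (fun x => ψ₁ x - ψ₂ x) x| ≤ B * m * ϑ ^ n)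
    (T : ℕ → ExpandingMap lam A) (a n : ℕ) (h : IsSignedDensity L Q g) {z : ℝ} {ψ : S1 → ℝ}
    (hψ : LogLipCone L z ψ) (iψ : ∫ x, ψ x = 1) {H : S1 → ℝ} (hH : Continuous H) {b : ℝ}
    (hb : ∀ x, |H x| ≤ b) :
    |(∫ x, g x * H (composeFrom T a n x)) - (∫ x, g x) * ∫ x, ψ x * H (composeFrom T a n x)|
      ≤ 2 * Q * b * B * ϑ ^ n := by
  obtain ⟨w, g₁, g₂, h₁, h₂, rfl, i₁, i₂⟩ := h
  have hb0 : 0 ≤ b := (abs_nonneg _).trans (hb 0)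
  have hHc : Continuous (fun x => H (composeFrom T a n x)) :=
    hH.comp (continuous_composeFrom T a n)
  -- Each part is compared with the multiple of `ψ` that has the same mass.
  have key : ∀ {φ : S1 → ℝ}, LogLipCone L w φ → ∫ x, φ x ≤ Q →
      |(∫ x, φ x * H (composeFrom T a n x)) - (∫ x, φ x) * ∫ x, ψ x * H (composeFrom T a n x)|
        ≤ Q * b * B * ϑ ^ n := by
    intro φ hφ iφ
    set m := ∫ x, φ x with hm
    have hmpos : 0 < m := hφ.integral_pos
    have hmψ : LogLipCone L z (fun x => m * ψ x) := hψ.const_mul hmpos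
    have hsub : Integrable (fun x => φ x - m * ψ x) := hφ.integrable.sub hmψ.integrable
    have e1 : (∫ x, φ x * H (composeFrom T a n x)) - m * ∫ x, ψ x * H (composeFrom T a n x)
        = ∫ x, CircleCLT.transferFrom T a n (fun x => φ x - m * ψ x) x * H x := by
      rw [integral_transferFrom_mul hlam T a n hsub hH,
        ← integral_const_mul, ← integral_sub (Integrable.mul_continuous hφ.integrable hHc)
          ((Integrable.mul_continuous hψ.integrable hHc).const_mul m)]
      congr 1; funext x; ring
    have hint := integrable_transferFrom hlam T a n (hφ.integrable.sub hmψ.integrable)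
    have e2 := norm_integral_le_of_norm_le (hint.abs.mul_const b)
      (f := fun x => CircleCLT.transferFrom T a n (fun x => φ x - m * ψ x) x * H x)
      (Filter.Eventually.of_forall fun x => by
        rw [Real.norm_eq_abs, abs_mul]
        exact mul_le_mul_of_nonneg_left (hb x) (abs_nonneg _))
    rw [integral_mul_const, Real.norm_eq_abs] at e2
    have e3 := hmem T a n w z m φ (fun x => m * ψ x) hφ hmψ rfl
      (by rw [integral_const_mul, iψ, mul_one])
    rw [e1]
    refine e2.trans ((mul_le_mul_of_nonneg_right e3 hb0).trans ?_)
    calc B * m * ϑ ^ n * b = m * (b * B * ϑ ^ n) := by ring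
      _ ≤ Q * (b * B * ϑ ^ n) := mul_le_mul_of_nonneg_right iφ (by positivity)
      _ = _ := by ring
  have e4 : (∫ x, (g₁ x - g₂ x) * H (composeFrom T a n x))
      = (∫ x, g₁ x * H (composeFrom T a n x)) - ∫ x, g₂ x * H (composeFrom T a n x) := by
    rw [← integral_sub (Integrable.mul_continuous h₁.integrable hHc)
      (Integrable.mul_continuous h₂.integrable hHc)]
    congr 1; funext x; ring
  rw [e4, integral_sub h₁.integrable h₂.integrable]
  have k1 := abs_le.1 (key h₁ i₁)
  have k2 := abs_le.1 (key h₂ i₂)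
  rw [abs_le]
  constructor <;> nlinarith
end IsSignedDensity

/-! ### Decay of correlations from memory loss. -/

theorem IsInitialDensity.logLipCone {L₀ : ℝ≥0} {ϱ : S1 → ℝ} (h : IsInitialDensity L₀ ϱ) :
    ∃ z, LogLipCone L₀ z ϱ := h.isDensityClass.exists_cone

theorem integral_compose (hlam : 1 < lam) (T : ℕ → ExpandingMap lam A) {L₀ : ℝ≥0} {ϱ : S1 → ℝ}
    (h : IsInitialDensity L₀ ϱ) (i : ℕ) {K : S1 → ℝ} (hK : Continuous K) :
    ∫ x, K (compose T i x) ∂initialMeasure ϱ = ∫ x, transferFrom T 1 i ϱ x * K x := by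
  rw [h.integral_eq, compose_eq_composeFrom,
    integral_transferFrom_mul hlam T 1 i (integrable_of_continuous _ h.continuous) hK]

theorem integral_mul_composeFrom (hlam : 1 < lam) (T : ℕ → ExpandingMap lam A) {g w K : S1 → ℝ}
    (hg : Integrable g) (hw : Continuous w) (hK : Continuous K) (a r : ℕ) :
    ∫ x, g x * (w (composeFrom T a r x) * K (composeFrom T a r x))
      = ∫ x, (w x * transferFrom T a r g x) * K x := by
  rw [← integral_transferFrom_mul hlam T a r hg (H := fun x => w x * K x) (hw.mul hK)]
  congr 1; funext x; ring

section
variable {f : S1 → ℝ} (μ : Measure S1) (T : ℕ → ExpandingMap lam A)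

/-- `f - μ(f ∘ 𝒯_i)`, so that `f̄^i` is its composition with `𝒯_i`. -/
noncomputable def recentered (f : S1 → ℝ) (i : ℕ) (x : S1) : ℝ :=
  f x - ∫ y, f (compose T i y) ∂μ

theorem centered_eq (f : S1 → ℝ) (i : ℕ) (x : S1) :
    centered μ T f i x = recentered μ T f i (compose T i x) := rfl

theorem continuous_recentered (hf : Continuous f) (i : ℕ) : Continuous (recentered μ T f i) :=
  hf.sub continuous_const

theorem continuous_centered (hf : Continuous f) (i : ℕ) : Continuous (centered μ T f i) :=
  (continuous_recentered μ T hf i).comp (continuous_compose T i)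

theorem abs_recentered_le [IsProbabilityMeasure μ] (hf : Continuous f) (i : ℕ) (x : S1) :
    |recentered μ T f i x| ≤ 2 * supNorm f := by
  have h1 := norm_integral_le_of_norm_le_const (μ := μ) (f := fun y => f (compose T i y))
    (Filter.Eventually.of_forall fun y => abs_le_supNorm hf _)
  rw [probReal_univ, mul_one, Real.norm_eq_abs] at h1
  have h2 := abs_le_supNorm hf x
  have h3 := abs_sub (f x) (∫ y, f (compose T i y) ∂μ)
  unfold recentered
  linarith

theorem integral_centered [IsProbabilityMeasure μ] (hf : Continuous f) (i : ℕ) :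
    ∫ x, centered μ T f i x ∂μ = 0 := by
  have h1 : Continuous fun x => f (compose T i x) := hf.comp (continuous_compose T i)
  unfold centered
  rw [integral_sub (integrable_of_continuous μ h1) (integrable_const _)]
  simp
end

/-- The factors before a gap are absorbed into a signed density transported to the time where the
gap begins; the factors after it form a bounded function of the later state. At most three factors
are absorbed, hence `L + 3`. Each multiplies the mass bound by `R = 3(2M) + 2M + 2`. -/
theorem correlationDecay_of_cone (hlam : 1 < lam) {L₀ : ℝ≥0} {ϑ B L M : ℝ} (hB : 0 ≤ B)
    (hϑ0 : 0 ≤ ϑ) (hL0 : (L₀ : ℝ) ≤ L) (hDL : distortion lam A ≤ L) (hM : 0 ≤ M)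
    (hmem : ∀ (T : ℕ → ExpandingMap lam A) (a n : ℕ) (z₁ z₂ m : ℝ) (ψ₁ ψ₂ : S1 → ℝ),
        LogLipCone (L + 3) z₁ ψ₁ → LogLipCone (L + 3) z₂ ψ₂ → ∫ x, ψ₁ x = m → ∫ x, ψ₂ x = m →
        ∫ x, |transferFrom T a n (fun x => ψ₁ x - ψ₂ x) x| ≤ B * m * ϑ ^ n)
    (T : ℕ → ExpandingMap lam A) {ϱ f : S1 → ℝ} (h : IsInitialDensity L₀ ϱ)
    (hf : ∃ K : ℝ≥0, LipschitzWith K f) (hfM : lipNorm f ≤ M) :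
    CorrelationDecay (initialMeasure ϱ) T f ϑ (4 * (8 * M + 2) ^ 4 * B)
      (4 * (8 * M + 2) ^ 4 * B) := by
  have := h.isProbabilityMeasure
  have hfc : Continuous f := by obtain ⟨K, hK⟩ := hf; exact hK.continuous
  set μ := initialMeasure ϱ with hμ
  have hL : 0 ≤ L := L₀.2.trans hL0
  set R := 8 * M + 2 with hR
  set u : ℕ → S1 → ℝ := fun i => recentered μ T f i with hu
  have huc : ∀ i, Continuous (u i) := continuous_recentered μ T hfc
  have hsup := supNorm_nonneg f
  have hlip := lipConst_nonneg f
  have hsum : supNorm f + lipConst f ≤ M := hfM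
  have hub : ∀ i x, |u i x| ≤ 2 * M := fun i x =>
    (abs_recentered_le μ T hfc i x).trans (by linarith)
  have hul : ∀ i (x y : ℝ), |u i (x : S1) - u i (y : S1)| ≤ M * |x - y| := fun i x y => by
    have e : u i (x : S1) - u i (y : S1) = f (x : S1) - f (y : S1) := by
      simp only [hu, recentered]; ring
    rw [e]
    exact (abs_sub_coe_le hf x y).trans (mul_le_mul_of_nonneg_right (by linarith) (abs_nonneg _))
  have hcF := continuous_composeFrom T
  have hmul : ∀ {L' Q : ℝ} {g : S1 → ℝ} (i : ℕ), IsSignedDensity L' Q g →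
      IsSignedDensity (L' + 1) (R * Q) (fun x => u i x * g x) := fun i hg => by
    have := hg.mul (by positivity) hM (huc i) (hub i) (hul i)
    rwa [show 3 * (2 * M) + 2 * M + 2 = R by rw [hR]; ring] at this
  -- the densities at the successive times
  obtain ⟨z, hz⟩ := h.logLipCone
  set ρ : ℕ → S1 → ℝ := fun i => transferFrom T 1 i ϱ with hρ
  have hρcone : ∀ i, ∃ z, LogLipCone L z (ρ i) := fun i =>
    (hz.mono hL0).transferFrom_of_le hlam T hL hDL 1 i
  have hρ1 : ∀ i, ∫ x, ρ i x = 1 := fun i => by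
    rw [hρ]
    exact (integral_transferFrom hlam T 1 i hz.integrable).trans h.integral_eq_one
  have hpush : ∀ (i : ℕ) {K : S1 → ℝ}, Continuous K →
      ∫ x, K (compose T i x) ∂μ = ∫ x, ρ i x * K x := fun i K hK => integral_compose hlam T h i hK
  set g1 : ℕ → S1 → ℝ := fun i x => u i x * ρ i x with hg1
  set g2 : ℕ → ℕ → S1 → ℝ := fun i r x => u (i + r) x * transferFrom T (i + 1) r (g1 i) x with hg2
  set g3 : ℕ → ℕ → ℕ → S1 → ℝ := fun i r s x =>
    u (i + r + s) x * transferFrom T (i + r + 1) s (g2 i r) x with hg3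
  have sρ : ∀ i, IsSignedDensity L 2 (ρ i) := fun i => by
    obtain ⟨z', hz'⟩ := hρcone i
    exact hz'.isSignedDensity (hρ1 i)
  have s1 : ∀ i, IsSignedDensity (L + 1) (R * 2) (g1 i) := fun i => hmul i (sρ i)
  have s2 : ∀ i r, IsSignedDensity (L + 2) (R * (R * 2)) (g2 i r) := fun i r => by
    have := hmul (i + r) ((s1 i).transferFrom hlam T (by linarith) (by linarith) (i + 1) r)
    rwa [show L + 1 + 1 = L + 2 by ring] at this
  have s3 : ∀ i r s, IsSignedDensity (L + 3) (R * (R * (R * 2))) (g3 i r s) := fun i r s => by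
    have := hmul (i + r + s)
      ((s2 i r).transferFrom hlam T (by linarith) (by linarith) (i + r + 1) s)
    rwa [show L + 2 + 1 = L + 3 by ring] at this
  -- integrals of products in terms of these densities
  have E1 : ∀ (i : ℕ) {K : S1 → ℝ}, Continuous K →
      ∫ x, u i (compose T i x) * K (compose T i x) ∂μ = ∫ x, g1 i x * K x := fun i K hK => by
    rw [hpush i (K := fun x => u i x * K x) ((huc i).mul hK)]
    congr 1; funext x; simp only [hg1]; ring
  have E2 : ∀ (i r : ℕ) {K : S1 → ℝ}, Continuous K →
      ∫ x, u i (compose T i x) * (u (i + r) (compose T (i + r) x) * K (compose T (i + r) x)) ∂μ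
        = ∫ x, g2 i r x * K x := fun i r K hK => by
    rw [compose_add]
    refine (E1 i (K := fun y => u (i + r) (composeFrom T (i + 1) r y)
      * K (composeFrom T (i + 1) r y))
      (by have := hcF (i + 1) r; have := huc (i + r); fun_prop)).trans ?_
    exact integral_mul_composeFrom hlam T (s1 i).integrable (huc (i + r)) hK (i + 1) r
  have E3 : ∀ (i r s : ℕ) {K : S1 → ℝ}, Continuous K →
      ∫ x, u i (compose T i x) * (u (i + r) (compose T (i + r) x) *
          (u (i + r + s) (compose T (i + r + s) x) * K (compose T (i + r + s) x))) ∂μ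
        = ∫ x, g3 i r s x * K x := fun i r s K hK => by
    rw [compose_add T (i + r) s]
    refine (E2 i r (K := fun y => u (i + r + s) (composeFrom T (i + r + 1) s y)
      * K (composeFrom T (i + r + 1) s y))
      (by have := hcF (i + r + 1) s; have := huc (i + r + s); fun_prop)).trans ?_
    exact integral_mul_composeFrom hlam T (s2 i r).integrable (huc _) hK (i + r + 1) s
  have hmean : ∀ i, ∫ x, u i (compose T i x) ∂μ = 0 := fun i => integral_centered μ T hfc i
  have hg1mean : ∀ i, ∫ x, g1 i x = 0 := fun i => by
    have := E1 i (K := fun _ => 1) continuous_const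
    simpa [hmean] using this.symm
  have hR2 : 2 * M ≤ R := by rw [hR]; linarith
  have hR1 : 1 ≤ R := by rw [hR]; linarith
  have hR0 : 0 ≤ R := by linarith
  have hM2 : 0 ≤ 2 * M := by linarith
  have habs2 : ∀ {a b A' B' : ℝ}, |a| ≤ A' → |b| ≤ B' → |a * b| ≤ A' * B' := fun ha hb => by
    rw [abs_mul]; exact mul_le_mul ha hb (abs_nonneg _) ((abs_nonneg _).trans ha)
  have decay : ∀ {Q b : ℝ} {g H : S1 → ℝ} (i n : ℕ), IsSignedDensity (L + 3) Q g →
      Continuous H → (∀ x, |H x| ≤ b) →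
      |(∫ x, g x * H (composeFrom T (i + 1) n x))
        - (∫ x, g x) * ∫ x, ρ i x * H (composeFrom T (i + 1) n x)| ≤ 2 * Q * b * B * ϑ ^ n := by
    intro Q b g H i n hg hH hb
    obtain ⟨z', hz'⟩ := hρcone i
    exact hg.abs_integral_sub_le hlam hB hϑ0 hmem T (i + 1) n (hz'.mono (by linarith)) (hρ1 i) hH hb
  have final : ∀ {Q b c : ℝ} (n : ℕ), Q * b ≤ 2 * R ^ 4 → |c| ≤ 2 * Q * b * B * ϑ ^ n →
      |c| ≤ 4 * R ^ 4 * B * ϑ ^ n := by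
    intro Q b c n hQ hc
    refine hc.trans (mul_le_mul_of_nonneg_right ?_ (pow_nonneg hϑ0 n))
    exact mul_le_mul_of_nonneg_right (by linarith) hB
  refine ⟨fun i j hij => ?_, fun i j k l hij hjk hkl => ?_, fun i j k l hij hjk hkl => ?_⟩
  · obtain ⟨r, rfl⟩ := Nat.exists_eq_add_of_le hij
    rw [add_tsub_cancel_left]
    have e : ∫ x, centered μ T f i x * centered μ T f (i + r) x ∂μ
        = ∫ x, g1 i x * u (i + r) (composeFrom T (i + 1) r x) := by
      rw [← E1 i (K := fun x => u (i + r) (composeFrom T (i + 1) r x))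
        ((huc _).comp (hcF _ _))]
      simp only [centered_eq, compose_add T i r]; rfl
    have := decay i r ((s1 i).mono (by linarith)) (huc (i + r)) (hub (i + r))
    rw [hg1mean, zero_mul, sub_zero, ← e] at this
    refine final r ?_ this
    have h1 : R * 2 * (2 * M) ≤ R * 2 * R := mul_le_mul_of_nonneg_left hR2 (by positivity)
    have h2 : R ^ 2 ≤ R ^ 4 := pow_le_pow_right₀ hR1 (by norm_num)
    nlinarith
  · obtain ⟨r, rfl⟩ := Nat.exists_eq_add_of_le hij
    obtain ⟨s, rfl⟩ := Nat.exists_eq_add_of_le hjk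
    obtain ⟨t, rfl⟩ := Nat.exists_eq_add_of_le hkl
    rw [add_tsub_cancel_left, add_tsub_cancel_left]
    -- For the first gap the product of means vanishes because `g1 i` has integral zero.
    have c1 : |∫ x, centered μ T f i x * centered μ T f (i + r) x * centered μ T f (i + r + s) x
        * centered μ T f (i + r + s + t) x ∂μ| ≤ 4 * R ^ 4 * B * ϑ ^ r := by
      set H : S1 → ℝ := fun y => u (i + r) y * (u (i + r + s) (composeFrom T (i + r + 1) s y)
        * u (i + r + s + t) (composeFrom T (i + r + s + 1) t
          (composeFrom T (i + r + 1) s y))) with hH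
      have hHc : Continuous H := by
        have := hcF (i + r + 1) s
        have := hcF (i + r + s + 1) t
        have := huc (i + r)
        have := huc (i + r + s)
        have := huc (i + r + s + t)
        simp only [hH]; fun_prop
      have hHb : ∀ x, |H x| ≤ 2 * M * (2 * M * (2 * M)) := fun x =>
        habs2 (hub _ _) (habs2 (hub _ _) (hub _ _))
      have e : ∫ x, centered μ T f i x * centered μ T f (i + r) x * centered μ T f (i + r + s) x
          * centered μ T f (i + r + s + t) x ∂μ
          = ∫ x, g1 i x * H (composeFrom T (i + 1) r x) := by
        rw [← E1 i (K := fun x => H (composeFrom T (i + 1) r x)) (hHc.comp (hcF _ _))]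
        simp only [centered_eq, compose_add T (i + r + s) t, compose_add T (i + r) s,
          compose_add T i r, hH, hu, Function.comp_apply, mul_assoc]
      have := decay i r ((s1 i).mono (by linarith)) hHc hHb
      rw [hg1mean, zero_mul, sub_zero, ← e] at this
      refine final r ?_ this
      have h1 : 2 * M * (2 * M * (2 * M)) ≤ R * (R * R) := by gcongr
      have h2 : R * 2 * (2 * M * (2 * M * (2 * M))) ≤ R * 2 * (R * (R * R)) :=
        mul_le_mul_of_nonneg_left h1 (by positivity)
      calc _ ≤ _ := h2
        _ = _ := by ring
    -- For the last gap it vanishes because the last factor is centered under the law of the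
    -- process.
    have c2 : |∫ x, centered μ T f i x * centered μ T f (i + r) x * centered μ T f (i + r + s) x
        * centered μ T f (i + r + s + t) x ∂μ| ≤ 4 * R ^ 4 * B * ϑ ^ t := by
      have e : ∫ x, centered μ T f i x * centered μ T f (i + r) x * centered μ T f (i + r + s) x
          * centered μ T f (i + r + s + t) x ∂μ
          = ∫ x, g3 i r s x * u (i + r + s + t) (composeFrom T (i + r + s + 1) t x) := by
        rw [← E3 i r s (K := fun x => u (i + r + s + t) (composeFrom T (i + r + s + 1) t x))
          ((huc _).comp (hcF _ _))]
        simp only [centered_eq, compose_add T (i + r + s) t, hu, Function.comp_apply, mul_assoc]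
      have e0 : ∫ x, ρ (i + r + s) x * u (i + r + s + t) (composeFrom T (i + r + s + 1) t x)
          = 0 := by
        rw [← hpush (i + r + s) (K := fun x => u (i + r + s + t)
          (composeFrom T (i + r + s + 1) t x)) ((huc _).comp (hcF _ _))]
        have := hmean (i + r + s + t)
        rwa [compose_add T (i + r + s) t] at this
      have := decay (i + r + s) t (s3 i r s) (huc (i + r + s + t)) (hub _)
      rw [e0, mul_zero, sub_zero, ← e] at this
      refine final t ?_ this
      calc R * (R * (R * 2)) * (2 * M) ≤ R * (R * (R * 2)) * R :=
            mul_le_mul_of_nonneg_left hR2 (by positivity)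
        _ = _ := by ring
    rcases le_total r t with hrt | hrt
    · rw [max_eq_right hrt]; exact c2
    · rw [max_eq_left hrt]; exact c1
  · obtain ⟨r, rfl⟩ := Nat.exists_eq_add_of_le hij
    obtain ⟨s, rfl⟩ := Nat.exists_eq_add_of_le hjk
    obtain ⟨t, rfl⟩ := Nat.exists_eq_add_of_le hkl
    rw [add_tsub_cancel_left]
    set H : S1 → ℝ := fun y => u (i + r + s) y
      * u (i + r + s + t) (composeFrom T (i + r + s + 1) t y) with hH
    have hHc : Continuous H := by
      have := hcF (i + r + s + 1) t
      have := huc (i + r + s)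
      have := huc (i + r + s + t)
      simp only [hH]; fun_prop
    have hHb : ∀ x, |H x| ≤ 2 * M * (2 * M) := fun x => habs2 (hub _ _) (hub _ _)
    have e : ∫ x, centered μ T f i x * centered μ T f (i + r) x * centered μ T f (i + r + s) x
        * centered μ T f (i + r + s + t) x ∂μ
        = ∫ x, g2 i r x * H (composeFrom T (i + r + 1) s x) := by
      rw [← E2 i r (K := fun x => H (composeFrom T (i + r + 1) s x)) (hHc.comp (hcF _ _))]
      simp only [centered_eq, compose_add T (i + r + s) t, compose_add T (i + r) s, hH, hu,
        Function.comp_apply, mul_assoc]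
    have e1 : ∫ x, centered μ T f i x * centered μ T f (i + r) x ∂μ = ∫ x, g2 i r x := by
      have := E2 i r (K := fun _ => 1) continuous_const
      simpa only [mul_one, centered_eq] using this
    have e2 : ∫ x, centered μ T f (i + r + s) x * centered μ T f (i + r + s + t) x ∂μ
        = ∫ x, ρ (i + r) x * H (composeFrom T (i + r + 1) s x) := by
      rw [← hpush (i + r) (K := fun x => H (composeFrom T (i + r + 1) s x)) (hHc.comp (hcF _ _))]
      simp only [centered_eq, compose_add T (i + r + s) t, compose_add T (i + r) s, hH, hu,
        Function.comp_apply]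
    have := decay (i + r) s ((s2 i r).mono (by linarith)) hHc hHb
    rw [← e, ← e1, ← e2] at this
    refine final s ?_ this
    have h1 : 2 * M * (2 * M) ≤ R * R := by gcongr
    calc R * (R * 2) * (2 * M * (2 * M)) ≤ R * (R * 2) * (R * R) :=
          mul_le_mul_of_nonneg_left h1 (by positivity)
      _ = _ := by ring

/-- Memory loss and correlation decay with constants that only depend on the parameters. -/
theorem exists_decay_constants (hlam : 1 < lam) (A : ℝ) :
    ∃ ϑ : ℝ, lam⁻¹ ≤ ϑ ∧ ϑ < 1 ∧
      ∀ L₀ : ℝ≥0,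
        (∃ B₀ : ℝ, 0 < B₀ ∧ MemoryLoss lam A L₀ ϑ B₀) ∧
        ∀ M : ℝ, ∃ C₂ C₄ : ℝ, 0 < C₂ ∧ 0 < C₄ ∧
          ∀ (T : ℕ → ExpandingMap lam A) (ϱ : S1 → ℝ) (f : S1 → ℝ),
            IsInitialDensity L₀ ϱ → (∃ K : ℝ≥0, LipschitzWith K f) → lipNorm f ≤ M →
            CorrelationDecay (initialMeasure ϱ) T f ϑ C₂ C₄ := by
  obtain ⟨ϑ, h1, h2, hL⟩ := exists_memory_loss hlam A
  have hϑ0 : 0 ≤ ϑ := le_trans (inv_nonneg.2 (by linarith)) h1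
  refine ⟨ϑ, h1, h2, fun L₀ => ⟨?_, fun M => ?_⟩⟩
  · obtain ⟨B, hB, hmem⟩ := hL (max (max (regularityConst lam A) L₀) (distortion lam A))
      (le_max_of_le_left (le_max_of_le_right L₀.2))
    exact ⟨B, hB, memoryLoss_of_cone hlam hmem⟩
  · obtain ⟨B, hB, hmem⟩ := hL (max (L₀ : ℝ) (distortion lam A) + 3)
      (add_nonneg (le_max_of_le_left L₀.2) (by norm_num))
    have hpos : 0 < 4 * (8 * max M 0 + 2) ^ 4 * B := by positivity
    exact ⟨_, _, hpos, hpos, fun T ϱ f hϱ hf hfM =>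
      correlationDecay_of_cone hlam hB.le hϑ0 (le_max_left _ _) (le_max_right _ _)
        (le_max_right M 0) hmem T hϱ hf (hfM.trans (le_max_left M 0))⟩

/-! ### Cylinders of the compositions -/

/-- The lift of `𝒯_m` that is the composition of the lifts. -/
def liftCompose (T : ℕ → ExpandingMap lam A) : ℕ → ℝ → ℝ
  | 0 => fun x => x
  | m + 1 => (T (m + 1)).lift ∘ liftCompose T m

theorem coe_liftCompose (T : ℕ → ExpandingMap lam A) (m : ℕ) (x : ℝ) :
    ((liftCompose T m x : ℝ) : S1) = compose T m x := by
  induction m with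
  | zero => rfl
  | succ m ih =>
    change (((T (m + 1)).lift (liftCompose T m x) : ℝ) : S1) = (T (m + 1)).toFun (compose T m x)
    rw [(T (m + 1)).coe_lift, ih]

theorem exists_isLift_liftCompose (hlam : 1 < lam) (T : ℕ → ExpandingMap lam A) (m : ℕ) :
    ∃ d : ℕ, Lift (liftCompose T m) d := by
  induction m with
  | zero => exact ⟨1, Lift.id⟩
  | succ m ih =>
    obtain ⟨d, h⟩ := ih
    obtain ⟨d', h'⟩ := (T (m + 1)).exists_isLift hlam
    exact ⟨d * d', h'.comp h⟩

theorem pow_mul_abs_liftCompose_sub_le (hlam : 1 < lam) (T : ℕ → ExpandingMap lam A)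
    (i r : ℕ) (a b : ℝ) : lam ^ r * |liftCompose T i a - liftCompose T i b|
      ≤ |liftCompose T (i + r) a - liftCompose T (i + r) b| := by
  induction r with
  | zero => simp
  | succ r ih =>
    have h1 := (T (i + r + 1)).mul_abs_sub_le (liftCompose T (i + r) a) (liftCompose T (i + r) b)
    have h2 := mul_le_mul_of_nonneg_left ih (by linarith : 0 ≤ lam)
    rw [pow_succ']
    calc _ = lam * (lam ^ r * |liftCompose T i a - liftCompose T i b|) := by ring
      _ ≤ _ := h2
      _ ≤ _ := h1

/-- Measuring distance at the final time, one more map divides the accumulated distortion by `λ` and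
adds `A/λ²`: the recursion of the cones, started from zero. -/
theorem deriv_liftCompose_le (hlam : 1 < lam) (T : ℕ → ExpandingMap lam A) (m : ℕ) (a b : ℝ) :
    deriv (liftCompose T m) a ≤ Real.exp (distortion lam A * (1 - lam⁻¹ ^ m)
      * |liftCompose T m a - liftCompose T m b|) * deriv (liftCompose T m) b := by
  have hD := distortion_nonneg hlam (T 0)
  induction m with
  | zero =>
    simp [liftCompose]
  | succ m ih =>
    obtain ⟨d, h⟩ := exists_isLift_liftCompose hlam T m
    have hd : ∀ x, deriv (liftCompose T (m + 1)) x
        = deriv (T (m + 1)).lift (liftCompose T m x) * deriv (liftCompose T m) x := fun x =>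
      deriv_comp x ((T (m + 1)).differentiable_lift _) (h.differentiable x)
    set a' := liftCompose T m a with ha'
    set b' := liftCompose T m b with hb'
    set t := |liftCompose T (m + 1) a - liftCompose T (m + 1) b| with ht
    have h1 : deriv (T (m + 1)).lift a'
        ≤ Real.exp (A / lam / lam * t) * deriv (T (m + 1)).lift b' :=
      (T (m + 1)).deriv_le_exp_mul_image hlam a' b'
    have hlam0 : 0 < lam := by linarith
    have hp := inv_pow_mem hlam m
    have h2 : deriv (liftCompose T m) a ≤ Real.exp (distortion lam A * (1 - lam⁻¹ ^ m) / lam * t)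
        * deriv (liftCompose T m) b := by
      refine ih.trans (mul_le_mul_of_nonneg_right (Real.exp_le_exp.2 ?_) (h.deriv_pos b).le)
      have h3 : lam * |a' - b'| ≤ t := (T (m + 1)).mul_abs_sub_le a' b'
      rw [div_mul_eq_mul_div _ lam, le_div_iff₀ hlam0, mul_assoc (_ * _)]
      exact mul_le_mul_of_nonneg_left (by linarith) (mul_nonneg hD (by linarith [hp.2]))
    have e := distortion_step (A := A) hlam 0 (lam⁻¹ ^ m)
    rw [zero_mul, zero_add, zero_mul, zero_add, ← pow_succ] at e
    have hpos : ∀ x, 0 < deriv (T (m + 1)).lift x := fun x =>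
      lt_of_lt_of_le hlam0 ((T (m + 1)).le_deriv x)
    rw [hd, hd, ← e, add_mul, Real.exp_add]
    calc _ ≤ (Real.exp (A / lam / lam * t) * deriv (T (m + 1)).lift b')
          * (Real.exp (distortion lam A * (1 - lam⁻¹ ^ m) / lam * t)
            * deriv (liftCompose T m) b) :=
          mul_le_mul h1 h2 (h.deriv_pos a).le ((hpos a').le.trans h1)
      _ = _ := by ring

theorem distortion_le_regularityConst (hlam : 1 < lam) (hA : 0 ≤ A) :
    distortion lam A ≤ regularityConst lam A := by
  have h0 : 0 < lam := by linarith
  have h1 : 0 < lam - 1 := by linarith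
  have e1 : regularityConst lam A = A * (lam ^ 3 / (lam - 1) ^ 2) := by
    unfold regularityConst
    have : 1 - lam⁻¹ = (lam - 1) / lam := by field_simp
    rw [this]; field_simp
  have e2 : distortion lam A = A * (1 / (lam * (lam - 1))) := by unfold distortion; ring
  rw [e1, e2]
  refine mul_le_mul_of_nonneg_left ?_ hA
  rw [div_le_div_iff₀ (by positivity) (by positivity), one_mul]
  have h2 : lam - 1 ≤ lam ^ 4 := by
    have : 1 ≤ lam ^ 3 := one_le_pow₀ hlam.le
    nlinarith
  nlinarith [mul_le_mul_of_nonneg_left h2 h1.le]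

theorem IsDensityClass.mono {L L' : ℝ} {ψ : S1 → ℝ} (h : IsDensityClass L ψ) (hL : L ≤ L') :
    IsDensityClass L' ψ := by
  obtain ⟨h1, h2, z, hz⟩ := h
  exact ⟨h1, h2, z, fun x hx y hy => (hz x hx y hy).trans
    (mul_le_mul_of_nonneg_right hL (abs_nonneg _))⟩

section
variable {L₀ : ℝ≥0} {ϱ : S1 → ℝ}

/-- The image under `𝒯_m` of the initial density restricted to a cylinder is, when normalized, of
the class `𝒟_{L₁}`. -/
theorem isDensityClass_branch (hlam : 1 < lam) (T : ℕ → ExpandingMap lam A)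
    (hϱ : IsInitialDensity L₀ ϱ) {m d : ℕ} (h : Lift (liftCompose T m) d) {z p : ℝ} {k : ℕ}
    (hk : k < d) (hp : p = ∫ t in Set.Ioc (h.inv (z + k)) (h.inv (z + (k + 1 : ℕ))), ϱ (t : S1))
    (hp0 : 0 < p) :
    IsDensityClass (max (regularityConst lam A) L₀) (AddCircle.liftIco (1 : ℝ) z fun x =>
      p⁻¹ * ((deriv (liftCompose T m) (h.inv (x + k)))⁻¹ * ϱ (h.inv (x + k) : ℝ))) := by
  set v : ℝ → ℝ := fun x => (deriv (liftCompose T m) (h.inv (x + k)))⁻¹ * ϱ (h.inv (x + k) : ℝ)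
    with hv
  have hvpos : ∀ x, 0 < v x := fun x => mul_pos (inv_pos.2 (h.deriv_pos _)) (hϱ.pos _)
  have hcoe : ∀ x ∈ Set.Ioo z (z + 1),
      AddCircle.liftIco (1 : ℝ) z (fun x => p⁻¹ * v x) (x : S1) = p⁻¹ * v x := fun x hx =>
    AddCircle.liftIco_coe_apply (Set.Ioo_subset_Ico_self hx)
  -- The images of the two ends of the cylinder meet at `z`, where the values need not match; this
  -- is the jump that the class permits.
  refine ⟨fun x => mul_pos (inv_pos.2 hp0) (hvpos _), ?_, z, fun x hx y hy => ?_⟩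
  · rw [integral_circle_eq_Ioo z, setIntegral_congr_fun measurableSet_Ioo hcoe,
      ← integral_Ioc_eq_integral_Ioo, integral_const_mul,
      ← h.integral_branch k z (fun t => ϱ (t : S1)), ← hp, inv_mul_cancel₀ hp0.ne']
  · have hlam0 : 0 < lam := by linarith
    have hm := inv_pow_mem hlam m
    have hcone : LogLipCone L₀ (h.inv z) ϱ := by
      refine ⟨fun x _ => hϱ.pos _, fun x _ y _ => ?_⟩
      have h1 := (le_abs_self _).trans (hϱ.abs_log_sub_le x y)
      rw [← Real.exp_log (hϱ.pos (x : S1)), ← Real.exp_log (hϱ.pos (y : S1)), ← Real.exp_add]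
      exact Real.exp_le_exp.2 (by linarith)
    have key : ∀ x ∈ Set.Ioo z (z + 1), ∀ y ∈ Set.Ioo z (z + 1),
        Real.log (v x) - Real.log (v y) ≤ max (regularityConst lam A) L₀ * |x - y| := by
      intro x hx y hy
      have h1 : v x ≤ _ * v y := h.branch_le_exp_mul (B := distortion lam A * (1 - lam⁻¹ ^ m))
        (E := lam ^ m) (by positivity) L₀.2 (deriv_liftCompose_le hlam T m)
        (fun a b => by simpa [liftCompose] using pow_mul_abs_liftCompose_sub_le hlam T 0 m a b)
        hcone hk hx hy
      have h2 := Real.log_le_log (hvpos x) h1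
      rw [Real.log_mul (Real.exp_pos _).ne' (hvpos y).ne', Real.log_exp] at h2
      have h3 : distortion lam A * (1 - lam⁻¹ ^ m) + L₀ / lam ^ m
          ≤ max (regularityConst lam A) L₀ := by
        have := convex_comb_le hlam (le_max_right (regularityConst lam A) (L₀ : ℝ))
          ((distortion_le_regularityConst hlam (T 0).bound_nonneg).trans (le_max_left _ _)) m
        rw [inv_pow] at this ⊢
        rw [div_eq_mul_inv]; linarith
      exact sub_le_iff_le_add.2 (h2.trans (add_le_add
        (mul_le_mul_of_nonneg_right h3 (abs_nonneg (x - y))) le_rfl))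
    rw [hcoe x hx, hcoe y hy, Real.log_mul (inv_pos.2 hp0).ne' (hvpos x).ne',
      Real.log_mul (inv_pos.2 hp0).ne' (hvpos y).ne', add_sub_add_left_eq_sub, abs_le]
    have := key y hy x hx
    rw [abs_sub_comm] at this
    exact ⟨by linarith, key x hx y hy⟩

/-- On every cylinder of `𝒯_m` the law of the later state `𝒯_c` is close to the global one. -/
theorem abs_branch_integral_sub_le (hlam : 1 < lam) {ϑ B₀ : ℝ} (hML : MemoryLoss lam A L₀ ϑ B₀)
    (T : ℕ → ExpandingMap lam A) (hϱ : IsInitialDensity L₀ ϱ) {m c d : ℕ} (hmc : m < c)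
    (h : Lift (liftCompose T m) d) {z : ℝ} {k : ℕ} (hk : k < d) {K : S1 → ℝ} (hK : Continuous K)
    {b : ℝ} (hb : ∀ x, |K x| ≤ b) :
    |(∫ t in Set.Ioc (h.inv (z + k)) (h.inv (z + (k + 1 : ℕ))), ϱ (t : S1) * K (compose T c t))
        - (∫ t in Set.Ioc (h.inv (z + k)) (h.inv (z + (k + 1 : ℕ))), ϱ (t : S1))
          * ∫ x, K (compose T c x) ∂initialMeasure ϱ|
      ≤ (∫ t in Set.Ioc (h.inv (z + k)) (h.inv (z + (k + 1 : ℕ))), ϱ (t : S1))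
        * (b * B₀ * ϑ ^ (c - m)) := by
  set J := Set.Ioc (h.inv (z + k)) (h.inv (z + (k + 1 : ℕ))) with hJ
  set p := ∫ t in J, ϱ (t : S1) with hp
  have hb0 : 0 ≤ b := (abs_nonneg _).trans (hb 0)
  have hϱc : Continuous (fun t : ℝ => ϱ (t : S1)) :=
    hϱ.continuous.comp (AddCircle.continuous_mk' 1)
  have hp0 : 0 < p := by
    have hlt : h.inv (z + k) < h.inv (z + (k + 1 : ℕ)) := h.inv.strictMono (by push_cast; linarith)
    rw [hp, hJ, ← intervalIntegral.integral_of_le hlt.le]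
    exact intervalIntegral.intervalIntegral_pos_of_pos (hϱc.intervalIntegrable _ _)
      (fun t => hϱ.pos _) hlt
  set ψ : S1 → ℝ := AddCircle.liftIco (1 : ℝ) z fun x =>
      p⁻¹ * ((deriv (liftCompose T m) (h.inv (x + k)))⁻¹ * ϱ (h.inv (x + k) : ℝ)) with hψ
  have hψc : IsDensityClass (max (regularityConst lam A) L₀) ψ :=
    isDensityClass_branch hlam T hϱ h hk hp hp0
  obtain ⟨w, hψcone⟩ := hψc.exists_cone
  have e1 : ∫ t in J, ϱ (t : S1) * K (compose T c t)
      = p * ∫ x, transferFrom T (m + 1) (c - m) ψ x * K x := by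
    rw [integral_transferFrom_mul hlam T (m + 1) (c - m) hψcone.integrable hK,
      h.integral_branch k z (fun t => ϱ (t : S1) * K (compose T c t)), integral_circle_eq_Ioo z,
      integral_Ioc_eq_integral_Ioo, ← integral_const_mul]
    refine setIntegral_congr_fun measurableSet_Ioo fun x hx => ?_
    have e2 : ψ (x : S1) = p⁻¹ * ((deriv (liftCompose T m) (h.inv (x + k)))⁻¹
        * ϱ (h.inv (x + k) : ℝ)) := AddCircle.liftIco_coe_apply (Set.Ioo_subset_Ico_self hx)
    have e3 : compose T c (h.inv (x + k) : ℝ) = composeFrom T (m + 1) (c - m) (x : S1) := by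
      conv_lhs => rw [← Nat.add_sub_of_le hmc.le, compose_add]
      rw [Function.comp_apply, ← coe_liftCompose, h.apply_inv, coe_add_natCast]
    rw [e2, e3]
    field_simp
  have e2 : ∫ x, K (compose T c x) ∂initialMeasure ϱ = ∫ x, transferFrom T 1 c ϱ x * K x :=
    integral_compose hlam T hϱ c hK
  have i1 := integrable_transferFrom hlam T (m + 1) (c - m) hψcone.integrable
  have i2 := integrable_transferFrom hlam T 1 c (integrable_of_continuous volume hϱ.continuous)
  -- The global law starts from `ϱ` at time `1`, the cylinder law from `ψ` at time `m + 1`.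
  have hmem := hML T ϱ ψ (hϱ.isDensityClass.mono (le_max_right _ _)) hψc 1 (m + 1) c le_rfl
    (by omega) hmc
  rw [show c - (m + 1) + 1 = c - m by omega] at hmem
  simp only [transferBetween] at hmem
  rw [show c + 1 - 1 = c by omega, show c + 1 - (m + 1) = c - m by omega] at hmem
  rw [e1, e2, ← mul_sub, ← integral_sub (Integrable.mul_continuous i1 hK)
    (Integrable.mul_continuous i2 hK), abs_mul, abs_of_pos hp0]
  refine mul_le_mul_of_nonneg_left ?_ hp0.le
  have e3 := norm_integral_le_of_norm_le ((i2.sub i1).abs.const_mul b)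
    (f := fun x => transferFrom T (m + 1) (c - m) ψ x * K x - transferFrom T 1 c ϱ x * K x)
    (Filter.Eventually.of_forall fun x => by
      rw [← sub_mul, Real.norm_eq_abs, abs_mul, mul_comm, Pi.sub_apply, abs_sub_comm]
      exact mul_le_mul_of_nonneg_right (hb x) (abs_nonneg _))
  rw [integral_const_mul, Real.norm_eq_abs] at e3
  refine e3.trans ?_
  rw [mul_assoc]
  exact mul_le_mul_of_nonneg_left hmem hb0

/-- Decoupling of the far past and the far future. -/
theorem abs_integral_sub_integral_integral_le (hlam : 1 < lam) {ϑ B₀ : ℝ}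
    (hML : MemoryLoss lam A L₀ ϑ B₀) (T : ℕ → ExpandingMap lam A) (hϱ : IsInitialDensity L₀ ϱ)
    {m c : ℕ} (hmc : m < c) {H : S1 → S1 → ℝ} (hH : Continuous (Function.uncurry H)) {b δ : ℝ}
    (hb : ∀ x y, |H x y| ≤ b)
    (hδ : ∀ x x' : ℝ, |liftCompose T m x - liftCompose T m x'| ≤ 1 →
      ∀ y, |H (x : S1) y - H (x' : S1) y| ≤ δ) :
    |(∫ x, H x (compose T c x) ∂initialMeasure ϱ)
        - ∫ x, (∫ y, H x (compose T c y) ∂initialMeasure ϱ) ∂initialMeasure ϱ|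
      ≤ 2 * δ + b * B₀ * ϑ ^ (c - m) := by
  have := hϱ.isProbabilityMeasure
  set μ := initialMeasure ϱ with hμ
  obtain ⟨d, h⟩ := exists_isLift_liftCompose hlam T m
  have hTc := continuous_compose T c
  have hH1 : ∀ x, Continuous (H x) := fun x => hH.comp (Continuous.prodMk_right x)
  have hHT : Continuous fun q : S1 × S1 => H q.1 (compose T c q.2) :=
    hH.comp (continuous_fst.prodMk (hTc.comp continuous_snd))
  set Φ : S1 → ℝ := fun x => ∫ y, H x (compose T c y) ∂μ with hΦ
  have hΦc : Continuous Φ := by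
    obtain ⟨C, hC⟩ := isCompact_univ.exists_bound_of_continuousOn hHT.continuousOn
    refine continuous_of_dominated (bound := fun _ => C)
      (fun x => ((hH1 x).comp hTc).aestronglyMeasurable)
      (fun x => Filter.Eventually.of_forall fun y => hC (x, y) trivial) (integrable_const _)
      (Filter.Eventually.of_forall fun y => hHT.comp (Continuous.prodMk_left y))
  have hdiag : Continuous fun x => H x (compose T c x) := hH.comp (continuous_id.prodMk hTc)
  have hΦδ : ∀ x x' : ℝ, |liftCompose T m x - liftCompose T m x'| ≤ 1 →
      |Φ (x : S1) - Φ (x' : S1)| ≤ δ := by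
    intro x x' hx
    have k1 : Continuous fun y => H (x : S1) (compose T c y) := (hH1 _).comp hTc
    have k2 : Continuous fun y => H (x' : S1) (compose T c y) := (hH1 _).comp hTc
    simp only [hΦ]
    rw [← integral_sub (integrable_of_continuous μ k1) (integrable_of_continuous μ k2)]
    have := norm_integral_le_of_norm_le_const (μ := μ)
      (f := fun y => H (x : S1) (compose T c y) - H (x' : S1) (compose T c y)) (C := δ)
      (Filter.Eventually.of_forall fun y => hδ x x' hx _)
    simpa using this
  set z := liftCompose T m 0 with hz
  have hz0 : h.inv z = 0 := h.inv_apply 0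
  set J : ℕ → Set ℝ := fun k => Set.Ioc (h.inv (z + k)) (h.inv (z + (k + 1 : ℕ))) with hJ
  set p : ℕ → ℝ := fun k => ∫ t in J k, ϱ (t : S1) with hp
  have hmk : Continuous (fun t : ℝ => (t : S1)) := AddCircle.continuous_mk' 1
  have hϱc : Continuous (fun t : ℝ => ϱ (t : S1)) := hϱ.continuous.comp hmk
  have hion : ∀ {u : ℝ → ℝ} (s t : ℝ), Continuous u → IntegrableOn u (Set.Ioc s t) := fun s t hu =>
    (hu.integrableOn_Icc).mono_set Set.Ioc_subset_Icc_self
  have hsplit : ∀ {G : S1 → ℝ}, Continuous G →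
      ∫ x, G x ∂μ = ∑ k ∈ Finset.range d, ∫ t in J k, ϱ (t : S1) * G (t : S1) := by
    intro G hG
    rw [hϱ.integral_eq, integral_circle_eq (h.inv z)]
    exact h.integral_Ioc_eq_sum z (hion _ _ (hϱc.mul (hG.comp hmk)))
  have hpsum : ∑ k ∈ Finset.range d, p k = 1 := by
    have := hsplit (G := fun _ => 1) continuous_const
    simpa [hp] using this.symm
  rw [← integral_sub (integrable_of_continuous μ hdiag) (integrable_of_continuous μ hΦc),
    hsplit (G := fun x => H x (compose T c x) - Φ x) (hdiag.sub hΦc)]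
  have hterm : ∀ k ∈ Finset.range d,
      |∫ t in J k, ϱ (t : S1) * (H (t : S1) (compose T c t) - Φ (t : S1))|
        ≤ p k * (2 * δ + b * B₀ * ϑ ^ (c - m)) := by
    intro k hk
    -- The first variable is frozen at the right end of the cylinder. This costs `δ` in `H` and
    -- again `δ` in its partial average `Φ`; what remains is the law of `𝒯_c` on the cylinder.
    set x₀ : ℝ := h.inv (z + (k + 1 : ℕ)) with hx₀
    have hnear : ∀ t ∈ J k, |liftCompose T m t - liftCompose T m x₀| ≤ 1 := by
      intro t ht
      have h1 := h.strictMono ht.1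
      have h2 := h.strictMono.monotone ht.2
      rw [h.apply_inv] at h1 h2
      rw [hx₀, h.apply_inv, abs_le]
      push_cast at h2 ⊢
      constructor <;> linarith
    set K : S1 → ℝ := H (x₀ : S1) with hK
    have hKc : Continuous K := hH1 _
    have hTt : Continuous fun t : ℝ => compose T c (t : S1) := hTc.comp hmk
    have c1 : Continuous fun t : ℝ => ϱ (t : S1) * (H (t : S1) (compose T c t) - Φ (t : S1)
        - (K (compose T c t) - Φ (x₀ : S1))) :=
      hϱc.mul (((hdiag.comp hmk).sub (hΦc.comp hmk)).sub ((hKc.comp hTt).sub continuous_const))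
    have c2 : Continuous fun t : ℝ => ϱ (t : S1) * K (compose T c t) := hϱc.mul (hKc.comp hTt)
    have c3 : Continuous fun t : ℝ => ϱ (t : S1) * Φ (x₀ : S1) := hϱc.mul continuous_const
    have e1 : ∫ t in J k, ϱ (t : S1) * (H (t : S1) (compose T c t) - Φ (t : S1))
        = (∫ t in J k, ϱ (t : S1) * (H (t : S1) (compose T c t) - Φ (t : S1)
          - (K (compose T c t) - Φ (x₀ : S1))))
        + ((∫ t in J k, ϱ (t : S1) * K (compose T c t)) - p k * Φ (x₀ : S1)) := by
      have c4 : Continuous fun t : ℝ => ϱ (t : S1) * K (compose T c t) - ϱ (t : S1) * Φ (x₀ : S1) :=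
        c2.sub c3
      rw [hp, ← integral_mul_const, ← integral_sub (hion _ _ c2) (hion _ _ c3),
        ← integral_add (hion _ _ c1) (hion _ _ c4)]
      congr 1; funext t; ring
    have e2 : |∫ t in J k, ϱ (t : S1) * (H (t : S1) (compose T c t) - Φ (t : S1)
          - (K (compose T c t) - Φ (x₀ : S1)))| ≤ p k * (2 * δ) := by
      rw [hp, ← integral_mul_const, ← Real.norm_eq_abs]
      refine norm_integral_le_of_norm_le (hion _ _ (hϱc.mul continuous_const)) ?_
      rw [ae_restrict_iff' measurableSet_Ioc]
      refine Filter.Eventually.of_forall fun t ht => ?_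
      rw [Real.norm_eq_abs, abs_mul, abs_of_pos (hϱ.pos _)]
      refine mul_le_mul_of_nonneg_left ?_ (hϱ.pos _).le
      have h1 := hδ t x₀ (hnear t ht) (compose T c t)
      have h2 := hΦδ t x₀ (hnear t ht)
      have h3 : H (t : S1) (compose T c t) - Φ (t : S1) - (K (compose T c t) - Φ (x₀ : S1))
          = (H (t : S1) (compose T c t) - K (compose T c t)) - (Φ (t : S1) - Φ (x₀ : S1)) := by
        ring
      rw [h3]
      exact (abs_sub _ _).trans (by linarith)
    have e3 := abs_branch_integral_sub_le hlam hML T hϱ hmc h (z := z) (Finset.mem_range.1 hk)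
      hKc (hb (x₀ : S1))
    rw [e1, mul_add]
    exact (abs_add_le _ _).trans (add_le_add e2 e3)
  refine (Finset.abs_sum_le_sum_abs _ _).trans ((Finset.sum_le_sum hterm).trans (le_of_eq ?_))
  rw [← Finset.sum_mul, hpsum, one_mul]

end

/-! ### The leading terms of the block bound -/

section
variable {L₀ : ℝ≥0} {ϱ f : S1 → ℝ} {q : ℝ}

/-- Points whose lifted images at time `m` are within one are within `λ^{-(m-i)} ≤ q^{m-i}` at time
`i`. -/
theorem abs_centered_sub_le (hlam : 1 < lam) (T : ℕ → ExpandingMap lam A) (μ : Measure S1)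
    (hf : ∃ K : ℝ≥0, LipschitzWith K f) (hq : lam⁻¹ ≤ q) {i m : ℕ} (him : i ≤ m) {x x' : ℝ}
    (hx : |liftCompose T m x - liftCompose T m x'| ≤ 1) :
    |centered μ T f i (x : S1) - centered μ T f i (x' : S1)| ≤ lipConst f * q ^ (m - i) := by
  have hlam0 : 0 < lam := by linarith
  have h1 := pow_mul_abs_liftCompose_sub_le hlam T i (m - i) x x'
  rw [Nat.add_sub_of_le him] at h1
  have h2 : |liftCompose T i x - liftCompose T i x'| ≤ q ^ (m - i) := by
    refine le_trans ?_ (pow_le_pow_left₀ (inv_nonneg.2 hlam0.le) hq (m - i))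
    rw [inv_pow, ← one_div, le_div_iff₀ (by positivity), mul_comm]
    exact h1.trans hx
  unfold centered
  rw [sub_sub_sub_cancel_right, ← coe_liftCompose, ← coe_liftCompose]
  exact (abs_sub_coe_le hf _ _).trans (mul_le_mul_of_nonneg_left h2 (lipConst_nonneg f))

theorem abs_sum_centered_sub_le (hlam : 1 < lam) (T : ℕ → ExpandingMap lam A) (μ : Measure S1)
    (hf : ∃ K : ℝ≥0, LipschitzWith K f) (hq : lam⁻¹ ≤ q) (hq1 : q < 1) {M a m : ℕ}
    (hM : M + a ≤ m + 1) {x x' : ℝ} (hx : |liftCompose T m x - liftCompose T m x'| ≤ 1) :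
    |(∑ i ∈ Finset.range M, centered μ T f i (x : S1))
        - ∑ i ∈ Finset.range M, centered μ T f i (x' : S1)|
      ≤ lipConst f * (q ^ a / (1 - q)) := by
  have hq0 : 0 ≤ q := le_trans (inv_nonneg.2 (by linarith)) hq
  rw [← Finset.sum_sub_distrib]
  rcases Nat.eq_zero_or_pos M with rfl | hM0
  · have := lipConst_nonneg f
    have : 0 < 1 - q := by linarith
    simp only [Finset.range_zero, Finset.sum_empty, abs_zero]
    positivity
  have h1 : ∀ i ∈ Finset.range M, |centered μ T f i (x : S1) - centered μ T f i (x' : S1)|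
      ≤ lipConst f * (q ^ a * q ^ (M - 1 - i)) := by
    intro i hi
    have hi' := Finset.mem_range.1 hi
    have hin : |centered μ T f i (x : S1) - centered μ T f i (x' : S1)|
        ≤ lipConst f * q ^ (m - i) := by
      rcases le_or_gt i m with him | him
      · exact abs_centered_sub_le hlam T μ hf hq him hx
      · omega
    refine hin.trans (mul_le_mul_of_nonneg_left ?_ (lipConst_nonneg f))
    rw [← pow_add]
    exact pow_le_pow_of_le_one hq0 hq1.le (by omega)
  refine (Finset.abs_sum_le_sum_abs _ _).trans ((Finset.sum_le_sum h1).trans ?_)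
  rw [← Finset.mul_sum, ← Finset.mul_sum, Finset.sum_range_reflect (fun i => q ^ i) M,
    div_eq_mul_one_div (q ^ a)]
  exact mul_le_mul_of_nonneg_left (mul_le_mul_of_nonneg_left (geom_sum_le hq0 hq1 M)
    (by positivity)) (lipConst_nonneg f)

/-- The indices `i ≤ n - 2a` and the time `n` are decoupled at `m = n - a`: a gap `a` before `m`
makes the past nearly constant on cylinders, and a gap `a` after `m` gives memory loss. The
decoupled integral vanishes since `f̄^n` is centered. -/
theorem abs_integral_centered_mul_past_le (hlam : 1 < lam) {B₀ : ℝ}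
    (hML : MemoryLoss lam A L₀ q B₀) (hB₀ : 0 ≤ B₀) (T : ℕ → ExpandingMap lam A)
    (hϱ : IsInitialDensity L₀ ϱ) (hf : ∃ K : ℝ≥0, LipschitzWith K f) (hq : lam⁻¹ ≤ q) (hq1 : q < 1)
    {g : ℝ → ℝ} {c r : ℝ} (hgc : Continuous g) (hg : ∀ x, |g x| ≤ 1)
    (hgL : ∀ x y, |g x - g y| ≤ c * |x - y|) (hc : 0 ≤ c) (hr : 0 ≤ r) {a : ℕ} (ha : 0 < a)
    (n : ℕ) (w : ℝ) :
    |∫ x, centered (initialMeasure ϱ) T f n x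
        * g (r * (∑ i ∈ Finset.range (n + 1 - 2 * a), centered (initialMeasure ϱ) T f i x) + w)
        ∂initialMeasure ϱ|
      ≤ q ^ a * (2 * supNorm f * B₀ + 4 * supNorm f * c * r * lipConst f / (1 - q)) := by
  have := hϱ.isProbabilityMeasure
  set μ := initialMeasure ϱ with hμ
  obtain ⟨C, hC⟩ := hf
  have hfc := hC.continuous
  replace hf : ∃ K : ℝ≥0, LipschitzWith K f := ⟨C, hC⟩
  have hq0 : 0 ≤ q := le_trans (inv_nonneg.2 (by linarith)) hq
  have h1q : 0 < 1 - q := by linarith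
  have hF := supNorm_nonneg f
  have hΛ := lipConst_nonneg f
  set U : S1 → ℝ := fun x => ∑ i ∈ Finset.range (n + 1 - 2 * a), centered μ T f i x with hU
  have hUc : Continuous U := continuous_finsetSum _ fun i _ => continuous_centered μ T hfc i
  -- With an empty past the integral is a multiple of the mean of `f̄^n`, hence zero.
  rcases lt_or_ge n (2 * a) with hn | hn
  · have e : n + 1 - 2 * a = 0 := by omega
    have e2 : ∫ x, centered μ T f n x * g (r * U x + w) ∂μ = 0 := by
      simp only [hU, e, Finset.range_zero, Finset.sum_empty]
      rw [integral_mul_const, integral_centered μ T hfc, zero_mul]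
    rw [e2, abs_zero]
    positivity
  · have hgU : Continuous fun x => g (r * U x + w) :=
      hgc.comp ((continuous_const.mul hUc).add continuous_const)
    have key := abs_integral_sub_integral_integral_le hlam hML T hϱ (m := n - a) (c := n) (by omega)
      (H := fun x y => g (r * U x + w) * recentered μ T f n y)
      (by
        exact (hgU.comp continuous_fst).mul ((continuous_recentered μ T hfc n).comp continuous_snd))
      (b := 2 * supNorm f) (δ := c * (r * (lipConst f * (q ^ a / (1 - q)))) * (2 * supNorm f))
      (fun x y => by
        rw [abs_mul, ← one_mul (2 * _)]
        exact mul_le_mul (hg _) (abs_recentered_le μ T hfc n y) (abs_nonneg _) zero_le_one)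
      (fun x x' hx y => by
        rw [← sub_mul, abs_mul]
        refine mul_le_mul ((hgL _ _).trans (mul_le_mul_of_nonneg_left ?_ hc))
          (abs_recentered_le μ T hfc n y) (abs_nonneg _) (by positivity)
        rw [add_sub_add_right_eq_sub, ← mul_sub, abs_mul, abs_of_nonneg hr]
        exact mul_le_mul_of_nonneg_left
          (abs_sum_centered_sub_le hlam T μ hf hq hq1 (m := n - a) (by omega) hx) hr)
    have e1 : ∀ x, ∫ y, g (r * U x + w) * recentered μ T f n (compose T n y) ∂μ = 0 := fun x => by
      rw [integral_const_mul]
      have := integral_centered μ T hfc n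
      simp only [centered_eq] at this
      rw [this, mul_zero]
    simp only [← hμ, e1, integral_zero, sub_zero] at key
    rw [show n - (n - a) = a by omega] at key
    have e2 : ∫ x, centered μ T f n x * g (r * U x + w) ∂μ
        = ∫ x, g (r * U x + w) * recentered μ T f n (compose T n x) ∂μ := by
      congr 1; funext x; rw [mul_comm, centered_eq]
    rw [e2]
    refine key.trans (le_of_eq ?_)
    field_simp
    ring

/-- The future from `n + 2a` on is decoupled at `m = n + a`. By Fubini its value may then be held
fixed, where it is just the shift `w` of the estimate for the past, which is uniform in `w`. -/
theorem abs_integral_centered_mul_past_future_le (hlam : 1 < lam) {B₀ : ℝ}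
    (hML : MemoryLoss lam A L₀ q B₀) (hB₀ : 0 ≤ B₀) (T : ℕ → ExpandingMap lam A)
    (hϱ : IsInitialDensity L₀ ϱ) (hf : ∃ K : ℝ≥0, LipschitzWith K f) (hq : lam⁻¹ ≤ q) (hq1 : q < 1)
    {g : ℝ → ℝ} {c r : ℝ} (hgc : Continuous g) (hg : ∀ x, |g x| ≤ 1)
    (hgL : ∀ x y, |g x - g y| ≤ c * |x - y|) (hc : 0 ≤ c) (hr : 0 ≤ r) {a : ℕ} (ha : 0 < a)
    (n : ℕ) {v : S1 → ℝ} (hv : Continuous v) :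
    |∫ x, centered (initialMeasure ϱ) T f n x
        * g (r * (∑ i ∈ Finset.range (n + 1 - 2 * a), centered (initialMeasure ϱ) T f i x)
          + r * v (compose T (n + 2 * a) x)) ∂initialMeasure ϱ|
      ≤ q ^ a * (2 * lipConst f + 4 * supNorm f * B₀
        + 8 * supNorm f * c * r * lipConst f / (1 - q)) := by
  have := hϱ.isProbabilityMeasure
  have hpast := fun w => abs_integral_centered_mul_past_le hlam hML hB₀ T hϱ hf hq hq1 hgc hg hgL hc
    hr ha n w
  set μ := initialMeasure ϱ with hμ
  obtain ⟨C, hC⟩ := hf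
  have hfc := hC.continuous
  replace hf : ∃ K : ℝ≥0, LipschitzWith K f := ⟨C, hC⟩
  have hq0 : 0 ≤ q := le_trans (inv_nonneg.2 (by linarith)) hq
  have h1q : 0 < 1 - q := by linarith
  have hF := supNorm_nonneg f
  have hΛ := lipConst_nonneg f
  set U : S1 → ℝ := fun x => ∑ i ∈ Finset.range (n + 1 - 2 * a), centered μ T f i x with hU
  have hUc : Continuous U := continuous_finsetSum _ fun i _ => continuous_centered μ T hfc i
  have hXc := continuous_centered μ T hfc n
  have hX : ∀ x, |centered μ T f n x| ≤ 2 * supNorm f := fun x => abs_recentered_le μ T hfc n _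
  have hH : Continuous fun z : S1 × S1 => centered μ T f n z.1 * g (r * U z.1 + r * v z.2) :=
    (hXc.comp continuous_fst).mul (hgc.comp ((continuous_const.mul (hUc.comp continuous_fst)).add
      (continuous_const.mul (hv.comp continuous_snd))))
  have key := abs_integral_sub_integral_integral_le hlam hML T hϱ (m := n + a) (c := n + 2 * a)
    (by omega) (H := fun x y => centered μ T f n x * g (r * U x + r * v y)) hH
    (b := 2 * supNorm f)
    (δ := lipConst f * q ^ a + 2 * supNorm f * (c * (r * (lipConst f * (q ^ a / (1 - q))))))
    (fun x y => by
      rw [abs_mul, ← mul_one (2 * _)]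
      exact mul_le_mul (hX x) (hg _) (abs_nonneg _) (by positivity))
    (fun x x' hx y => by
      have h1 := abs_centered_sub_le hlam T μ hf hq (i := n) (Nat.le_add_right n a) hx
      rw [Nat.add_sub_cancel_left] at h1
      have h2 := (hgL (r * U x + r * v y) (r * U x' + r * v y)).trans (mul_le_mul_of_nonneg_left
        (c := r * (lipConst f * (q ^ a / (1 - q)))) (by
          rw [add_sub_add_right_eq_sub, ← mul_sub, abs_mul, abs_of_nonneg hr]
          exact mul_le_mul_of_nonneg_left
            (abs_sum_centered_sub_le hlam T μ hf hq hq1 (a := a) (m := n + a) (by omega) hx) hr) hc)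
      have e : ∀ X X' G G' : ℝ, X * G - X' * G' = (X - X') * G + X' * (G - G') := by
        intros; ring
      rw [e]
      refine (abs_add_le _ _).trans (add_le_add ?_ ?_)
      · rw [abs_mul, ← mul_one (lipConst f * _)]
        exact mul_le_mul h1 (hg _) (abs_nonneg _) (by positivity)
      · rw [abs_mul]
        exact mul_le_mul (hX _) h2 (abs_nonneg _) (by positivity))
  have hTc := continuous_compose T (n + 2 * a)
  have hHT : Continuous fun z : S1 × S1 =>
      centered μ T f n z.1 * g (r * U z.1 + r * v (compose T (n + 2 * a) z.2)) :=
    hH.comp (continuous_fst.prodMk (hTc.comp continuous_snd))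
  rw [← hμ, integral_integral_swap (f := fun x y => centered μ T f n x
    * g (r * U x + r * v (compose T (n + 2 * a) y))) (integrable_of_continuous _ hHT),
    show n + 2 * a - (n + a) = a by omega] at key
  have h3 := norm_integral_le_of_norm_le_const (μ := μ)
    (f := fun y => ∫ x, centered μ T f n x
      * g (r * U x + r * v (compose T (n + 2 * a) y)) ∂μ) (Filter.Eventually.of_forall fun y =>
    hpast (r * v (compose T (n + 2 * a) y)))
  rw [probReal_univ, mul_one, Real.norm_eq_abs] at h3
  have h4 := abs_add_le (a := (∫ x, centered μ T f n x
    * g (r * U x + r * v (compose T (n + 2 * a) x)) ∂μ) - ∫ y, ∫ x, centered μ T f n x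
    * g (r * U x + r * v (compose T (n + 2 * a) y)) ∂μ ∂μ) (b := ∫ y, ∫ x, centered μ T f n x
    * g (r * U x + r * v (compose T (n + 2 * a) y)) ∂μ ∂μ)
  rw [sub_add_cancel] at h4
  refine h4.trans ((add_le_add key h3).trans (le_of_eq ?_))
  field_simp
  ring

/-- Removing `|i - n| ≤ 2a - 1` leaves gaps of exactly `2a` on both sides, `a` for each use of
expansion and of memory loss. -/
theorem sum_sub_sum_bandWeight_mul (X : ℕ → ℝ) {a n N : ℕ} (ha : 0 < a) (hn : n < N) :
    ∑ i ∈ Finset.range N, X i - ∑ i ∈ Finset.range N, bandWeight (2 * a - 1) n i * X i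
      = ∑ i ∈ Finset.range (n + 1 - 2 * a), X i + ∑ i ∈ Finset.Ico (n + 2 * a) N, X i := by
  have e1 : Finset.range (n + 1 - 2 * a)
      = (Finset.range N).filter (fun i => i < n + 1 - 2 * a) := by
    ext i; simp only [Finset.mem_range, Finset.mem_filter]; omega
  have e2 : Finset.Ico (n + 2 * a) N = (Finset.range N).filter (fun i => n + 2 * a ≤ i) := by
    ext i; simp only [Finset.mem_range, Finset.mem_filter, Finset.mem_Ico]; omega
  rw [e1, e2, Finset.sum_filter, Finset.sum_filter, ← Finset.sum_sub_distrib,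
    ← Finset.sum_add_distrib]
  refine Finset.sum_congr rfl fun i _ => ?_
  unfold bandWeight Nat.dist
  split_ifs <;> first | omega | simp

/-- The contribution of the index `n`, when a block of indices around `n` is removed. -/
theorem abs_integral_centered_mul_block_le (hlam : 1 < lam) {B₀ : ℝ}
    (hML : MemoryLoss lam A L₀ q B₀) (hB₀ : 0 ≤ B₀) (T : ℕ → ExpandingMap lam A)
    (hϱ : IsInitialDensity L₀ ϱ) (hf : ∃ K : ℝ≥0, LipschitzWith K f) (hq : lam⁻¹ ≤ q) (hq1 : q < 1)
    {g : ℝ → ℝ} {c : ℝ} (hgc : Continuous g) (hg : ∀ x, |g x| ≤ 1)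
    (hgL : ∀ x y, |g x - g y| ≤ c * |x - y|) (hc : 0 ≤ c) {a : ℕ} (ha : 0 < a)
    {n N : ℕ} (hn : n < N) :
    |∫ x, centered (initialMeasure ϱ) T f n x
        * g (normalizedSum (initialMeasure ϱ) T f N x - (Real.sqrt N)⁻¹ * ∑ i ∈ Finset.range N,
          bandWeight (2 * a - 1) n i * centered (initialMeasure ϱ) T f i x) ∂initialMeasure ϱ|
      ≤ q ^ a * (2 * lipConst f + 4 * supNorm f * B₀
        + 8 * supNorm f * c * (Real.sqrt N)⁻¹ * lipConst f / (1 - q)) := by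
  have hfc : Continuous f := hf.choose_spec.continuous
  have key := abs_integral_centered_mul_past_future_le hlam hML hB₀ T hϱ hf hq hq1 hgc hg hgL hc
    (inv_nonneg.2 (Real.sqrt_nonneg N)) ha n
    (v := fun y => ∑ i ∈ Finset.Ico (n + 2 * a) N, recentered (initialMeasure ϱ) T f i
      (composeFrom T (n + 2 * a + 1) (i - (n + 2 * a)) y))
    (continuous_finsetSum _ fun i _ => (continuous_recentered _ T hfc i).comp
      (continuous_composeFrom T _ _))
  refine le_of_eq_of_le ?_ key
  congr 2
  funext x
  have e : ∑ i ∈ Finset.Ico (n + 2 * a) N, centered (initialMeasure ϱ) T f i x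
      = ∑ i ∈ Finset.Ico (n + 2 * a) N, recentered (initialMeasure ϱ) T f i
      (composeFrom T (n + 2 * a + 1) (i - (n + 2 * a)) (compose T (n + 2 * a) x)) := by
    refine Finset.sum_congr rfl fun i hi => ?_
    have h1 := congrFun (compose_add T (n + 2 * a) (i - (n + 2 * a))) x
    rw [Nat.add_sub_of_le (Finset.mem_Ico.1 hi).1] at h1
    rw [centered_eq, h1, Function.comp_apply]
  rw [normalizedSum, ← mul_sub, sum_sub_sum_bandWeight_mul _ ha hn, mul_add, e]

end

/-! ### Choice of the block length -/

/-- To be read with `s = σ_N`, `t = √N`, `ℓ = log N`, `p = √ϑ`, `E = ϑ^a`, `F = ‖f‖_∞`, `Λ =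
Lip(f)`, and `S` a common bound for `1` and `σ_N⁻²`. The band terms give the two parts of `60 D(1 +
F)`: `5/2 · 21 = 52.5` and `8 · 7 = 56` are rounded up to `60`. The decoupling errors give the other
terms. -/
theorem stein_bound_arithmetic {D F Λ B₀ s S ℓ t p a E : ℝ} (hD : 0 ≤ D) (hF : 0 ≤ F) (hΛ : 0 ≤ Λ)
    (hB₀ : 0 ≤ B₀) (hs : 0 < s) (hS : 1 ≤ S) (hsS : s⁻¹ ^ 2 ≤ S) (hℓ : 2.77 ≤ ℓ) (ht : 4 ≤ t)
    (hp0 : 0 < p) (hp1 : p < 1) (ha : a ≤ ℓ / (1 - p ^ 2) + 1) (hE : 0 ≤ E) (hE1 : E ≤ t⁻¹ ^ 2)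
    (hE2 : E ≤ p * t⁻¹) :
    5 / (2 * s) * (t ^ 2 * D * E ^ 2 + D * (20 * ℓ) / ((1 - p ^ 2) ^ 2 * t))
        + 4 / s ^ 2 / 2 * (2 * F) * t⁻¹ * ((2 * (2 * a - 1) + 1) * (D * (2 / (1 - p ^ 2))))
        + t⁻¹ * (t ^ 2 * (E * (2 * Λ + 4 * F * B₀ + 8 * F * (5 / (2 * s)) * t⁻¹ * Λ / (1 - p ^ 2))))
      ≤ (60 * D * (1 + F) / (1 - p ^ 2) ^ 2 + 4 * (F + Λ) ^ 2 / (p⁻¹ - p) + 8 * B₀ * (F + Λ)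
        + 4 * (F + Λ) / p) * (S * t⁻¹) * ℓ := by
  have hδ1 : 1 - p ^ 2 ≤ 1 := by nlinarith
  have hδ0 : 0 < 1 - p ^ 2 := by nlinarith
  have e0 : p⁻¹ - p = (1 - p ^ 2) / p := by field_simp
  rw [e0]
  set δ := 1 - p ^ 2
  set u := s⁻¹ with hu
  set w := t⁻¹ with hw
  have ht0 : 0 < t := by linarith
  have hu0 : 0 < u := inv_pos.2 hs
  have hw0 : 0 < w := inv_pos.2 ht0
  have htw : t * w = 1 := mul_inv_cancel₀ ht0.ne'
  have hw4 : w ≤ 1 / 4 := by rw [hw, ← one_div]; exact one_div_le_one_div_of_le (by norm_num) ht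
  have huS : u ≤ S := by nlinarith [sq_nonneg (u - 1)]
  set d := δ⁻¹ with hd
  have hd1 : 1 ≤ d := (one_le_inv₀ hδ0).2 hδ1
  have hd0 : 0 < d := by linarith
  have a1 : 5 / (2 * s) * (t ^ 2 * D * E ^ 2 + D * (20 * ℓ) / (δ ^ 2 * t))
      ≤ 60 * D / δ ^ 2 * (S * w) * ℓ := by
    have h1 : t ^ 2 * D * E ^ 2 ≤ D * w * (d ^ 2 * ℓ) := by
      have h2 : t ^ 2 * E ^ 2 ≤ w * w := by
        calc t ^ 2 * E ^ 2 ≤ t ^ 2 * (w ^ 2) ^ 2 := by gcongr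
          _ = (t * w) ^ 2 * (w * w) := by ring
          _ = w * w := by rw [htw]; ring
      have h3 : 1 ≤ d ^ 2 * ℓ := by nlinarith [one_le_pow₀ hd1 (n := 2)]
      calc t ^ 2 * D * E ^ 2 = D * (t ^ 2 * E ^ 2) := by ring
        _ ≤ D * (w * 1) := mul_le_mul_of_nonneg_left
          (h2.trans (mul_le_mul_of_nonneg_left (by linarith) hw0.le)) hD
        _ ≤ D * (w * (d ^ 2 * ℓ)) := by gcongr
        _ = _ := by ring
    have e1 : D * (20 * ℓ) / (δ ^ 2 * t) = 20 * (D * w * (d ^ 2 * ℓ)) := by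
      rw [hd, hw]; field_simp
    have e2 : 60 * D / δ ^ 2 * (S * w) * ℓ = 60 * S * (D * w * (d ^ 2 * ℓ)) := by
      rw [hd]; field_simp
    have e3 : 5 / (2 * s) = 5 / 2 * u := by rw [hu]; field_simp
    rw [e1, e2, e3]
    have hY : 0 ≤ D * w * (d ^ 2 * ℓ) := by positivity
    calc _ ≤ 5 / 2 * u * (D * w * (d ^ 2 * ℓ) + 20 * (D * w * (d ^ 2 * ℓ))) := by gcongr
      _ = 52.5 * u * (D * w * (d ^ 2 * ℓ)) := by ring
      _ ≤ 60 * S * (D * w * (d ^ 2 * ℓ)) := by gcongr; norm_num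
  have a2 : 4 / s ^ 2 / 2 * (2 * F) * w * ((2 * (2 * a - 1) + 1) * (D * (2 / δ)))
      ≤ 60 * D * F / δ ^ 2 * (S * w) * ℓ := by
    -- The left side is `4a - 1 ≤ 4ℓd + 3`, and `ℓd ≥ 1`.
    have h1 : 2 * (2 * a - 1) + 1 ≤ 7 * (ℓ * d) := by
      rw [div_eq_mul_inv, ← hd] at ha
      nlinarith
    have e1 : 4 / s ^ 2 / 2 * (2 * F) * w * ((2 * (2 * a - 1) + 1) * (D * (2 / δ)))
        = 8 * (F * w * D * d) * (u ^ 2 * (2 * (2 * a - 1) + 1)) := by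
      rw [hu, hd]; field_simp; ring
    have e2 : 60 * D * F / δ ^ 2 * (S * w) * ℓ = 8 * (F * w * D * d) * (S * (7.5 * (ℓ * d))) := by
      rw [hd]; field_simp; ring
    rw [e1, e2]
    have h2 : u ^ 2 * (2 * (2 * a - 1) + 1) ≤ S * (7.5 * (ℓ * d)) := by
      calc _ ≤ u ^ 2 * (7 * (ℓ * d)) := by gcongr
        _ ≤ S * (7.5 * (ℓ * d)) := by gcongr; norm_num
    gcongr
  have hSw : w ≤ S * w * ℓ := by
    calc w = 1 * w * 1 := by ring
      _ ≤ S * w * ℓ := by gcongr; linarith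
  have htE : t * E ≤ S * w * ℓ := by
    refine le_trans ?_ hSw
    calc t * E ≤ t * w ^ 2 := by gcongr
      _ = t * w * w := by ring
      _ = w := by rw [htw, one_mul]
  have a3 : t * E * (2 * Λ) ≤ 4 * (F + Λ) / p * (S * w) * ℓ := by
    have h1 : 2 * Λ ≤ 4 * (F + Λ) / p := by
      have := mul_le_mul_of_nonneg_left hp1.le hΛ
      rw [le_div_iff₀ hp0]; linarith
    calc _ ≤ (S * w * ℓ) * (4 * (F + Λ) / p) := by gcongr
      _ = _ := by ring
  have a4 : t * E * (4 * F * B₀) ≤ 8 * B₀ * (F + Λ) * (S * w) * ℓ := by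
    have h1 : 4 * F * B₀ ≤ 8 * B₀ * (F + Λ) := by linarith [mul_nonneg hF hB₀, mul_nonneg hΛ hB₀]
    calc _ ≤ (S * w * ℓ) * (8 * B₀ * (F + Λ)) := by gcongr
      _ = _ := by ring
  have a5 : t * E * (8 * F * (5 / (2 * s)) * w * Λ / δ)
      ≤ 4 * (F + Λ) ^ 2 / (δ / p) * (S * w) * ℓ := by
    have e1 : t * E * (8 * F * (5 / (2 * s)) * w * Λ / δ) = 20 * (F * Λ) * d * (t * w) * u * E := by
      rw [hu, hd]; field_simp; ring
    have e2 : 4 * (F + Λ) ^ 2 / (δ / p) * (S * w) * ℓ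
        = 4 * ℓ * (F + Λ) ^ 2 * d * S * (p * w) := by rw [hd]; field_simp
    rw [e1, e2, htw, mul_one]
    have h1 : 20 * (F * Λ) ≤ 4 * ℓ * (F + Λ) ^ 2 := by
      have := mul_le_mul_of_nonneg_right (by linarith : 5 ≤ 4 * ℓ) (sq_nonneg (F + Λ))
      linarith [sq_nonneg (F - Λ)]
    gcongr
  have e : t⁻¹ * (t ^ 2 * (E * (2 * Λ + 4 * F * B₀ + 8 * F * (5 / (2 * s)) * w * Λ / δ)))
      = t * E * (2 * Λ) + t * E * (4 * F * B₀) + t * E * (8 * F * (5 / (2 * s)) * w * Λ / δ) := by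
    have : t⁻¹ * t ^ 2 = t := by field_simp
    rw [← mul_assoc, this]; ring
  rw [← hw] at e
  rw [e]
  have e' : (60 * D * (1 + F) / δ ^ 2 + 4 * (F + Λ) ^ 2 / (δ / p) + 8 * B₀ * (F + Λ)
        + 4 * (F + Λ) / p) * (S * w) * ℓ
      = 60 * D / δ ^ 2 * (S * w) * ℓ + 60 * D * F / δ ^ 2 * (S * w) * ℓ
        + (4 * (F + Λ) / p * (S * w) * ℓ + 8 * B₀ * (F + Λ) * (S * w) * ℓ
          + 4 * (F + Λ) ^ 2 / (δ / p) * (S * w) * ℓ) := by ring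
  rw [e']
  linarith

theorem CorrelationDecay.decayingCorrelations {μ : Measure S1} {T : ℕ → ExpandingMap lam A}
    {f : S1 → ℝ} {q C₂ C₄ : ℝ} (h : CorrelationDecay μ T f q C₂ C₄) (hq : 0 ≤ q) (hC₄ : 0 ≤ C₄) :
    DecayingCorrelations μ (centered μ T f) q (max C₂ (Real.sqrt C₄)) := by
  have h4 : C₄ ≤ max C₂ (Real.sqrt C₄) ^ 2 := by
    calc C₄ = Real.sqrt C₄ ^ 2 := (Real.sq_sqrt hC₄).symm
      _ ≤ _ := pow_le_pow_left₀ (Real.sqrt_nonneg _) (le_max_right _ _) 2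
  exact ⟨fun i j hij => (h.two i j hij).trans (by gcongr; exact le_max_left _ _),
    fun i j k l h1 h2 h3 => (h.four i j k l h1 h2 h3).trans (by gcongr),
    fun i j k l h1 h2 h3 => (h.split i j k l h1 h2 h3).trans (by gcongr)⟩

theorem tildeC_eq {q C₂ C₄ B₀ : ℝ} {f : S1 → ℝ} (hq : 0 ≤ q) :
    tildeC q C₂ C₄ B₀ f = 60 * max C₂ (Real.sqrt C₄) * (1 + supNorm f) / (1 - q) ^ 2
      + 4 * (supNorm f + lipConst f) ^ 2 / ((Real.sqrt q)⁻¹ - Real.sqrt q)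
      + 8 * B₀ * (supNorm f + lipConst f) + 4 * (supNorm f + lipConst f) / Real.sqrt q := by
  rw [tildeC, Real.rpow_neg hq, ← Real.sqrt_eq_rpow, lipNorm]

theorem pow_le_exp_neg {q : ℝ} (hq : 0 ≤ q) (a : ℕ) : q ^ a ≤ Real.exp (-((1 - q) * a)) := by
  have h := Real.add_one_le_exp (-(1 - q))
  calc q ^ a ≤ Real.exp (-(1 - q)) ^ a := pow_le_pow_left₀ hq (by linarith) a
    _ = _ := by rw [← Real.exp_nat_mul]; congr 1; ring

section
variable {L₀ : ℝ≥0} {ϱ f : S1 → ℝ} {q B₀ C₂ C₄ S : ℝ} {N : ℕ}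

/-- The bound for differentiable test functions. -/
theorem abs_integral_sub_integral_gaussian_le (hlam : 1 < lam) (hML : MemoryLoss lam A L₀ q B₀)
    (hB₀ : 0 < B₀) (hC₂ : 0 < C₂) (hC₄ : 0 < C₄) (T : ℕ → ExpandingMap lam A)
    (hϱ : IsInitialDensity L₀ ϱ) (hf : ∃ K : ℝ≥0, LipschitzWith K f) (hq : lam⁻¹ ≤ q) (hq1 : q < 1)
    (hcorr : CorrelationDecay (initialMeasure ϱ) T f q C₂ C₄) (hN : 16 ≤ N)
    (hs : 0 < sigma (initialMeasure ϱ) T f N) (hS : 1 ≤ S)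
    (hsS : (sigma (initialMeasure ϱ) T f N)⁻¹ ^ 2 ≤ S) {h h' : ℝ → ℝ}
    (hd : ∀ x, HasDerivAt h (h' x) x) (hb : ∀ x, |h' x| ≤ 1) :
    |(∫ x, h (normalizedSum (initialMeasure ϱ) T f N x) ∂initialMeasure ϱ)
        - ∫ z, h (sigma (initialMeasure ϱ) T f N * z) ∂gaussianReal 0 1|
      ≤ tildeC q C₂ C₄ B₀ f * (S * (Real.sqrt N)⁻¹) * Real.log N := by
  have := hϱ.isProbabilityMeasure
  set μ := initialMeasure ϱ with hμ
  set s := sigma μ T f N with hs'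
  set W := normalizedSum μ T f N with hW
  have hq0 : 0 < q := lt_of_lt_of_le (inv_pos.2 (by linarith)) hq
  have hfc : Continuous f := hf.choose_spec.continuous
  have hXc := fun n => continuous_centered μ T hfc n
  have hWc : Continuous W :=
    continuous_const.mul (continuous_finsetSum _ fun i _ => hXc i)
  have hs2 : ∫ x, W x ^ 2 ∂μ = s ^ 2 :=
    (Real.sq_sqrt (integral_nonneg fun x => sq_nonneg _)).symm
  obtain ⟨g, g', g'', d1, d2, b0, b1, b2, hg⟩ := exists_stein_solution_scaled hd hb hs
  have hgc : Continuous g := continuous_iff_continuousAt.2 fun x => (d1 x).continuousAt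
  have hhc : Continuous h := continuous_iff_continuousAt.2 fun x => (hd x).continuousAt
  have hgL : ∀ x y, |g x - g y| ≤ 5 / (2 * s) * |x - y| := fun x y =>
    Convex.norm_image_sub_le_of_norm_hasDerivWithin_le (fun z _ => (d1 z).hasDerivWithinAt)
      (fun z _ => b1 z) convex_univ (Set.mem_univ y) (Set.mem_univ x)
  set D := max C₂ (Real.sqrt C₄) with hD
  have hD0 : 0 < D := lt_max_of_lt_left hC₂
  set p := Real.sqrt q with hp
  have hpq : p ^ 2 = q := Real.sq_sqrt hq0.le
  have hp0 : 0 < p := Real.sqrt_pos.2 hq0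
  have hp1 : p < 1 := by rw [hp, Real.sqrt_lt' one_pos]; simpa using hq1
  have hNr : (16 : ℝ) ≤ N := by exact_mod_cast hN
  have hN0 : (0 : ℝ) < N := by linarith
  set t := Real.sqrt N with ht
  have ht2 : t ^ 2 = N := Real.sq_sqrt hN0.le
  have ht4 : 4 ≤ t := Real.le_sqrt_of_sq_le (by linarith)
  set ℓ := Real.log N with hℓ
  have hℓ1 : 2.77 ≤ ℓ := by
    have h1 : Real.log 16 ≤ ℓ := Real.log_le_log (by norm_num) hNr
    have h2 : Real.log 16 = 4 * Real.log 2 := by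
      rw [show (16 : ℝ) = 2 ^ 4 by norm_num, Real.log_pow]; norm_num
    have h3 := Real.log_two_gt_d9
    linarith
  have h1q : 0 < 1 - q := by linarith
  -- The shortest length for which `q^a ≤ e^{-(1-q)a}` yields `q^a ≤ 1/N`.
  set a := ⌈ℓ / (1 - q)⌉₊ with ha
  have ha1 : ℓ / (1 - q) ≤ a := Nat.le_ceil _
  have ha2 : a ≤ ℓ / (1 - q) + 1 := (Nat.ceil_lt_add_one (by positivity)).le
  have ha0 : 0 < a := Nat.ceil_pos.2 (by positivity)
  have hE1 : q ^ a ≤ t⁻¹ ^ 2 := by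
    refine (pow_le_exp_neg hq0.le a).trans ?_
    rw [inv_pow, ht2, ← Real.exp_log (inv_pos.2 hN0), Real.log_inv]
    refine Real.exp_le_exp.2 (neg_le_neg ?_)
    rwa [div_le_iff₀ h1q, mul_comm] at ha1
  -- Splitting `q^a = p^a p^a` keeps one factor `p`, which the term of the constant with `p⁻¹ - p`
  -- in its denominator requires.
  have hE2 : q ^ a ≤ p * t⁻¹ := by
    have h1 : p ^ a ≤ t⁻¹ := by
      refine le_of_sq_le_sq ?_ (by positivity)
      rw [← pow_mul, mul_comm, pow_mul, hpq]; exact hE1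
    have h2 : p ^ a ≤ p := pow_le_of_le_one hp0.le hp1.le ha0.ne'
    calc q ^ a = p ^ a * p ^ a := by rw [← hpq, ← pow_mul, mul_comm, pow_mul, sq]
      _ ≤ p * t⁻¹ := mul_le_mul h2 h1 (by positivity) hp0.le
  set K := 2 * a - 1 with hK
  have hKr : (K : ℝ) = 2 * a - 1 := by
    rw [hK, Nat.cast_sub (by omega)]; push_cast; ring
  -- The `L²` bound asks for `V` of order `√(K/N)`; this larger choice is already of the final form
  -- `log N/√N`. The factor `1 - p` is traded for `1 - q` through `1 - p ≥ (1 - q)/2`.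
  have hVle : 48 * (2 * (K : ℝ) + 1) * D ^ 2 / (1 - p) ^ 2
      ≤ (D * (20 * ℓ) / ((1 - p ^ 2) ^ 2 * t)) ^ 2 * N := by
    rw [← ht2]
    have hδ1 : 1 - q ≤ 1 := by linarith
    have hd1 : 1 ≤ (1 - q)⁻¹ := (one_le_inv₀ h1q).2 hδ1
    have h1 : (1 - q) / 2 ≤ 1 - p := by rw [← hpq]; linarith [sq_nonneg (1 - p)]
    have e1 : (D * (20 * ℓ) / ((1 - p ^ 2) ^ 2 * t)) ^ 2 * t ^ 2
        = 4 * D ^ 2 * ((1 - q)⁻¹ ^ 2) * (100 * (ℓ * (1 - q)⁻¹) ^ 2) := by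
      rw [hpq]; field_simp; ring
    have h2 : 48 * (2 * (K : ℝ) + 1) ≤ 100 * (ℓ * (1 - q)⁻¹) ^ 2 := by
      rw [div_eq_mul_inv] at ha2
      rw [hKr]
      have h3 : 2.77 ≤ ℓ * (1 - q)⁻¹ :=
        hℓ1.trans (le_mul_of_one_le_right (by linarith) hd1)
      have h4 := mul_le_mul_of_nonneg_right h3 ((by norm_num : (0 : ℝ) ≤ 2.77).trans h3)
      linarith
    rw [e1, div_le_iff₀ (pow_pos (by linarith) 2)]
    have h3 : 1 ≤ 4 * (1 - q)⁻¹ ^ 2 * (1 - p) ^ 2 := by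
      have h4 := pow_le_pow_left₀ (by positivity) h1 2
      calc (1 : ℝ) = 4 * (1 - q)⁻¹ ^ 2 * ((1 - q) / 2) ^ 2 := by field_simp; norm_num
        _ ≤ _ := by gcongr
    calc _ = 48 * (2 * (K : ℝ) + 1) * D ^ 2 * 1 := by ring
      _ ≤ 100 * (ℓ * (1 - q)⁻¹) ^ 2 * D ^ 2 * (4 * (1 - q)⁻¹ ^ 2 * (1 - p) ^ 2) := by gcongr
      _ = _ := by ring
  have hV0 : 0 < D * (20 * ℓ) / ((1 - p ^ 2) ^ 2 * t) := by
    rw [hpq]; positivity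
  have key := stein_block_bound (μ := μ) hXc (fun n x => abs_recentered_le μ T hfc n _)
    (hcorr.decayingCorrelations hq0.le hC₄.le) hD0 hp0.le hp1 hpq d1 d2 b1 b2 (by omega) K hV0 hVle
    (W := W) (fun x => rfl)
  have e1 : ∫ x, ((∫ y, W y ^ 2 ∂μ) * g' (W x) - W x * g (W x)) ∂μ
      = (∫ x, h (W x) ∂μ) - ∫ z, h (s * z) ∂gaussianReal 0 1 := by
    rw [hs2]
    simp only [hg]
    have hhW : Continuous fun x => h (W x) := hhc.comp hWc
    rw [integral_sub (integrable_of_continuous μ hhW) (integrable_const _)]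
    simp
  rw [e1] at key
  refine key.trans ?_
  have hsum : ∑ n ∈ Finset.range N, |∫ x, centered μ T f n x * g (W x - (Real.sqrt N)⁻¹
      * ∑ i ∈ Finset.range N, bandWeight K n i * centered μ T f i x) ∂μ|
      ≤ N * (q ^ a * (2 * lipConst f + 4 * supNorm f * B₀
        + 8 * supNorm f * (5 / (2 * s)) * (Real.sqrt N)⁻¹ * lipConst f / (1 - q))) := by
    refine (Finset.sum_le_sum fun n hn => abs_integral_centered_mul_block_le hlam hML hB₀.le T hϱ hf
      hq hq1 hgc b0 hgL (by positivity) ha0 (Finset.mem_range.1 hn)).trans (le_of_eq ?_)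
    rw [Finset.sum_const, Finset.card_range, nsmul_eq_mul]
  have hfin := stein_bound_arithmetic (D := D) (F := supNorm f) (Λ := lipConst f) hD0.le
    (supNorm_nonneg f) (lipConst_nonneg f) hB₀.le hs hS hsS hℓ1 ht4 hp0 hp1 (a := a)
    (by rw [hpq]; exact ha2) (by positivity) hE1 hE2
  rw [tildeC_eq hq0.le, ← hp, ← hD]
  rw [hpq, ht2] at hfin
  rw [hpq, hKr, show K + 1 = a * 2 by omega, pow_mul]
  refine le_trans ?_ hfin
  gcongr

/-- The bound for the Wasserstein distance. -/
theorem wassersteinDist_le (hlam : 1 < lam) (hML : MemoryLoss lam A L₀ q B₀)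
    (hB₀ : 0 < B₀) (hC₂ : 0 < C₂) (hC₄ : 0 < C₄) (T : ℕ → ExpandingMap lam A)
    (hϱ : IsInitialDensity L₀ ϱ) (hf : ∃ K : ℝ≥0, LipschitzWith K f) (hq : lam⁻¹ ≤ q) (hq1 : q < 1)
    (hcorr : CorrelationDecay (initialMeasure ϱ) T f q C₂ C₄) (hN : 16 ≤ N)
    (hs : 0 < sigma (initialMeasure ϱ) T f N) (hS : 1 ≤ S)
    (hsS : (sigma (initialMeasure ϱ) T f N)⁻¹ ^ 2 ≤ S) :
    wassersteinDist (initialMeasure ϱ) (normalizedSum (initialMeasure ϱ) T f N)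
        (gaussianReal 0 1) (fun z => sigma (initialMeasure ϱ) T f N * z)
      ≤ ENNReal.ofReal (tildeC q C₂ C₄ B₀ f * (S * (Real.sqrt N)⁻¹) * Real.log N) := by
  have := hϱ.isProbabilityMeasure
  refine iSup₂_le fun h hh => ENNReal.ofReal_le_ofReal (le_of_forall_pos_le_add fun ε hε => ?_)
  -- Replacing `h` by `g` changes each of the two expectations by at most `ε/2`.
  obtain ⟨g, g', hd, hb, hgh⟩ := exists_smooth_approx hh (half_pos hε)
  have hmain := abs_integral_sub_integral_gaussian_le hlam hML hB₀ hC₂ hC₄ T hϱ hf hq hq1 hcorr hN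
    hs hS hsS hd hb
  set μ := initialMeasure ϱ
  set s := sigma μ T f N
  have hfc : Continuous f := hf.choose_spec.continuous
  have hWc : Continuous (normalizedSum μ T f N) :=
    continuous_const.mul (continuous_finsetSum _ fun i _ => continuous_centered μ T hfc i)
  have hgL : LipschitzWith 1 g := lipschitzWith_of_nnnorm_deriv_le
    (fun x => (hd x).differentiableAt) fun x => by
      rw [(hd x).deriv, ← NNReal.coe_le_coe]; exact hb x
  have approx : ∀ {Ω : Type} [MeasurableSpace Ω] (P : Measure Ω) [IsProbabilityMeasure P]
      (X : Ω → ℝ), Integrable (fun ω => g (X ω)) P → Integrable (fun ω => h (X ω)) P →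
      |(∫ ω, g (X ω) ∂P) - ∫ ω, h (X ω) ∂P| ≤ ε / 2 := by
    intro Ω _ P _ X i1 i2
    rw [← integral_sub i1 i2]
    have := norm_integral_le_of_norm_le_const (μ := P) (f := fun ω => g (X ω) - h (X ω))
      (Filter.Eventually.of_forall fun ω => hgh (X ω))
    simpa using this
  have hsL : LipschitzWith (Real.nnabs s) (fun z : ℝ => s * z) := LipschitzWith.of_dist_le_mul
    fun x y => by rw [Real.dist_eq, Real.dist_eq, ← mul_sub, abs_mul, Real.coe_nnabs]
  have k1 := approx μ (normalizedSum μ T f N)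
    (integrable_of_continuous μ (hgL.continuous.comp hWc))
    (integrable_of_continuous μ (hh.continuous.comp hWc))
  have k2 := approx (gaussianReal 0 1) (fun z => s * z)
    (integrable_gaussian_of_lipschitz (hgL.comp hsL))
    (integrable_gaussian_of_lipschitz (hh.comp hsL))
  rw [abs_le] at hmain k1 k2 ⊢
  constructor <;> linarith [k1.1, k1.2, k2.1, k2.2, hmain.1, hmain.2]

end

end CircleCLT

open MeasureTheory ProbabilityTheory CircleCLT
open scoped NNReal ENNReal
/-- Central limit theorem with a rate, in the Wasserstein distance, for time-dependent expanding
circle maps. The first part: the constants `ϑ(lam, A)`, `B₀(L₀, lam, A)` and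
`C₂, C₄ (lam, A, ‖f‖_Lip, L₀)` exist. The second part: the bound, for every choice of such
constants. -/
theorem theorem3p2 (lam A : ℝ) (hlam : 1 < lam) :
    (∃ ϑ : ℝ, lam⁻¹ ≤ ϑ ∧ ϑ < 1 ∧
      ∀ L₀ : ℝ≥0,
        (∃ B₀ : ℝ, 0 < B₀ ∧ MemoryLoss lam A L₀ ϑ B₀) ∧
        ∀ M : ℝ, ∃ C₂ C₄ : ℝ, 0 < C₂ ∧ 0 < C₄ ∧
          ∀ (T : ℕ → ExpandingMap lam A) (ϱ : S1 → ℝ) (f : S1 → ℝ),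
            IsInitialDensity L₀ ϱ → (∃ K : ℝ≥0, LipschitzWith K f) → lipNorm f ≤ M →
            CorrelationDecay (initialMeasure ϱ) T f ϑ C₂ C₄) ∧
    ∀ (ϑ : ℝ), lam⁻¹ ≤ ϑ → ϑ < 1 →
      ∀ (L₀ : ℝ≥0) (B₀ C₂ C₄ : ℝ), 0 < B₀ → 0 < C₂ → 0 < C₄ →
      MemoryLoss lam A L₀ ϑ B₀ →
      ∀ (T : ℕ → ExpandingMap lam A) (ϱ : S1 → ℝ) (f : S1 → ℝ),
        IsInitialDensity L₀ ϱ → (∃ K : ℝ≥0, LipschitzWith K f) →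
        CorrelationDecay (initialMeasure ϱ) T f ϑ C₂ C₄ →
        ∀ (N : ℕ) (C₀ p : ℝ), 16 / (1 - ϑ) ^ 2 ≤ (N : ℝ) → 0 < C₀ → 0 ≤ p →
          C₀ * (N : ℝ) ^ (-p) ≤ sigma (initialMeasure ϱ) T f N →
          wassersteinDist (initialMeasure ϱ) (normalizedSum (initialMeasure ϱ) T f N)
              (gaussianReal 0 1) (fun z => sigma (initialMeasure ϱ) T f N * z)
            ≤ ENNReal.ofReal (tildeC ϑ C₂ C₄ B₀ f * max 1 (C₀ ^ (-2 : ℤ))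
                * (N : ℝ) ^ (-(1 / 2 : ℝ) + 2 * p) * Real.log N) := by
  refine ⟨exists_decay_constants hlam A, ?_⟩
  intro ϑ hϑ hϑ1 L₀ B₀ C₂ C₄ hB₀ hC₂ hC₄ hML T ϱ f hϱ hf hcorr N C₀ p hN hC₀ hp hσ
  have hϑ0 : 0 < ϑ := lt_of_lt_of_le (inv_pos.2 (by linarith)) hϑ
  have hN16 : (16 : ℝ) ≤ N := by
    refine le_trans ?_ hN
    rw [le_div_iff₀ (by nlinarith)]
    nlinarith
  have hN0 : (0 : ℝ) < N := by linarith
  have hNp : 0 < (N : ℝ) ^ (-p) := Real.rpow_pos_of_pos hN0 _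
  have e1 : (N : ℝ) ^ (2 * p) = ((N : ℝ) ^ (-p))⁻¹ ^ 2 := by
    rw [Real.rpow_neg hN0.le, inv_inv, ← Real.rpow_natCast, ← Real.rpow_mul hN0.le]
    congr 1; push_cast; ring
  have e2 : C₀ ^ (-2 : ℤ) = C₀⁻¹ ^ 2 := by
    rw [zpow_neg, inv_pow]; norm_cast
  have h2p : 1 ≤ (N : ℝ) ^ (2 * p) := Real.one_le_rpow (by linarith) (by linarith)
  have hpos : 0 < C₀ * (N : ℝ) ^ (-p) := mul_pos hC₀ hNp
  have main := wassersteinDist_le hlam hML hB₀ hC₂ hC₄ T hϱ hf hϑ hϑ1 hcorr (N := N)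
    (by exact_mod_cast hN16) (hpos.trans_le hσ)
    -- The lower bound on `σ_N` gives `σ_N⁻² ≤ C₀⁻² N^{2p}`; the maximum with one makes `S` dominate
    -- `σ_N⁻¹` as well.
    (S := max 1 (C₀ ^ (-2 : ℤ)) * (N : ℝ) ^ (2 * p)) (one_le_mul_of_one_le_of_one_le
      (le_max_left _ _) h2p) (by
      calc _ ≤ (C₀ * (N : ℝ) ^ (-p))⁻¹ ^ 2 := by
            have := inv_anti₀ hpos hσ
            gcongr
            exact inv_nonneg.2 (Real.sqrt_nonneg _)
        _ = C₀ ^ (-2 : ℤ) * (N : ℝ) ^ (2 * p) := by rw [e1, e2, mul_inv, mul_pow]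
        _ ≤ _ := by gcongr; exact le_max_right _ _)
  refine main.trans (le_of_eq ?_)
  congr 2
  rw [Real.rpow_add hN0, Real.rpow_neg hN0.le, ← Real.sqrt_eq_rpow]
  ring
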